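/- **Setting.** Let $d\ge 1$, let $\mathcal X\subseteq\mathbb R^d$ be closed and convex, let $\xi$ be a random sample with law $P$, and let $f(\cdot;\xi):\mathbb R^d\to\mathbb R$ be component functions with objective $f(x)=\mathbb E_\xi f(x;\xi)$, to be minimized over $\mathcal X$. For $\mu>0$ put $$\hat\nabla f(x;\xi,u)=\frac{f(x+\mu u;\xi)-f(x;\xi)}{\mu/d}\,u ,\qquad f_\mu(x)=\mathbb E_{w}\,f(x+\mu w),$$ with $u$ uniform on the unit sphere and $w$ uniform on the unit ball of $\mathbb R^d$. Assume, for constants $L,\sigma>0$: * for some $\delta>\mu$, on the open $\delta$-neighbourhood of $\mathcal X$ every $f(x;\cdot)$ is integrable and every $f(\cdot;\xi)$ is differentiable with $\|\nabla f(x;\xi)-\nabla f(x';\xi)\|\le L\|x-x'\|$; * $\mathbb E_{\xi,u}\|\hat\nabla f(x;\xi,u)-\nabla f_\mu(x)\|^2\le\sigma^2$ for all $x\in\mathcal X$; * $f^*$ is a real number with $f(x+\mu w)\ge f^*$ for all $x\in\mathcal X$, $\|w\|\le 1$. **Algorithm (Acc-ZOM).** Let $(\xi_t,u_t)_{t\ge1}$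 be independent, with $\xi_t\sim P$ and $u_t$ uniform on the unit sphere, independent of $\xi_t$. Start from $x_1\in\mathcal X$ and $v_1=\hat\nabla f(x_1;\xi_1,u_1)$. For $t=1,\dots,T$, with $\eta_t=k/(m+t)^{1/3}$ and $\alpha_{t+1}=c\eta_t^2$, put $$\tilde x_{t+1}=\mathcal P_{\mathcal X}(x_t-\gamma v_t),\quad x_{t+1}=x_t+\eta_t(\tilde x_{t+1}-x_t),$$ $$v_{t+1}=\hat\nabla f(x_{t+1};\xi_{t+1},u_{t+1})+(1-\alpha_{t+1})\big[v_t-\hat\nabla f(x_t;\xi_{t+1},u_{t+1})\big],$$ where $\mathcal P_{\mathcal X}$ is the Euclidean projection. Let $\mathcal G_t=\|\nabla f(x_t)-v_t\|+\frac1\gamma\|\tilde x_{t+1}-x_t\|$, and let $\zeta$ be uniform on $\{1,\dots,T\}$ and independent of the samples. Each iteration uses one fresh sample. **Theorem.** Let $T\ge1$ and let the real parameters satisfy $k>0$, $c\ge\frac{2}{3k^3}+\frac54$, $m\ge\max(2,(ck)^3,k^3)$, $0<\gamma\le\min\big(\frac{m^{1/3}}{2Lk},\frac1{2\sqrt{6d}L}\big)$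 and $0<\mu\le\frac1{d(m+T)^{2/3}}$. (1) All $\mathcal G_t$ with $1\le t\le T$ and $\mathcal G_\zeta$ are integrable, and $$\mathbb E[\mathcal G_\zeta]=\frac1T\sum_{t=1}^T\mathbb E\Big[\|\nabla f(x_t)-v_t\|+\frac1\gamma\|\tilde x_{t+1}-x_t\|\Big]\le\frac{2\sqrt{2M}\,m^{1/6}}{T^{1/2}}+\frac{2\sqrt{2M}}{T^{1/3}}+\frac{L}{2(m+T)^{2/3}},$$ $$M=\frac{f_\mu(x_1)-f^*}{k\gamma}+\frac{m^{1/3}\sigma^2}{k^2}+\frac{9L^2}{4k^2}+2k^2c^2\sigma^2\ln(m+T).$$ (2) For fixed $L,\sigma,k,c,m,\Delta$ and $\gamma_0>0$ there is a constant $C$, independent of the dimension and the accuracy, such that for all $d\ge1$ and $0<\varepsilon\le1$ there is a $T\ge1$ for which the following holds for every problem and every $\gamma,\mu,x_1,f^*$ as above with $\gamma\ge\gamma_0/\sqrt d$ and $f_\mu(x_1)-f^*\le\Delta$: the whole run of $T$ iterations makes at most $$C\,d^{3/4}\varepsilon^{-3}\,\ln(2+d/\varepsilon)^{3/2}=\tilde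 O(d^{3/4}\varepsilon^{-3})$$ evaluations of component functions $f(\cdot;\xi)$, and $\mathbb E[\mathcal G_\zeta]\le\varepsilon$. -/

import Mathlib

open MeasureTheory ProbabilityTheory
open scoped ENNReal Gradient

universe uX uO

noncomputable section

namespace AccZOM

/-- The space `ℝ^d` with the Euclidean norm. -/
abbrev Vec (d : ℕ) : Type := EuclideanSpace ℝ (Fin d)

/-- The unit sphere of `ℝ^d`. -/
abbrev USphere (d : ℕ) : Type := Metric.sphere (0 : Vec d) 1

/-- The uniform distribution on the unit sphere: normalized surface measure. -/
def sphereUniform (d : ℕ) : Measure (USphere d) :=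
  ((volume : Measure (Vec d)).toSphere Set.univ)⁻¹ • (volume : Measure (Vec d)).toSphere

/-- The smoothing `f_μ(x) = E[f(x + μ w)]`, with `w` uniform on the unit ball. -/
def smoothing {d : ℕ} (μ : ℝ) (f : Vec d → ℝ) (x : Vec d) : ℝ :=
  ⨍ w in Metric.closedBall (0 : Vec d) 1, f (x + μ • w)

open Classical in
/-- The Euclidean projection onto `X`: a point of `X` nearest to `y` (it exists and is unique when
`X` is nonempty, closed and convex; `y` itself if there is no nearest point). -/
def proj {d : ℕ} (X : Set (Vec d)) (y : Vec d) : Vec d :=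
  if h : ∃ z ∈ X, ∀ w ∈ X, ‖z - y‖ ≤ ‖w - y‖ then h.choose else y

/-- A constrained stochastic problem `min_{x ∈ X} E_ξ[F(x; ξ)]`, where `ξ` has law `P`. -/
structure Problem (d : ℕ) (Ξ : Type*) [MeasurableSpace Ξ] where
  /-- the component functions `f(x; ξ)` -/
  F : Vec d → Ξ → ℝ
  /-- the distribution of the sample `ξ` -/
  P : Measure Ξ
  /-- the constraint set -/
  X : Set (Vec d)

/-- The parameters of the algorithm: `γ, k, m, c` and the smoothing parameter `μ`. -/
structure Params where
  γ : ℝ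
  k : ℝ
  m : ℝ
  c : ℝ
  μ : ℝ

/-- The step size `η_t = k / (m + t)^{1/3}`. -/
def Params.eta (p : Params) (t : ℕ) : ℝ := p.k / (p.m + t) ^ (1 / 3 : ℝ)

/-- A value together with the number of function evaluations spent on it. -/
structure Counted (α : Type*) where
  val : α
  cost : ℕ

/-- The state of the algorithm: the iterate, the gradient estimate, and the total number of
function evaluations made so far. -/
structure State (d : ℕ) where
  x : Vec d
  v : Vec d
  queries : ℕ

namespace Problem

variable {d : ℕ} {Ξ : Type*} [MeasurableSpace Ξ] (Q : Problem d Ξ)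

/-- The objective `f(x) = E_ξ[f(x; ξ)]`. -/
def obj (x : Vec d) : ℝ := ∫ ξ, Q.F x ξ ∂Q.P

/-- One call of the black-box oracle. -/
def query (x : Vec d) (ξ : Ξ) : Counted ℝ := ⟨Q.F x ξ, 1⟩

/-- The uniform smoothing gradient estimator `(f(x + μ u; ξ) - f(x; ξ)) / (μ / d) · u`. -/
def uniGE (μ : ℝ) (x : Vec d) (ξ : Ξ) (u : USphere d) : Counted (Vec d) :=
  let a := Q.query (x + μ • (u : Vec d)) ξ
  let b := Q.query x ξ
  ⟨((a.val - b.val) / (μ / d)) • (u : Vec d), a.cost + b.cost⟩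

/-- The standing assumptions, for component smoothness constant `L`, variance bound `σ ^ 2` and
smoothing parameter `μ`. The oracle is called within distance `μ` of `X`, so smoothness is required
on a `δ`-neighbourhood of `X` with `δ > μ`. -/
structure Regular (L σ μ : ℝ) : Prop where
  isProbabilityMeasure : IsProbabilityMeasure Q.P
  measurable : Measurable (Function.uncurry Q.F)
  isClosed : IsClosed Q.X
  convex : Convex ℝ Q.X
  smooth : ∃ δ, μ < δ ∧
    (∀ x ∈ Metric.thickening δ Q.X, Integrable (Q.F x) Q.P) ∧
    (∀ ξ, ∀ x ∈ Metric.thickening δ Q.X, DifferentiableAt ℝ (fun y => Q.F y ξ) x) ∧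
    (∀ ξ, ∀ x ∈ Metric.thickening δ Q.X, ∀ x' ∈ Metric.thickening δ Q.X,
      ‖∇ (fun y => Q.F y ξ) x - ∇ (fun y => Q.F y ξ) x'‖ ≤ L * ‖x - x'‖)
  variance : ∀ x ∈ Q.X,
    ∫⁻ s : Ξ × USphere d, ‖(Q.uniGE μ x s.1 s.2).val - ∇ (smoothing μ Q.obj) x‖ₑ ^ 2
      ∂(Q.P.prod (sphereUniform d)) ≤ ENNReal.ofReal (σ ^ 2)

/-- `x̃_{t+1} = P_X(x_t - γ v_t)`. -/
def xTilde (p : Params) (s : State d) : Vec d := proj Q.X (s.x - p.γ • s.v)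

/-- The initial state: `x_1` and `v_1`, from one sample. -/
def init (p : Params) (x₁ : Vec d) (ξ : Ξ) (u : USphere d) : State d :=
  let g := Q.uniGE p.μ x₁ ξ u
  ⟨x₁, g.val, g.cost⟩

/-- Iteration `t`, from `(x_t, v_t)` to `(x_{t+1}, v_{t+1})`, with the fresh sample `(ξ, u)`.
(If `X` is the whole space, then `x_{t+1} = x_t - γ η_t v_t`.) -/
def step (p : Params) (t : ℕ) (s : State d) (ξ : Ξ) (u : USphere d) : State d :=
  let x' := s.x + p.eta t • (Q.xTilde p s - s.x)
  let α := p.c * p.eta t ^ 2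
  let g' := Q.uniGE p.μ x' ξ u
  let g := Q.uniGE p.μ s.x ξ u
  ⟨x', g'.val + (1 - α) • (s.v - g.val), s.queries + g'.cost + g.cost⟩

/-- The Acc-ZOM algorithm on the samples `(ξ 0, u 0), (ξ 1, u 1), …`: the state after `n`
iterations, which holds `x_{n+1}`, `v_{n+1}` and the number of function evaluations so far. -/
def run (p : Params) (x₁ : Vec d) (ξ : ℕ → Ξ) (u : ℕ → USphere d) : ℕ → State d
  | 0 => Q.init p x₁ (ξ 0) (u 0)
  | n + 1 => Q.step p (n + 1) (run p x₁ ξ u n) (ξ (n + 1)) (u (n + 1))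

/-- The gap `‖∇f(x) - v‖ + ‖x̃ - x‖ / γ` of a state. -/
def gap (p : Params) (s : State d) : ℝ :=
  ‖∇ Q.obj s.x - s.v‖ + 1 / p.γ * ‖Q.xTilde p s - s.x‖

end Problem

/-- The random inputs of the algorithm with `T` iterations: independent samples `(ξ_t, u_t)`, with
`ξ_t` of law `P` and `u_t` uniform on the sphere and independent of `ξ_t`, and an output index `ζ`,
uniform on `T` values and independent of all samples. -/
structure IsSampling {d : ℕ} {Ξ Ω : Type*} [MeasurableSpace Ξ] [MeasurableSpace Ω]
    (P : Measure Ξ) (Pr : Measure Ω) (ξ : ℕ → Ω → Ξ) (u : ℕ → Ω → USphere d)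
    {T : ℕ} (ζ : Ω → Fin T) : Prop where
  isProbabilityMeasure : IsProbabilityMeasure Pr
  measurable_ξ : ∀ t, Measurable (ξ t)
  measurable_u : ∀ t, Measurable (u t)
  measurable_ζ : Measurable ζ
  law : ∀ t, Pr.map (fun ω => (ξ t ω, u t ω)) = P.prod (sphereUniform d)
  indep : iIndepFun (fun t ω => (ξ t ω, u t ω)) Pr
  law_ζ : ∀ i, Pr (ζ ⁻¹' {i}) = (T : ℝ≥0∞)⁻¹
  indep_ζ : IndepFun ζ (fun ω t => (ξ t ω, u t ω)) Pr

/-- The constant `M`, where `Δ` stands for `f_μ(x_1) - f^*`. -/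
def boundM (p : Params) (L σ Δ : ℝ) (T : ℕ) : ℝ :=
  Δ / (p.k * p.γ) + p.m ^ (1 / 3 : ℝ) * σ ^ 2 / p.k ^ 2 + 9 * L ^ 2 / (4 * p.k ^ 2)
    + 2 * p.k ^ 2 * p.c ^ 2 * σ ^ 2 * Real.log (p.m + T)

/-- The conditions on the parameters, for dimension `d` and `T` iterations. -/
structure Params.Valid (p : Params) (d T : ℕ) (L : ℝ) : Prop where
  k_pos : 0 < p.k
  c_ge : 2 / (3 * p.k ^ 3) + 5 / 4 ≤ p.c
  m_ge : max 2 (max ((p.c * p.k) ^ 3) (p.k ^ 3)) ≤ p.m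
  γ_pos : 0 < p.γ
  γ_le : p.γ ≤ min (p.m ^ (1 / 3 : ℝ) / (2 * L * p.k)) (1 / (2 * √(6 * d) * L))
  μ_pos : 0 < p.μ
  μ_le : p.μ ≤ 1 / (d * (p.m + T) ^ (2 / 3 : ℝ))

end AccZOM

end

/-! ### The divergence theorem on the unit ball. -/

section SphereDivergence

open Metric Set Filter Topology

variable {E : Type*} [NormedAddCommGroup E] [InnerProductSpace ℝ E]

/-! The analysis runs on the smoothing `f_μ`, for which the two-point estimator is unbiased, and
returns to `f` at the end at the cost of the bias `Lμd/2`. Unbiasedness is the divergence theorem on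
the unit ball (`LipschitzWith.integral_ball_lineDeriv`): differentiating the ball average yields a
sphere average, and the ratio of area to volume is the factor `d` of the estimator. The same theorem
applied to a linear function gives `E⟨a,u⟩² = ‖a‖²/d`. Hence the estimator at two points with a
common sample has mean square difference at most `3dL²‖y-x‖² + (3/2)d²L²μ²`, with `d` and not `d²`
in front of the distance.

Write `a n` for the mean square of `v - ∇f_μ(x)`, `D n` for that of `x̃ - x` and `φ n` for the mean
of `f_μ(x)`, all at state `n`, which holds `x_{n+1}` and `v_{n+1}`. Put `η = η_{n+1}` and `β = cη²`.
Two recursions carry the proof. Descent (`Regular.smoothing_step_le`): smoothness of `f_μ` and the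
variational inequality of the projection give `φ (n+1) ≤ φ n + ηγ a n - η/(2γ) D n`. Momentum
(`integral_norm_momentum_error_sq_le`): the new error is `1 - β` times the old one plus noise
centred given the past, so `a (n+1) ≤ (1-β)² a n` plus terms in `η² D n`, `μ²` and `β²σ²`.

In the potential `φ n + γ a n / η_n` the lower bound on `c` makes the contraction beat the growth of
`1/η_n`, and the bound `24dL²γ² ≤ 1` absorbs the new displacement term (`sum_le_of_recursion`). Each
step then leaves `γη/4 (a n + D n/γ²)`, up to remainders that sum to the smoothing term and the
logarithm in `M`. Telescoping gives `∑ (a n + D n/γ²) ≤ 4M(m+T)^{1/3}`, and Cauchy–Schwarz turns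
this into the bound on the gap.

For the complexity, `1/γ ≤ √d/γ₀` gives `M = O(√d log(m+T))`, so the gap is `O(d^{1/4} √(log(m+T))
T^{-1/3})`. Taking `T` of order `d^{3/4} ε^{-3} log(2+d/ε)^{3/2}` suffices, and an iteration costs
four evaluations. -/

theorem hasLineDerivAt_posPart_sub_norm {r : ℝ} {w : E} (v : E) (hw : w ≠ 0) (hr : ‖w‖ ≠ r) :
    HasLineDerivAt ℝ (fun w : E => max (r - ‖w‖) 0)
      (if ‖w‖ < r then -(inner ℝ w v / ‖w‖) else 0) w v := by
  have hc : Continuous fun t : ℝ => ‖w + t • v‖ := by fun_prop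
  have h0 : ‖w + (0 : ℝ) • v‖ = ‖w‖ := by simp
  have hn : HasDerivAt (fun t : ℝ => ‖w + t • v‖) (inner ℝ w v / ‖w‖) 0 := by
    have h1 : HasDerivAt (fun t : ℝ => w + t • v) v 0 := by
      simpa using ((hasDerivAt_id (0 : ℝ)).smul_const v).const_add w
    have h2 := h1.norm_sq
    have h3 := h2.sqrt (by simpa using hw)
    simp only [zero_smul, add_zero, Real.sqrt_sq (norm_nonneg _)] at h3
    convert h3 using 1
    field_simp
  unfold HasLineDerivAt
  split_ifs with h
  · have h4 : (fun t : ℝ => max (r - ‖w + t • v‖) 0) =ᶠ[𝓝 0] fun t => r - ‖w + t • v‖ := by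
      have : ∀ᶠ t in 𝓝 (0 : ℝ), ‖w + t • v‖ < r :=
        hc.continuousAt.eventually_lt continuousAt_const (by simpa using h)
      filter_upwards [this] with t ht
      exact max_eq_left (by linarith)
    exact (hn.const_sub r).congr_of_eventuallyEq h4
  · have h4 : (fun t : ℝ => max (r - ‖w + t • v‖) 0) =ᶠ[𝓝 0] fun _ => (0 : ℝ) := by
      have : ∀ᶠ t in 𝓝 (0 : ℝ), r < ‖w + t • v‖ :=
        continuousAt_const.eventually_lt hc.continuousAt
          (by simpa using lt_of_le_of_ne (not_lt.1 h) (Ne.symm hr))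
      filter_upwards [this] with t ht
      exact max_eq_right (by linarith)
    exact (hasDerivAt_const (0 : ℝ) (0 : ℝ)).congr_of_eventuallyEq h4

variable [MeasurableSpace E] [BorelSpace E] [FiniteDimensional ℝ E] [Nontrivial E]

/-- The origin is a null set, and off it polar coordinates are a measure-preserving homeomorphism.
-/
theorem integral_eq_integral_toSphere_prod (ν : Measure E) [ν.IsAddHaarMeasure] (h : E → ℝ) :
    ∫ w, h w ∂ν = ∫ z : sphere (0 : E) 1 × Ioi (0 : ℝ), h ((z.2 : ℝ) • (z.1 : E))
      ∂(ν.toSphere.prod (.volumeIoiPow (Module.finrank ℝ E - 1))) := by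
  rw [show ∫ w, h w ∂ν = ∫ w in ({0}ᶜ : Set E), h w ∂ν by rw [restrict_compl_singleton],
    ← integral_subtype_comap (measurableSet_singleton _).compl h,
    ← ν.measurePreserving_homeomorphUnitSphereProd.integral_comp
        (Homeomorph.measurableEmbedding _)]
  refine integral_congr_ae (.of_forall fun w => ?_)
  have hw : (w : E) ≠ 0 := w.2
  simp [hw, smul_smul]

theorem integral_volumeIoiPow (n : ℕ) (g : ℝ → ℝ) :
    ∫ s : Ioi (0 : ℝ), g s ∂(Measure.volumeIoiPow n) = ∫ s in Ioi (0 : ℝ), s ^ n * g s := by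
  simp only [Measure.volumeIoiPow, ENNReal.ofReal]
  rw [integral_withDensity_eq_integral_smul,
    integral_subtype_comap measurableSet_Ioi fun a ↦ Real.toNNReal (a ^ n) • g a,
    setIntegral_congr_fun measurableSet_Ioi fun x hx ↦ ?_]
  · simp only [NNReal.smul_def, Real.coe_toNNReal _ (pow_nonneg (le_of_lt hx) _), smul_eq_mul]
  · exact (measurable_subtype_coe.pow_const _).real_toNNReal

/-- The integral over a ball of a continuous function times the component of `v` in the radial
direction, in polar coordinates. -/
theorem integral_ball_polar (ν : Measure E) [ν.IsAddHaarMeasure] {ψ : E → ℝ} (hψ : Continuous ψ)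
    (v : E) {r : ℝ} (hr : 0 < r) :
    ∫ w, (if ‖w‖ < r then inner ℝ w v / ‖w‖ else 0) * ψ w ∂ν =
      ∫ s in (0 : ℝ)..r, s ^ (Module.finrank ℝ E - 1) *
        ∫ u : sphere (0 : E) 1, ψ (s • (u : E)) * inner ℝ (u : E) v ∂ν.toSphere := by
  rw [integral_eq_integral_toSphere_prod, integral_prod_symm]
  · have : ∀ s : Ioi (0 : ℝ), ∫ u : sphere (0 : E) 1,
        (if ‖(s : ℝ) • (u : E)‖ < r then inner ℝ ((s : ℝ) • (u : E)) v / ‖(s : ℝ) • (u : E)‖ else 0)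
          * ψ ((s : ℝ) • (u : E)) ∂ν.toSphere =
        (Iio r).indicator (fun s => ∫ u : sphere (0 : E) 1, ψ (s • (u : E)) *
          inner ℝ (u : E) v ∂ν.toSphere) s := by
      rintro ⟨s, hs⟩
      have hs : 0 < s := hs
      have : ∀ u : sphere (0 : E) 1, ‖s • (u : E)‖ = s := fun u => by
        simp [norm_smul, abs_of_pos hs]
      simp only [this, inner_smul_left, indicator, mem_Iio]
      split_ifs with h
      · refine integral_congr_ae (.of_forall fun u => ?_)
        simp only [RCLike.conj_to_real]
        field_simp
      · simp
    simp_rw [this]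
    rw [integral_volumeIoiPow _ ((Iio r).indicator _), intervalIntegral.integral_of_le hr.le,
      ← integral_indicator measurableSet_Ioi, ← integral_indicator measurableSet_Ioc]
    refine integral_congr_ae ?_
    -- The interval integral includes the endpoint `r` and the indicator of `Iio r` does not.
    have : ∀ᵐ s : ℝ, s ≠ r := by simp [ae_iff]
    filter_upwards [this] with s hs
    by_cases h0 : 0 < s <;> by_cases h1 : s < r
    · simp [h0, h1, h1.le]
    · have : ¬ s ≤ r := fun h => h1 (lt_of_le_of_ne h hs)
      simp [h0, h1, this]
    · simp [h0]
    · simp [h0]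
  -- Fubini needs integrability on the product: the integrand is bounded by `‖v‖ * C` and vanishes
  -- outside `s < r`, a set of finite measure.
  · set κ := ν.toSphere.prod (.volumeIoiPow (Module.finrank ℝ E - 1))
    obtain ⟨C, hC⟩ := (isCompact_closedBall (0 : E) r).exists_bound_of_continuousOn
      hψ.continuousOn
    have hC0 : 0 ≤ C := (norm_nonneg _).trans (hC 0 (by simp [hr.le]))
    have hm : MeasurableSet ((univ : Set (sphere (0 : E) 1)) ×ˢ Iio (⟨r, hr⟩ : Ioi (0 : ℝ))) :=
      MeasurableSet.univ.prod measurableSet_Iio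
    have hbd : Integrable (((univ : Set (sphere (0 : E) 1)) ×ˢ
        Iio (⟨r, hr⟩ : Ioi (0 : ℝ))).indicator fun _ => ‖v‖ * C) κ := by
      refine (integrable_indicator_iff hm).2 (integrableOn_const ?_)
      rw [Measure.prod_prod]
      exact ENNReal.mul_ne_top (measure_ne_top _ _)
        (by rw [Measure.volumeIoiPow_apply_Iio]; exact ENNReal.ofReal_ne_top)
    refine hbd.mono' ?_ (.of_forall ?_)
    · refine Measurable.aestronglyMeasurable ?_
      have h1 : Measurable fun z : sphere (0 : E) 1 × Ioi (0 : ℝ) => (z.2 : ℝ) • (z.1 : E) := by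
        fun_prop
      have h2 : Measurable fun w : E => (if ‖w‖ < r then inner ℝ w v / ‖w‖ else 0) * ψ w := by
        refine Measurable.mul (Measurable.ite (measurableSet_lt measurable_norm measurable_const)
          ?_ measurable_const) hψ.measurable
        fun_prop
      exact h2.comp h1
    · rintro ⟨u, s, hs⟩
      have hs : 0 < s := hs
      have hn : ‖s • (u : E)‖ = s := by simp [norm_smul, abs_of_pos hs]
      simp only [hn]
      by_cases h : s < r
      · have h1 : ‖ψ (s • (u : E))‖ ≤ C := hC _ (by simp [hn, h.le])
        have h2 : ‖inner ℝ (s • (u : E)) v / s‖ ≤ ‖v‖ := by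
          rw [norm_div, Real.norm_of_nonneg hs.le, div_le_iff₀ hs]
          simpa [hn, mul_comm] using norm_inner_le_norm (𝕜 := ℝ) (s • (u : E)) v
        have hmem : (u, (⟨s, hs⟩ : Ioi (0 : ℝ))) ∈
            (univ : Set (sphere (0 : E) 1)) ×ˢ Iio (⟨r, hr⟩ : Ioi (0 : ℝ)) := ⟨mem_univ _, h⟩
        rw [indicator_of_mem hmem, if_pos h, norm_mul]
        gcongr
      · rw [if_neg h, zero_mul, norm_zero]
        exact indicator_nonneg (fun _ _ => by positivity) _

/-- The divergence theorem on the unit ball, for Lipschitz functions. -/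
theorem LipschitzWith.integral_ball_lineDeriv (ν : Measure E) [ν.IsAddHaarMeasure] {ψ : E → ℝ}
    {C : NNReal} (hψ : LipschitzWith C ψ) (v : E) :
    ∫ w in ball (0 : E) 1, lineDeriv ℝ ψ w v ∂ν =
      ∫ u : sphere (0 : E) 1, ψ u * inner ℝ (u : E) v ∂ν.toSphere := by
  -- The indicator of the ball is not Lipschitz, so integration by parts is done against the cone
  -- `max (r - ‖w‖) 0`. Its derivative in `r` is the indicator of the ball of radius `r`, so
  -- differentiating the resulting identity at `r = 1` gives the claim.
  set Φ : ℝ → ℝ := fun s => ∫ u : sphere (0 : E) 1, ψ (s • (u : E)) * inner ℝ (u : E) v ∂ν.toSphere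
    with hΦ
  have hΦc : Continuous Φ := by
    rw [continuous_iff_continuousAt]
    intro s₀
    obtain ⟨K, hK⟩ := (isCompact_closedBall (0 : E) (|s₀| + 1)).exists_bound_of_continuousOn
      hψ.continuous.continuousOn
    have hcont := hψ.continuous
    refine continuousAt_of_dominated (bound := fun _ => K * ‖v‖) ?_ ?_ (integrable_const _) ?_
    · refine .of_forall fun s => Continuous.aestronglyMeasurable ?_
      fun_prop
    · have : ∀ᶠ s in 𝓝 s₀, |s| < |s₀| + 1 :=
        continuous_abs.continuousAt.eventually_lt continuousAt_const (by simp)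
      filter_upwards [this] with s hs
      refine .of_forall fun u => ?_
      rw [norm_mul]
      have h1 : ‖ψ (s • (u : E))‖ ≤ K := hK _ (by simp [norm_smul, hs.le])
      have h2 : ‖inner ℝ (u : E) v‖ ≤ ‖v‖ := by
        simpa using norm_inner_le_norm (𝕜 := ℝ) (u : E) v
      gcongr
      exact (norm_nonneg _).trans h1
    · exact .of_forall fun u => by fun_prop
  have hJ : HasDerivAt (fun r : ℝ => ∫ s in (0 : ℝ)..r, s ^ (Module.finrank ℝ E - 1) * Φ s)
      (Φ 1) 1 := by
    have hc : Continuous fun s : ℝ => s ^ (Module.finrank ℝ E - 1) * Φ s := by fun_prop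
    simpa using intervalIntegral.integral_hasDerivAt_right (hc.intervalIntegrable 0 1)
      (hc.stronglyMeasurableAtFilter _ _) hc.continuousAt
  have hlip : ∀ r : ℝ, LipschitzWith 1 fun w : E => max (r - ‖w‖) 0 := fun r =>
    LipschitzWith.max_const (LipschitzWith.of_dist_le_mul fun x y => by
      simpa [dist_eq_norm, abs_sub_comm, norm_sub_rev] using abs_norm_sub_norm_le y x) 0
  have hae : ∀ r : ℝ, ∀ᵐ w ∂ν, w ≠ 0 ∧ ‖w‖ ≠ r := fun r => by
    have h1 : ∀ᵐ w ∂ν, w ≠ 0 := by simp [ae_iff]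
    have h2 : ∀ᵐ w ∂ν, w ∉ sphere (0 : E) r := by
      rcases eq_or_ne r 0 with rfl | hr
      · simpa using h1
      · exact measure_eq_zero_iff_ae_notMem.1 (Measure.addHaar_sphere_of_ne_zero ν 0 hr)
    filter_upwards [h1, h2] with w h1 h2
    exact ⟨h1, by simpa using h2⟩
  -- Integration by parts moves the derivative to the cone, in direction `-v`. The cone has radial
  -- slope `-1` inside the ball, so the two signs cancel.
  have hKJ : ∀ r : ℝ, 0 < r → ∫ w, lineDeriv ℝ ψ w v * max (r - ‖w‖) 0 ∂ν =
      ∫ s in (0 : ℝ)..r, s ^ (Module.finrank ℝ E - 1) * Φ s := fun r hr => by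
    have hsupp : HasCompactSupport fun w : E => max (r - ‖w‖) 0 := by
      refine HasCompactSupport.intro (isCompact_closedBall (0 : E) r) fun w hw => ?_
      have : r < ‖w‖ := by simpa using hw
      exact max_eq_right (by linarith)
    rw [LipschitzWith.integral_lineDeriv_mul_eq hψ (hlip r) hsupp,
      ← integral_ball_polar ν hψ.continuous v hr]
    refine integral_congr_ae ?_
    filter_upwards [hae r] with w hw
    rw [(hasLineDerivAt_posPart_sub_norm (-v) hw.1 hw.2).lineDeriv]
    simp [neg_div]
  -- Differentiation under the integral: the cone is 1-Lipschitz in `r`, and for `r` in `(0, 2)` it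
  -- is supported in the ball of radius `2`, where `C * ‖v‖` dominates.
  have hK : HasDerivAt (fun r : ℝ => ∫ w, lineDeriv ℝ ψ w v * max (r - ‖w‖) 0 ∂ν)
      (∫ w, (ball (0 : E) 1).indicator (fun w => lineDeriv ℝ ψ w v) w ∂ν) 1 := by
    have hm : Measurable fun w => lineDeriv ℝ ψ w v := measurable_lineDeriv hψ.continuous
    refine (hasDerivAt_integral_of_dominated_loc_of_lip (ball_mem_nhds (1 : ℝ) one_pos)
      (bound := (ball (0 : E) 2).indicator fun _ => C * ‖v‖) ?_ ?_ ?_ ?_ ?_ ?_).2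
    · refine .of_forall fun r => (hm.mul ?_).aestronglyMeasurable
      exact ((hlip r).continuous).measurable
    · have hsupp : HasCompactSupport fun w : E => max (1 - ‖w‖) 0 := by
        refine HasCompactSupport.intro (isCompact_closedBall (0 : E) 1) fun w hw => ?_
        have : 1 < ‖w‖ := by simpa using hw
        exact max_eq_right (by linarith)
      refine (((hlip 1).continuous.integrable_of_hasCompactSupport hsupp).bdd_mul
        (c := C * ‖v‖) hm.aestronglyMeasurable (.of_forall fun w => ?_))
      exact norm_lineDeriv_le_of_lipschitz ℝ hψ
    · exact (hm.indicator measurableSet_ball).aestronglyMeasurable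
    · refine .of_forall fun w => ?_
      rw [lipschitzOnWith_iff_dist_le_mul]
      intro r hr s hs
      have hb := norm_lineDeriv_le_of_lipschitz ℝ hψ (x₀ := w) (v := v)
      rw [dist_eq_norm, ← mul_sub, norm_mul]
      simp only [mem_ball, Real.dist_eq, abs_lt] at hr hs
      by_cases hw : ‖w‖ < 2
      · have : w ∈ ball (0 : E) 2 := by simpa using hw
        rw [indicator_of_mem this, Real.coe_nnabs, abs_of_nonneg (by positivity)]
        have h3 : ‖max (r - ‖w‖) 0 - max (s - ‖w‖) 0‖ ≤ dist r s := by
          rw [Real.dist_eq, Real.norm_eq_abs]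
          simpa using abs_max_sub_max_le_abs (r - ‖w‖) (s - ‖w‖) 0
        gcongr
      · rw [max_eq_right (by linarith), max_eq_right (by linarith)]
        simp only [sub_self, norm_zero, mul_zero]
        positivity
    · refine (integrable_indicator_iff measurableSet_ball).2 (integrableOn_const ?_)
      exact measure_ball_lt_top.ne
    · filter_upwards [hae 1] with w hw
      by_cases h : ‖w‖ < 1
      · have hmem : w ∈ ball (0 : E) 1 := by simpa using h
        rw [indicator_of_mem hmem]
        have : (fun r => lineDeriv ℝ ψ w v * max (r - ‖w‖) 0) =ᶠ[𝓝 1]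
            fun r => lineDeriv ℝ ψ w v * (r - ‖w‖) := by
          filter_upwards [lt_mem_nhds h] with r hr
          rw [max_eq_left (by linarith)]
        refine HasDerivAt.congr_of_eventuallyEq ?_ this
        simpa using ((hasDerivAt_id (1 : ℝ)).sub_const ‖w‖).const_mul (lineDeriv ℝ ψ w v)
      · have hmem : w ∉ ball (0 : E) 1 := by simpa using h
        rw [indicator_of_notMem hmem]
        have : (fun r => lineDeriv ℝ ψ w v * max (r - ‖w‖) 0) =ᶠ[𝓝 1] fun r => 0 := by
          filter_upwards [gt_mem_nhds (lt_of_le_of_ne (not_lt.1 h) (Ne.symm hw.2))] with r hr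
          rw [max_eq_right (by linarith), mul_zero]
        exact (hasDerivAt_const (1 : ℝ) (0 : ℝ)).congr_of_eventuallyEq this
  rw [integral_indicator measurableSet_ball] at hK
  have hJK := hJ.congr_of_eventuallyEq (f₁ := fun r : ℝ => ∫ w, lineDeriv ℝ ψ w v *
    max (r - ‖w‖) 0 ∂ν) (by
      filter_upwards [lt_mem_nhds (zero_lt_one' ℝ)] with r hr using hKJ r hr)
  rw [hK.unique hJK]
  simp [hΦ]

end SphereDivergence

/-! ### Functions with Lipschitz gradient, and their expectations. -/

namespace AccZOM

open Metric Set Filter Topology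

section LipschitzGradient

variable {E : Type*} [NormedAddCommGroup E] [InnerProductSpace ℝ E] [CompleteSpace E]

/-- `f` is differentiable at the points of `V`, and its gradient is `L`-Lipschitz on `V`. -/
structure HasLipschitzGradientOn (L : ℝ) (f : E → ℝ) (V : Set E) : Prop where
  differentiableAt : ∀ x ∈ V, DifferentiableAt ℝ f x
  norm_gradient_sub_le : ∀ x ∈ V, ∀ y ∈ V, ‖∇ f x - ∇ f y‖ ≤ L * ‖x - y‖

namespace HasLipschitzGradientOn

variable {L : ℝ} {f : E → ℝ} {V : Set E}

theorem hasGradientAt (hf : HasLipschitzGradientOn L f V) {x : E} (hx : x ∈ V) :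
    HasGradientAt f (∇ f x) x :=
  (hf.differentiableAt x hx).hasGradientAt

/-- Along the segment from `x` to `y` the Taylor remainder has derivative at most `L t ‖y - x‖²`, so
it stays below the primitive of that function. Convexity keeps the segment in `V`. -/
theorem abs_sub_sub_inner_le (hf : HasLipschitzGradientOn L f V) (hV : Convex ℝ V) {x y : E}
    (hx : x ∈ V) (hy : y ∈ V) :
    |f y - f x - inner ℝ (∇ f x) (y - x)| ≤ L / 2 * ‖y - x‖ ^ 2 := by
  set h := y - x with hh
  have hmem : ∀ t ∈ Icc (0 : ℝ) 1, x + t • h ∈ V := fun t ht => by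
    have := hV.add_smul_sub_mem hx hy ht
    simpa [hh] using this
  have hd : ∀ t ∈ Icc (0 : ℝ) 1, HasDerivAt (fun t : ℝ => f (x + t • h) - f x
      - t * inner ℝ (∇ f x) h) (inner ℝ (∇ f (x + t • h)) h - inner ℝ (∇ f x) h) t := by
    intro t ht
    have h1 : HasDerivAt (fun t : ℝ => x + t • h) h t := by
      simpa using ((hasDerivAt_id t).smul_const h).const_add x
    have h2 := (hf.hasGradientAt (hmem t ht)).hasFDerivAt.comp_hasDerivAt t h1
    refine ((h2.sub_const (f x)).sub
      ((hasDerivAt_id t).mul_const (inner ℝ (∇ f x) h))).congr_deriv ?_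
    simp only [InnerProductSpace.toDual_apply_apply, one_mul]
  have key := image_norm_le_of_norm_deriv_right_le_deriv_boundary (a := 0) (b := 1)
    (f := fun t : ℝ => f (x + t • h) - f x - t * inner ℝ (∇ f x) h)
    (f' := fun t => inner ℝ (∇ f (x + t • h)) h - inner ℝ (∇ f x) h)
    (B := fun t => L / 2 * ‖h‖ ^ 2 * t ^ 2) (B' := fun t => L * ‖h‖ ^ 2 * t)
    (fun t ht => (hd t ht).continuousAt.continuousWithinAt)
    (fun t ht => (hd t ⟨ht.1, ht.2.le⟩).hasDerivWithinAt) (by simp)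
    (fun t => by
      refine ((hasDerivAt_pow 2 t).const_mul (L / 2 * ‖h‖ ^ 2)).congr_deriv ?_
      push_cast
      ring)
    (fun t ht => by
      rw [← inner_sub_left]
      refine (norm_inner_le_norm _ _).trans ?_
      have := hf.norm_gradient_sub_le _ (hmem t ⟨ht.1, ht.2.le⟩) x hx
      have h4 : ‖x + t • h - x‖ = t * ‖h‖ := by
        rw [add_sub_cancel_left, norm_smul, Real.norm_of_nonneg ht.1]
      rw [h4] at this
      calc _ ≤ L * (t * ‖h‖) * ‖h‖ := by gcongr
        _ = _ := by ring)
    (right_mem_Icc.2 zero_le_one)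
  simpa [hh] using key

theorem mono (hf : HasLipschitzGradientOn L f V) {U : Set E} (hU : U ⊆ V) :
    HasLipschitzGradientOn L f U :=
  ⟨fun x hx => hf.differentiableAt x (hU hx),
    fun x hx y hy => hf.norm_gradient_sub_le x (hU hx) y (hU hy)⟩

theorem comp_add_const (hf : HasLipschitzGradientOn L f V) {U : Set E} {a : E}
    (hU : ∀ x ∈ U, x + a ∈ V) :
    HasLipschitzGradientOn L (fun x => f (x + a)) U ∧
      ∀ x ∈ U, ∇ (fun x => f (x + a)) x = ∇ f (x + a) := by
  have key : ∀ x ∈ U, HasGradientAt (fun x => f (x + a)) (∇ f (x + a)) x := fun x hx => by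
    rw [hasGradientAt_iff_hasFDerivAt]
    exact (hf.hasGradientAt (hU x hx)).hasFDerivAt.comp x ((hasFDerivAt_id x).add_const a)
  refine ⟨⟨fun x hx => (key x hx).differentiableAt, fun x hx y hy => ?_⟩,
    fun x hx => (key x hx).gradient⟩
  rw [(key x hx).gradient, (key y hy).gradient]
  simpa using hf.norm_gradient_sub_le _ (hU x hx) _ (hU y hy)

theorem of_hasGradientAt {g : E → E} (hf : ∀ x ∈ V, HasGradientAt f (g x) x)
    (hg : ∀ x ∈ V, ∀ y ∈ V, ‖g x - g y‖ ≤ L * ‖x - y‖) : HasLipschitzGradientOn L f V :=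
  ⟨fun x hx => (hf x hx).differentiableAt, fun x hx y hy => by
    rw [(hf x hx).gradient, (hf y hy).gradient]; exact hg x hx y hy⟩

end HasLipschitzGradientOn

/-- A quadratic remainder is `o(‖y - x‖)`. This criterion is used because a uniform remainder bound
survives averaging, which yields differentiation under the expectation. -/
theorem hasGradientAt_of_abs_sub_sub_inner_le {f : E → ℝ} {g x : E} {K : ℝ}
    (h : ∀ᶠ y in 𝓝 x, |f y - f x - inner ℝ g (y - x)| ≤ K * ‖y - x‖ ^ 2) :
    HasGradientAt f g x := by
  rw [hasGradientAt_iff_hasFDerivAt, hasFDerivAt_iff_isLittleO]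
  have h1 : (fun y => f y - f x - InnerProductSpace.toDual ℝ E g (y - x)) =O[𝓝 x]
      fun y => ‖y - x‖ ^ 2 := by
    refine Asymptotics.IsBigO.of_bound K ?_
    filter_upwards [h] with y hy
    simpa using hy
  refine h1.trans_isLittleO ?_
  have h2 : Tendsto (fun y => y - x) (𝓝 x) (𝓝 0) := by
    have : Continuous fun y => y - x := by fun_prop
    simpa using this.tendsto x
  exact (Asymptotics.isLittleO_norm_pow_id (E' := E) one_lt_two).comp_tendsto h2

variable {Ω : Type*} [MeasurableSpace Ω] {P : Measure Ω} {L : ℝ} {V : Set E} {F : E → Ω → ℝ}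

/-- Only the values of `F` are assumed integrable. Measurability comes from writing the directional
derivative as a limit of difference quotients; integrability from comparing it with a single
quotient of fixed step `h`, the error being at most `L/2 * h * ‖v‖²`. -/
theorem integrable_inner_gradient [IsFiniteMeasure P] (hVo : IsOpen V) (hV : Convex ℝ V)
    (hF : ∀ᵐ ξ ∂P, HasLipschitzGradientOn L (fun y => F y ξ) V)
    (hint : ∀ x ∈ V, Integrable (F x) P) {x : E} (hx : x ∈ V) (v : E) :
    Integrable (fun ξ => inner ℝ (∇ (fun y => F y ξ) x) v) P := by
  have hlim : Tendsto (fun t : ℝ => x + t • v) (𝓝 0) (𝓝 x) := by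
    have : Continuous fun t : ℝ => x + t • v := by fun_prop
    simpa using this.tendsto 0
  have hev : ∀ᶠ t : ℝ in 𝓝[>] 0, x + t • v ∈ V :=
    (hlim.eventually (hVo.mem_nhds hx)).filter_mono nhdsWithin_le_nhds
  obtain ⟨h, hhV, hh0⟩ := (hev.and self_mem_nhdsWithin).exists
  have hh0 : 0 < h := hh0
  have hmem : ∀ t ∈ Icc (0 : ℝ) h, x + t • v ∈ V := fun t ht => by
    have := hV.add_smul_sub_mem hx hhV (t := t / h) ⟨div_nonneg ht.1 hh0.le,
      (div_le_one hh0).2 ht.2⟩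
    simpa [smul_smul, div_mul_cancel₀ _ hh0.ne'] using this
  have htn : ∀ n : ℕ, h * ((n : ℝ) + 1)⁻¹ ∈ Icc (0 : ℝ) h := fun n => by
    refine ⟨by positivity, mul_le_of_le_one_right hh0.le (inv_le_one_of_one_le₀ ?_)⟩
    have : (0 : ℝ) ≤ n := n.cast_nonneg
    linarith
  have hline : ∀ᵐ ξ ∂P, HasLineDerivAt ℝ (fun y => F y ξ)
      (inner ℝ (∇ (fun y => F y ξ) x) v) x v := by
    filter_upwards [hF] with ξ hξ
    simpa using (hξ.hasGradientAt hx).hasFDerivAt.hasLineDerivAt v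
  have hmeas : AEStronglyMeasurable (fun ξ => inner ℝ (∇ (fun y => F y ξ) x) v) P := by
    refine aestronglyMeasurable_of_tendsto_ae atTop
      (f := fun (n : ℕ) ξ => (h * ((n : ℝ) + 1)⁻¹)⁻¹ • (F (x + (h * ((n : ℝ) + 1)⁻¹) • v) ξ - F x ξ))
      (fun n => ((hint _ (hmem _ (htn n))).sub (hint x hx)).aestronglyMeasurable.const_smul
        ((h * ((n : ℝ) + 1)⁻¹)⁻¹)) ?_
    filter_upwards [hline] with ξ hξ
    refine hξ.tendsto_slope_zero.comp (tendsto_nhdsWithin_iff.2 ⟨?_, .of_forall fun n => ?_⟩)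
    · have : Tendsto (fun n : ℕ => ((n : ℝ) + 1)⁻¹) atTop (𝓝 0) :=
        tendsto_inv_atTop_zero.comp (tendsto_atTop_add_const_right _ _ tendsto_natCast_atTop_atTop)
      simpa using this.const_mul h
    · simp only [mem_compl_iff, mem_singleton_iff]
      positivity
  have hbd : Integrable (fun ξ => h⁻¹ * (|F (x + h • v) ξ| + |F x ξ|) + L / 2 * h * ‖v‖ ^ 2) P :=
    ((((hint _ hhV).abs.add (hint _ hx).abs).const_mul _).add (integrable_const _))
  refine hbd.mono' hmeas ?_
  filter_upwards [hF] with ξ hξ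
  have h1 := hξ.abs_sub_sub_inner_le hV hx hhV
  rw [add_sub_cancel_left, inner_smul_right, norm_smul, Real.norm_of_nonneg hh0.le] at h1
  have h2 : |h * inner ℝ (∇ (fun y => F y ξ) x) v| ≤
      |F (x + h • v) ξ| + |F x ξ| + L / 2 * (h * ‖v‖) ^ 2 := by
    have := abs_sub_abs_le_abs_sub (h * inner ℝ (∇ (fun y => F y ξ) x) v)
      (F (x + h • v) ξ - F x ξ)
    rw [abs_sub_comm (h * _)] at this
    have h3 := abs_sub (F (x + h • v) ξ) (F x ξ)
    linarith
  rw [abs_mul, abs_of_pos hh0] at h2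
  rw [Real.norm_eq_abs]
  calc _ = h⁻¹ * (h * |inner ℝ (∇ (fun y => F y ξ) x) v|) := by field_simp
    _ ≤ h⁻¹ * (|F (x + h • v) ξ| + |F x ξ| + L / 2 * (h * ‖v‖) ^ 2) := by gcongr
    _ = _ := by field_simp

theorem integrable_gradient [FiniteDimensional ℝ E] [IsFiniteMeasure P] (hVo : IsOpen V)
    (hV : Convex ℝ V) (hF : ∀ᵐ ξ ∂P, HasLipschitzGradientOn L (fun y => F y ξ) V)
    (hint : ∀ x ∈ V, Integrable (F x) P) {x : E} (hx : x ∈ V) :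
    Integrable (fun ξ => ∇ (fun y => F y ξ) x) P := by
  have b := stdOrthonormalBasis ℝ E
  have : (fun ξ => ∇ (fun y => F y ξ) x) =
      fun ξ => ∑ i, inner ℝ (∇ (fun y => F y ξ) x) (b i) • b i := by
    ext1 ξ
    conv_lhs => rw [← b.sum_repr' (∇ (fun y => F y ξ) x)]
    simp_rw [real_inner_comm]
  rw [this]
  exact integrable_finsetSum _ fun i _ =>
    (integrable_inner_gradient hVo hV hF hint hx (b i)).smul_const (b i)

/-- Differentiation under the expectation. -/
theorem hasGradientAt_integral [FiniteDimensional ℝ E] [IsProbabilityMeasure P] (hVo : IsOpen V)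
    (hV : Convex ℝ V) (hF : ∀ᵐ ξ ∂P, HasLipschitzGradientOn L (fun y => F y ξ) V)
    (hint : ∀ x ∈ V, Integrable (F x) P) {x : E} (hx : x ∈ V) :
    HasGradientAt (fun y => ∫ ξ, F y ξ ∂P) (∫ ξ, ∇ (fun y => F y ξ) x ∂P) x := by
  refine hasGradientAt_of_abs_sub_sub_inner_le (K := L / 2) ?_
  filter_upwards [hVo.mem_nhds hx] with y hy
  have hg := integrable_gradient hVo hV hF hint hx
  have h1 : (∫ ξ, F y ξ ∂P) - (∫ ξ, F x ξ ∂P) - inner ℝ (∫ ξ, ∇ (fun y => F y ξ) x ∂P) (y - x) =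
      ∫ ξ, (F y ξ - F x ξ - inner ℝ (∇ (fun y => F y ξ) x) (y - x)) ∂P := by
    rw [integral_sub, integral_sub (hint y hy) (hint x hx), real_inner_comm, ← integral_inner hg]
    · simp_rw [real_inner_comm]
    · exact (hint y hy).sub (hint x hx)
    · exact integrable_inner_gradient hVo hV hF hint hx _
  rw [h1, ← Real.norm_eq_abs]
  refine (norm_integral_le_of_norm_le_const (C := L / 2 * ‖y - x‖ ^ 2) ?_).trans_eq (by simp)
  filter_upwards [hF] with ξ hξ
  exact hξ.abs_sub_sub_inner_le hV hx hy

theorem HasLipschitzGradientOn.integral [FiniteDimensional ℝ E] [IsProbabilityMeasure P]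
    (hVo : IsOpen V) (hV : Convex ℝ V)
    (hF : ∀ᵐ ξ ∂P, HasLipschitzGradientOn L (fun y => F y ξ) V)
    (hint : ∀ x ∈ V, Integrable (F x) P) :
    HasLipschitzGradientOn L (fun y => ∫ ξ, F y ξ ∂P) V := by
  refine .of_hasGradientAt (fun x hx => hasGradientAt_integral hVo hV hF hint hx)
    fun x hx y hy => ?_
  rw [← integral_sub (integrable_gradient hVo hV hF hint hx)
    (integrable_gradient hVo hV hF hint hy)]
  refine (norm_integral_le_of_norm_le_const (C := L * ‖x - y‖) ?_).trans_eq (by simp)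
  filter_upwards [hF] with ξ hξ
  exact hξ.norm_gradient_sub_le x hx y hy

end LipschitzGradient

end AccZOM

/-! ### Uniform laws on the ball and the sphere. -/

namespace AccZOM

open Metric Set Filter Topology

section Uniform

variable {d : ℕ}

/-- The uniform distribution on the closed unit ball. -/
noncomputable def ballUniform (d : ℕ) : Measure (Vec d) :=
  (volume (closedBall (0 : Vec d) 1))⁻¹ • volume.restrict (closedBall (0 : Vec d) 1)

theorem smoothing_eq_integral (μ : ℝ) (f : Vec d → ℝ) :
    smoothing μ f = fun x => ∫ w, f (x + μ • w) ∂ballUniform d :=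
  funext fun _ => setAverage_eq' _ _ _

instance : IsProbabilityMeasure (ballUniform d) where
  measure_univ := by
    simp only [ballUniform, Measure.smul_apply, Measure.restrict_apply_univ, smul_eq_mul]
    exact ENNReal.inv_mul_cancel (measure_closedBall_pos _ _ one_pos).ne'
      measure_closedBall_lt_top.ne

theorem ae_ballUniform : ∀ᵐ w ∂ballUniform d, ‖w‖ ≤ 1 := by
  refine Measure.ae_smul_measure ?_ _
  filter_upwards [ae_restrict_mem measurableSet_closedBall] with w hw
  simpa using hw

theorem volume_ball_pos : 0 < (volume : Measure (Vec d)).real (ball 0 1) :=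
  ENNReal.toReal_pos (measure_ball_pos _ _ one_pos).ne' measure_ball_lt_top.ne

theorem toSphere_univ_real :
    (volume : Measure (Vec d)).toSphere.real univ = d * (volume : Measure (Vec d)).real (ball 0 1) := by
  rw [Measure.toSphere_real_apply_univ, finrank_euclideanSpace_fin]

theorem integral_sphereUniform (h : USphere d → ℝ) :
    ∫ u, h u ∂sphereUniform d =
      (d * (volume : Measure (Vec d)).real (ball 0 1))⁻¹ *
        ∫ u, h u ∂(volume : Measure (Vec d)).toSphere := by
  rw [sphereUniform, integral_smul_measure, ENNReal.toReal_inv, smul_eq_mul,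
    ← toSphere_univ_real]
  rfl

variable [NeZero d]

theorem integral_ballUniform (h : Vec d → ℝ) :
    ∫ w, h w ∂ballUniform d =
      ((volume : Measure (Vec d)).real (ball 0 1))⁻¹ * ∫ w in ball (0 : Vec d) 1, h w := by
  rw [ballUniform, integral_smul_measure, Measure.addHaar_closedBall_eq_addHaar_ball,
    ENNReal.toReal_inv, smul_eq_mul, setIntegral_congr_set (s := closedBall (0 : Vec d) 1)]
  · rfl
  · rw [← ball_union_sphere]
    refine union_ae_eq_left_of_ae_eq_empty ?_
    rw [ae_eq_empty]
    exact Measure.addHaar_sphere _ _ _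

theorem ae_ballUniform_lt : ∀ᵐ w ∂ballUniform d, ‖w‖ < 1 := by
  have h1 : ∀ᵐ w ∂ballUniform d, w ∉ sphere (0 : Vec d) 1 := by
    refine Measure.ae_smul_measure (ae_restrict_of_ae ?_) _
    exact measure_eq_zero_iff_ae_notMem.1 (Measure.addHaar_sphere _ _ _)
  filter_upwards [h1, ae_ballUniform] with w h1 h2
  exact lt_of_le_of_ne h2 (by simpa using h1)

instance : IsProbabilityMeasure (sphereUniform d) where
  measure_univ := by
    simp only [sphereUniform, Measure.smul_apply, smul_eq_mul]
    refine ENNReal.inv_mul_cancel ?_ (measure_ne_top _ _)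
    simpa using ⟨NeZero.ne d, (measure_ball_pos _ _ one_pos).ne'⟩

theorem cast_pos_of_neZero : (0 : ℝ) < d := Nat.cast_pos.2 (NeZero.pos d)

/-- The surface area of the sphere is `d` times the volume of the ball, so normalizing both sides of
the divergence theorem leaves the factor `d`. -/
theorem integral_ballUniform_lineDeriv {ψ : Vec d → ℝ} {C : NNReal} (hψ : LipschitzWith C ψ)
    (v : Vec d) :
    ∫ w, lineDeriv ℝ ψ w v ∂ballUniform d =
      d * ∫ u : USphere d, ψ u * inner ℝ (u : Vec d) v ∂sphereUniform d := by
  rw [integral_ballUniform, integral_sphereUniform, LipschitzWith.integral_ball_lineDeriv _ hψ]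
  have := volume_ball_pos (d := d)
  have := cast_pos_of_neZero (d := d)
  field_simp

/-- The divergence theorem for the linear function `⟨a, ·⟩` in direction `a`, whose derivative is
the constant `‖a‖²`. The `1/d` gained over Cauchy–Schwarz is what improves the dimension dependence.
-/
theorem integral_inner_sq_sphereUniform (a : Vec d) :
    ∫ u : USphere d, inner ℝ a (u : Vec d) ^ 2 ∂sphereUniform d = ‖a‖ ^ 2 / d := by
  have hL : LipschitzWith ‖innerSL ℝ a‖₊ fun w : Vec d => inner ℝ a w :=
    (innerSL ℝ a).lipschitz
  have h := integral_ballUniform_lineDeriv hL a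
  have h1 : ∀ w, lineDeriv ℝ (fun w : Vec d => inner ℝ a w) w a = ‖a‖ ^ 2 := fun w => by
    have := ((innerSL ℝ a).hasFDerivAt (x := w)).hasLineDerivAt a
    rw [← real_inner_self_eq_norm_sq]
    exact this.lineDeriv
  simp_rw [h1, real_inner_comm a, ← pow_two] at h
  rw [integral_const] at h
  simp only [probReal_univ, one_smul] at h
  rw [h]
  have := cast_pos_of_neZero (d := d)
  field_simp

/-- The exact value is `d/(d+1)`, and `d ≥ 1`. The weaker form is what the bias term of the final
bound uses. -/
theorem integral_norm_ballUniform_le : ∫ w, ‖w‖ ∂ballUniform d ≤ d / 2 := by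
  have h1 : ∫ w in ball (0 : Vec d) 1, ‖w‖ = ∫ w : Vec d, (Iio (1 : ℝ)).indicator id ‖w‖ := by
    rw [← integral_indicator measurableSet_ball]
    refine integral_congr_ae (.of_forall fun w => ?_)
    simp [indicator]
  have hd := NeZero.pos d
  have h2 : ∫ y in Ioi (0 : ℝ), y ^ (d - 1) • (Iio (1 : ℝ)).indicator id y = 1 / (d + 1) := by
    have h3 : ∀ y ∈ Ioi (0 : ℝ), y ^ (d - 1) • (Iio (1 : ℝ)).indicator id y =
        (Iio (1 : ℝ)).indicator (fun y => y ^ d) y := fun y _ => by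
      by_cases hy : y < 1
      · simp only [mem_Iio, hy, indicator_of_mem, id, smul_eq_mul]
        rw [← pow_succ, Nat.sub_add_cancel hd]
      · simp [hy]
    rw [setIntegral_congr_fun measurableSet_Ioi h3, setIntegral_indicator measurableSet_Iio,
      Ioi_inter_Iio, ← integral_Ioc_eq_integral_Ioo,
      ← intervalIntegral.integral_of_le zero_le_one, integral_pow]
    simp
  rw [integral_ballUniform, h1, integral_fun_norm_addHaar, finrank_euclideanSpace_fin, h2]
  have h4 := volume_ball_pos (d := d)
  have h5 : (1 : ℝ) ≤ d := by exact_mod_cast hd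
  simp only [nsmul_eq_mul, smul_eq_mul]
  have : ((volume : Measure (Vec d)).real (ball 0 1))⁻¹ * (d * ((volume : Measure (Vec d)).real
    (ball 0 1) * (1 / ((d : ℝ) + 1)))) = d / (d + 1) := by field_simp
  rw [this]
  gcongr
  linarith

end Uniform

/-! ### The smoothing and the estimator of one function. -/

section Smoothing

variable {d : ℕ} {L μ δ : ℝ} {X : Set (Vec d)} {f : Vec d → ℝ}

theorem add_smul_mem_thickening {x w : Vec d} {ρ : ℝ} (hμ : 0 ≤ μ) (hx : x ∈ thickening ρ X)
    (hw : ‖w‖ ≤ 1) : x + μ • w ∈ thickening (ρ + μ) X := by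
  rw [mem_thickening_iff] at hx ⊢
  obtain ⟨z, hz, hxz⟩ := hx
  refine ⟨z, hz, ?_⟩
  have h1 : dist (x + μ • w) x ≤ μ := by
    simpa [dist_eq_norm, norm_smul, abs_of_nonneg hμ] using mul_le_of_le_one_right hμ hw
  linarith [dist_triangle (x + μ • w) x z]

theorem add_smul_mem_thickening_of_mem {x w : Vec d} (hμ : 0 ≤ μ) (hμδ : μ < δ) (hx : x ∈ X)
    (hw : ‖w‖ ≤ 1) : x + μ • w ∈ thickening δ X := by
  have := add_smul_mem_thickening hμ (self_subset_thickening (sub_pos.2 hμδ) X hx) hw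
  simpa using this

theorem HasLipschitzGradientOn.continuousOn {V : Set (Vec d)} (hf : HasLipschitzGradientOn L f V) :
    ContinuousOn f V :=
  fun x hx => (hf.differentiableAt x hx).continuousAt.continuousWithinAt

theorem HasLipschitzGradientOn.integrable_ballUniform
    (hf : HasLipschitzGradientOn L f (thickening δ X)) (hμ : 0 < μ) {x : Vec d}
    (hx : x ∈ thickening (δ - μ) X) :
    Integrable (fun w => f (x + μ • w)) (ballUniform d) := by
  refine Integrable.smul_measure ?_
    (ENNReal.inv_ne_top.2 (measure_closedBall_pos _ _ one_pos).ne')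
  refine ContinuousOn.integrableOn_compact (isCompact_closedBall _ _) ?_
  refine hf.continuousOn.comp (by fun_prop) fun w hw => ?_
  simpa using add_smul_mem_thickening hμ.le hx (by simpa using hw)

theorem HasLipschitzGradientOn.ae_ballUniform
    (hf : HasLipschitzGradientOn L f (thickening δ X)) (hμ : 0 < μ) :
    ∀ᵐ w ∂ballUniform d, HasLipschitzGradientOn L (fun y => f (y + μ • w)) (thickening (δ - μ) X) ∧
      ∀ x ∈ thickening (δ - μ) X, ∇ (fun y => f (y + μ • w)) x = ∇ f (x + μ • w) := by
  filter_upwards [AccZOM.ae_ballUniform] with w hw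
  exact hf.comp_add_const fun x hx => by simpa using add_smul_mem_thickening hμ.le hx hw

/-- The smoothing is an expectation over `w` of the translates `f(· + μ w)`, so the results on
expectations apply. Translating by up to `μ` shrinks the neighbourhood from `δ` to `δ - μ`. -/
theorem HasLipschitzGradientOn.smoothing (hX : Convex ℝ X)
    (hf : HasLipschitzGradientOn L f (thickening δ X)) (hμ : 0 < μ) :
    HasLipschitzGradientOn L (smoothing μ f) (thickening (δ - μ) X) := by
  rw [smoothing_eq_integral]
  exact .integral isOpen_thickening (hX.thickening _) ((hf.ae_ballUniform hμ).mono fun _ h => h.1)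
    fun x hx => hf.integrable_ballUniform hμ hx

theorem HasLipschitzGradientOn.integrable_gradient_ballUniform (hX : Convex ℝ X)
    (hf : HasLipschitzGradientOn L f (thickening δ X)) (hμ : 0 < μ) {x : Vec d}
    (hx : x ∈ thickening (δ - μ) X) :
    Integrable (fun w => ∇ f (x + μ • w)) (ballUniform d) := by
  refine (integrable_gradient isOpen_thickening (hX.thickening _)
    ((hf.ae_ballUniform hμ).mono fun _ h => h.1)
    (fun x hx => hf.integrable_ballUniform hμ hx) hx).congr ?_
  filter_upwards [hf.ae_ballUniform hμ] with w hw
  exact hw.2 x hx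

theorem HasLipschitzGradientOn.gradient_smoothing (hX : Convex ℝ X)
    (hf : HasLipschitzGradientOn L f (thickening δ X)) (hμ : 0 < μ) {x : Vec d}
    (hx : x ∈ thickening (δ - μ) X) :
    ∇ (AccZOM.smoothing μ f) x = ∫ w, ∇ f (x + μ • w) ∂ballUniform d := by
  rw [smoothing_eq_integral, (hasGradientAt_integral isOpen_thickening (hX.thickening _)
    ((hf.ae_ballUniform hμ).mono fun _ h => h.1)
    (fun x hx => hf.integrable_ballUniform hμ hx) hx).gradient]
  refine integral_congr_ae ?_
  filter_upwards [hf.ae_ballUniform hμ] with w hw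
  exact hw.2 x hx

theorem HasLipschitzGradientOn.norm_gradient_sub_gradient_smoothing_le [NeZero d]
    (hX : Convex ℝ X) (hf : HasLipschitzGradientOn L f (thickening δ X)) (hL : 0 ≤ L) (hμ : 0 < μ)
    (hμδ : μ < δ) {x : Vec d} (hx : x ∈ X) :
    ‖∇ f x - ∇ (AccZOM.smoothing μ f) x‖ ≤ L * μ * (d / 2) := by
  have hx' : x ∈ thickening (δ - μ) X := self_subset_thickening (sub_pos.2 hμδ) X hx
  have hint := hf.integrable_gradient_ballUniform hX hμ hx'
  have hnorm : Integrable (fun w : Vec d => ‖w‖) (ballUniform d) :=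
    Integrable.of_bound (C := 1) (by fun_prop) (by simpa using AccZOM.ae_ballUniform)
  have h1 : ∇ f x - ∇ (AccZOM.smoothing μ f) x =
      ∫ w, (∇ f x - ∇ f (x + μ • w)) ∂ballUniform d := by
    rw [hf.gradient_smoothing hX hμ hx', integral_sub (integrable_const _) hint]
    simp
  rw [h1]
  calc _ ≤ ∫ w, L * μ * ‖w‖ ∂ballUniform d := by
        refine norm_integral_le_of_norm_le (hnorm.const_mul _) ?_
        filter_upwards [AccZOM.ae_ballUniform] with w hw
        refine (hf.norm_gradient_sub_le _
          (self_subset_thickening (hμ.trans hμδ) X hx) _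
          (add_smul_mem_thickening_of_mem hμ.le hμδ hx hw)).trans_eq ?_
        rw [sub_add_cancel_left, norm_neg, norm_smul, Real.norm_of_nonneg hμ.le, mul_assoc]
    _ = L * μ * ∫ w, ‖w‖ ∂ballUniform d := integral_const_mul _ _
    _ ≤ _ := by gcongr; exact integral_norm_ballUniform_le

/-- The gradient of the smoothing is an average over the sphere. -/
theorem HasLipschitzGradientOn.integral_sphereUniform_smul [NeZero d]
    (hX : Convex ℝ X) (hf : HasLipschitzGradientOn L f (thickening δ X)) (hL : 0 ≤ L) (hμ : 0 < μ)
    (hμδ : μ < δ) {x : Vec d} (hx : x ∈ X) :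
    ∫ u : USphere d, ((f (x + μ • (u : Vec d)) - f x) / (μ / d)) • (u : Vec d) ∂sphereUniform d =
      ∇ (AccZOM.smoothing μ f) x := by
  have hd := cast_pos_of_neZero (d := d)
  have hx' : x ∈ thickening (δ - μ) X := self_subset_thickening (sub_pos.2 hμδ) X hx
  have hxV : x ∈ thickening δ X := self_subset_thickening (hμ.trans hμδ) X hx
  have hmem : ∀ w ∈ closedBall (0 : Vec d) 1, x + μ • w ∈ thickening δ X := fun w hw =>
    add_smul_mem_thickening_of_mem hμ.le hμδ hx (by simpa using hw)
  set G : ℝ := ‖∇ f x‖ + L * μ with hG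
  have hG0 : 0 ≤ G := by positivity
  have hder : ∀ w ∈ closedBall (0 : Vec d) 1, HasFDerivAt (fun w => f (x + μ • w) - f x)
      (μ • InnerProductSpace.toDual ℝ (Vec d) (∇ f (x + μ • w))) w := fun w hw => by
    have h1 : HasFDerivAt (fun w : Vec d => x + μ • w) (μ • ContinuousLinearMap.id ℝ (Vec d)) w :=
      ((hasFDerivAt_id w).const_smul μ).const_add x
    refine (((hf.hasGradientAt (hmem w hw)).hasFDerivAt.comp w h1).sub_const (f x)).congr_fderiv ?_
    ext v
    simp
  have hlip : LipschitzOnWith (μ * G).toNNReal (fun w => f (x + μ • w) - f x)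
      (closedBall (0 : Vec d) 1) := by
    refine Convex.lipschitzOnWith_of_nnnorm_hasFDerivWithin_le
      (fun w hw => (hder w hw).hasFDerivWithinAt) (fun w hw => ?_) (convex_closedBall _ _)
    rw [← NNReal.coe_le_coe, Real.coe_toNNReal _ (by positivity), coe_nnnorm, norm_smul,
      LinearIsometryEquiv.norm_map, Real.norm_of_nonneg hμ.le]
    gcongr
    have h1 := hf.norm_gradient_sub_le _ (hmem w hw) _ hxV
    have h2 : ‖x + μ • w - x‖ ≤ μ := by
      rw [add_sub_cancel_left, norm_smul, Real.norm_of_nonneg hμ.le]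
      exact mul_le_of_le_one_right hμ.le (by simpa using hw)
    have h3 := norm_sub_norm_le (∇ f (x + μ • w)) (∇ f x)
    have h4 : L * ‖x + μ • w - x‖ ≤ L * μ := by gcongr
    linarith
  -- `f` is controlled only near `X`, while the divergence theorem asks for a globally Lipschitz
  -- function. The increment is Lipschitz on the closed ball, so it extends; the extension agrees
  -- with it on the sphere and, near interior points, has the same derivative.
  obtain ⟨ψ, hψ, heq⟩ := hlip.extend_real
  have hψu : ∀ u : USphere d, f (x + μ • (u : Vec d)) - f x = ψ u := fun u =>
    heq (sphere_subset_closedBall u.2)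
  have hψc := hψ.continuous
  have hint : Integrable (fun u : USphere d => (ψ u / (μ / d)) • (u : Vec d)) (sphereUniform d) := by
    have hc : Continuous fun u : USphere d => (ψ u / (μ / d)) • (u : Vec d) := by fun_prop
    exact hc.integrable_of_hasCompactSupport (HasCompactSupport.of_compactSpace _)
  simp_rw [hψu]
  refine ext_inner_left ℝ fun v => ?_
  rw [← integral_inner hint, hf.gradient_smoothing hX hμ hx',
    ← integral_inner (hf.integrable_gradient_ballUniform hX hμ hx')]
  have h1 : ∫ w, inner ℝ v (∇ f (x + μ • w)) ∂ballUniform d =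
      μ⁻¹ * ∫ w, lineDeriv ℝ ψ w v ∂ballUniform d := by
    rw [← integral_const_mul]
    refine integral_congr_ae ?_
    filter_upwards [ae_ballUniform_lt] with w hw
    have hev : ψ =ᶠ[𝓝 w] fun w => f (x + μ • w) - f x := by
      filter_upwards [isOpen_ball.mem_nhds (show w ∈ ball (0 : Vec d) 1 by simpa using hw)] with z hz
      exact (heq (ball_subset_closedBall hz)).symm
    rw [Filter.EventuallyEq.lineDeriv_eq hev,
      ((hder w (by simpa using hw.le)).hasLineDerivAt v).lineDeriv, real_inner_comm]
    simp [hμ.ne']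
  rw [h1, integral_ballUniform_lineDeriv hψ, ← mul_assoc, ← integral_const_mul]
  refine integral_congr_ae (.of_forall fun u => ?_)
  simp only [inner_smul_right, real_inner_comm v]
  field_simp

/-- The mean square change of the gradient estimator of a single component function. -/
theorem HasLipschitzGradientOn.integral_norm_estimator_sub_sq_le [NeZero d]
    (hX : Convex ℝ X) (hf : HasLipschitzGradientOn L f (thickening δ X)) (hμ : 0 < μ)
    (hμδ : μ < δ) {x y : Vec d} (hx : x ∈ X) (hy : y ∈ X) :
    ∫ u : USphere d, ‖((f (y + μ • (u : Vec d)) - f y) / (μ / d)) • (u : Vec d) -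
      ((f (x + μ • (u : Vec d)) - f x) / (μ / d)) • (u : Vec d)‖ ^ 2 ∂sphereUniform d ≤
      3 * d * L ^ 2 * ‖y - x‖ ^ 2 + 3 / 2 * d ^ 2 * L ^ 2 * μ ^ 2 := by
  have hd := cast_pos_of_neZero (d := d)
  have hXV : X ⊆ thickening δ X := self_subset_thickening (hμ.trans hμδ) X
  set a := ∇ f y - ∇ f x with ha
  have hrem : ∀ z ∈ X, ∀ u : USphere d,
      |f (z + μ • (u : Vec d)) - f z - μ * inner ℝ (∇ f z) (u : Vec d)| ≤ L / 2 * μ ^ 2 :=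
    fun z hz u => by
      have := hf.abs_sub_sub_inner_le (hX.thickening _) (hXV hz)
        (add_smul_mem_thickening_of_mem hμ.le hμδ hz (w := (u : Vec d)) (by simp))
      simpa [inner_smul_right, norm_smul] using this
  -- With `A` and `B` the Taylor remainders at `y` and `x`, the difference of the quotients is `d *
  -- ((q - p) + A / μ - B / μ)`. The remainders are of order `μ²`, and the linear part `q - p = ⟨a,
  -- u⟩` is averaged exactly below.
  have hpt : ∀ u : USphere d, ‖((f (y + μ • (u : Vec d)) - f y) / (μ / d)) • (u : Vec d) -
      ((f (x + μ • (u : Vec d)) - f x) / (μ / d)) • (u : Vec d)‖ ^ 2 ≤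
      3 * d ^ 2 * inner ℝ a (u : Vec d) ^ 2 + 3 / 2 * d ^ 2 * L ^ 2 * μ ^ 2 := fun u => by
    have h1 := sq_le_sq' (neg_le_of_abs_le (hrem x hx u)) (le_of_abs_le (hrem x hx u))
    have h2 := sq_le_sq' (neg_le_of_abs_le (hrem y hy u)) (le_of_abs_le (hrem y hy u))
    rw [← sub_smul, norm_smul, norm_eq_of_mem_sphere, mul_one, Real.norm_eq_abs, sq_abs, ha,
      inner_sub_left]
    set p := inner ℝ (∇ f x) (u : Vec d)
    set q := inner ℝ (∇ f y) (u : Vec d)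
    set A := f (y + μ • (u : Vec d)) - f y - μ * q with hA
    set B := f (x + μ • (u : Vec d)) - f x - μ * p with hB
    have h3 : (f (y + μ • (u : Vec d)) - f y) / (μ / d) - (f (x + μ • (u : Vec d)) - f x) / (μ / d)
        = d * ((q - p) + A / μ - B / μ) := by
      rw [hA, hB]
      field_simp
      ring
    have h4 : ∀ s t r : ℝ, (s + t - r) ^ 2 ≤ 3 * s ^ 2 + 3 * t ^ 2 + 3 * r ^ 2 := fun s t r => by
      nlinarith [sq_nonneg (s - t), sq_nonneg (s + r), sq_nonneg (t + r)]
    have h5 : ∀ t : ℝ, t ^ 2 ≤ (L / 2 * μ ^ 2) ^ 2 → (t / μ) ^ 2 ≤ L ^ 2 * μ ^ 2 / 4 := fun t ht => by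
      rw [div_pow, div_le_iff₀ (by positivity)]
      linarith
    rw [h3, mul_pow]
    calc _ ≤ (d : ℝ) ^ 2 * (3 * (q - p) ^ 2 + 3 * (A / μ) ^ 2 + 3 * (B / μ) ^ 2) := by
          gcongr; exact h4 _ _ _
      _ ≤ (d : ℝ) ^ 2 * (3 * (q - p) ^ 2 + 3 * (L ^ 2 * μ ^ 2 / 4) + 3 * (L ^ 2 * μ ^ 2 / 4)) := by
          gcongr
          · exact h5 _ h2
          · exact h5 _ h1
      _ = _ := by ring
  have hci : Integrable (fun u : USphere d => inner ℝ a (u : Vec d) ^ 2) (sphereUniform d) := by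
    have hc : Continuous fun u : USphere d => inner ℝ a (u : Vec d) ^ 2 := by fun_prop
    exact hc.integrable_of_hasCompactSupport (HasCompactSupport.of_compactSpace _)
  refine (integral_mono_of_nonneg (.of_forall fun u => by positivity)
    ((hci.const_mul _).add (integrable_const _)) (.of_forall hpt)).trans ?_
  rw [Pi.add_def, integral_add (hci.const_mul _) (integrable_const _), integral_const_mul,
    integral_inner_sq_sphereUniform]
  simp only [integral_const, probReal_univ, one_smul]
  have h6 : ‖a‖ ^ 2 ≤ L ^ 2 * ‖y - x‖ ^ 2 := by
    rw [← mul_pow]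
    have := hf.norm_gradient_sub_le y (hXV hy) x (hXV hx)
    gcongr
  have h7 : 3 * (d : ℝ) ^ 2 * (‖a‖ ^ 2 / d) = 3 * d * ‖a‖ ^ 2 := by field_simp
  rw [h7]
  have h8 : 3 * (d : ℝ) * ‖a‖ ^ 2 ≤ 3 * d * (L ^ 2 * ‖y - x‖ ^ 2) := by gcongr
  linarith

end Smoothing

end AccZOM

/-! ### Second moments and the momentum error. -/

namespace AccZOM

open Metric Set Filter Topology

section SecondMoment

variable {α E : Type*} [MeasurableSpace α] {ν : Measure α} [NormedAddCommGroup E]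

theorem _root_.MeasureTheory.MemLp.integrable_norm_sq {f : α → E} (hf : MemLp f 2 ν) :
    Integrable (fun z => ‖f z‖ ^ 2) ν :=
  hf.integrable_norm_pow two_ne_zero

variable [InnerProductSpace ℝ E] [CompleteSpace E] [IsProbabilityMeasure ν]

theorem integral_norm_add_const_sq {W : α → E} (hW : MemLp W 2 ν) (h0 : ∫ z, W z ∂ν = 0) (c : E) :
    ∫ z, ‖c + W z‖ ^ 2 ∂ν = ‖c‖ ^ 2 + ∫ z, ‖W z‖ ^ 2 ∂ν := by
  have hi : Integrable W ν := hW.integrable one_le_two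
  have h1 : Integrable (fun z => 2 * inner ℝ c (W z)) ν := (hi.const_inner c).const_mul 2
  have h2 : Integrable (fun z => ‖c‖ ^ 2 + 2 * inner ℝ c (W z)) ν := (integrable_const _).add h1
  simp_rw [norm_add_sq_real]
  rw [integral_add h2 hW.integrable_norm_sq, integral_add (integrable_const _) h1,
    integral_const_mul,
    integral_inner hi, h0]
  simp

theorem integral_norm_sub_integral_sq_le {Z : α → E} (hZ : MemLp Z 2 ν) :
    ∫ z, ‖Z z - ∫ y, Z y ∂ν‖ ^ 2 ∂ν ≤ ∫ z, ‖Z z‖ ^ 2 ∂ν := by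
  have hi : Integrable Z ν := hZ.integrable one_le_two
  have h := integral_norm_add_const_sq (hZ.sub (memLp_const (∫ y, Z y ∂ν))) (by
    simp only [Pi.sub_apply]
    rw [integral_sub hi (integrable_const _)]; simp) (∫ y, Z y ∂ν)
  simp only [Pi.sub_apply, add_sub_cancel] at h
  rw [h]
  linarith [sq_nonneg ‖∫ y, Z y ∂ν‖]

/-- The mean square error of a recursive momentum estimator after one step. -/
theorem integral_norm_momentum_error_sq_le {A B : α → E} (hA : MemLp A 2 ν) (hB : MemLp B 2 ν)
    (v : E) (β : ℝ) :
    ∫ z, ‖A z + (1 - β) • (v - B z) - ∫ y, A y ∂ν‖ ^ 2 ∂ν ≤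
      (1 - β) ^ 2 * ‖v - ∫ y, B y ∂ν‖ ^ 2 + 2 * (1 - β) ^ 2 * ∫ z, ‖A z - B z‖ ^ 2 ∂ν +
        2 * β ^ 2 * ∫ z, ‖A z - ∫ y, A y ∂ν‖ ^ 2 ∂ν := by
  set a := ∫ y, A y ∂ν with ha
  set b := ∫ y, B y ∂ν with hb
  have hAi : Integrable A ν := hA.integrable one_le_two
  have hBi : Integrable B ν := hB.integrable one_le_two
  have hAa : MemLp (fun z => A z - a) 2 ν := hA.sub (memLp_const a)
  have hD : MemLp (fun z => (A z - B z) - (a - b)) 2 ν := (hA.sub hB).sub (memLp_const _)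
  have hAa0 : ∫ z, (A z - a) ∂ν = 0 := by
    rw [integral_sub hAi (integrable_const _)]; simp [ha]
  have hD0 : ∫ z, ((A z - B z) - (a - b)) ∂ν = 0 := by
    have h1 : Integrable (fun z => A z - B z) ν := hAi.sub hBi
    rw [integral_sub h1 (integrable_const _)]
    simp [integral_sub hAi hBi, ha, hb]
  -- The new error splits into the deterministic part `(1 - β) • (v - b)` and the centred noise `W`.
  -- The cross term vanishes, so the old error keeps the factor `(1 - β)²` without a constant; the
  -- factor `2` is lost only inside `W`.
  set W : α → E := fun z => (1 - β) • ((A z - B z) - (a - b)) + β • (A z - a) with hW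
  have hWL : MemLp W 2 ν := (hD.const_smul (1 - β)).add (hAa.const_smul β)
  have hW0 : ∫ z, W z ∂ν = 0 := by
    have h1 : Integrable (fun z => (1 - β) • ((A z - B z) - (a - b))) ν :=
      (hD.integrable one_le_two).smul _
    have h2 : Integrable (fun z => β • (A z - a)) ν := (hAa.integrable one_le_two).smul _
    simp only [hW]
    rw [integral_add h1 h2, integral_smul, integral_smul, hAa0, hD0]
    simp
  have h1 : ∀ z, A z + (1 - β) • (v - B z) - a = (1 - β) • (v - b) + W z := fun z => by
    simp only [hW]
    module
  simp_rw [h1]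
  rw [integral_norm_add_const_sq hWL hW0, norm_smul, mul_pow, Real.norm_eq_abs, sq_abs, add_assoc]
  gcongr
  have h2 : ∀ z, ‖W z‖ ^ 2 ≤ 2 * (1 - β) ^ 2 * ‖(A z - B z) - (a - b)‖ ^ 2 +
      2 * β ^ 2 * ‖A z - a‖ ^ 2 := fun z => by
    have h3 : ‖W z‖ ≤ |1 - β| * ‖(A z - B z) - (a - b)‖ + |β| * ‖A z - a‖ := by
      refine (norm_add_le _ _).trans_eq ?_
      rw [norm_smul, norm_smul, Real.norm_eq_abs, Real.norm_eq_abs]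
    calc ‖W z‖ ^ 2 ≤ (|1 - β| * ‖(A z - B z) - (a - b)‖ + |β| * ‖A z - a‖) ^ 2 := by gcongr
      _ ≤ 2 * ((|1 - β| * ‖(A z - B z) - (a - b)‖) ^ 2 + (|β| * ‖A z - a‖) ^ 2) := add_sq_le
      _ = _ := by rw [mul_pow, mul_pow, sq_abs, sq_abs]; ring
  have h5 : Integrable (fun z => 2 * (1 - β) ^ 2 * ‖(A z - B z) - (a - b)‖ ^ 2) ν :=
    hD.integrable_norm_sq.const_mul _
  have h6 : Integrable (fun z => 2 * β ^ 2 * ‖A z - a‖ ^ 2) ν := hAa.integrable_norm_sq.const_mul _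
  refine (integral_mono hWL.integrable_norm_sq (h5.add h6) h2).trans ?_
  rw [Pi.add_def, integral_add h5 h6, integral_const_mul, integral_const_mul]
  have h4 := integral_norm_sub_integral_sq_le (hA.sub hB)
  simp only [Pi.sub_apply] at h4
  rw [integral_sub hAi hBi, ← ha, ← hb] at h4
  gcongr

end SecondMoment

/-! ### The stochastic estimator on `X`. -/

namespace Problem

variable {d : ℕ} {Ξ : Type*} [MeasurableSpace Ξ] {Q : Problem d Ξ} {L σ μ : ℝ}

theorem uniGE_val (x : Vec d) (ξ : Ξ) (u : USphere d) :
    (Q.uniGE μ x ξ u).val = ((Q.F (x + μ • (u : Vec d)) ξ - Q.F x ξ) / (μ / d)) • (u : Vec d) :=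
  rfl

theorem measurable_uniGE (hF : Measurable (Function.uncurry Q.F)) {α : Type*} [MeasurableSpace α]
    {x : α → Vec d} {ξ : α → Ξ} {u : α → USphere d} (hx : Measurable x) (hξ : Measurable ξ)
    (hu : Measurable u) : Measurable fun a => (Q.uniGE μ (x a) (ξ a) (u a)).val := by
  simp only [uniGE_val]
  have h1 : Measurable fun a => Q.F (x a + μ • (u a : Vec d)) (ξ a) :=
    hF.comp ((hx.add (hu.subtype_val.const_smul μ)).prodMk hξ)
  have h2 : Measurable fun a => Q.F (x a) (ξ a) := hF.comp (hx.prodMk hξ)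
  exact ((h1.sub h2).div_const _).smul hu.subtype_val

theorem Regular.exists_hasLipschitzGradientOn (h : Q.Regular L σ μ) :
    ∃ δ, μ < δ ∧ (∀ x ∈ thickening δ Q.X, Integrable (Q.F x) Q.P) ∧
      (∀ ξ, HasLipschitzGradientOn L (fun y => Q.F y ξ) (thickening δ Q.X)) ∧
      HasLipschitzGradientOn L Q.obj (thickening δ Q.X) := by
  obtain ⟨δ, hδ, h1, h2, h3⟩ := h.smooth
  have := h.isProbabilityMeasure
  have h4 : ∀ ξ, HasLipschitzGradientOn L (fun y => Q.F y ξ) (thickening δ Q.X) :=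
    fun ξ => ⟨h2 ξ, h3 ξ⟩
  exact ⟨δ, hδ, h1, h4, .integral isOpen_thickening (h.convex.thickening _) (.of_forall h4) h1⟩

theorem Regular.smoothing_hasLipschitzGradientOn (h : Q.Regular L σ μ) (hμ : 0 < μ) :
    HasLipschitzGradientOn L (smoothing μ Q.obj) Q.X := by
  obtain ⟨δ, hδ, -, -, hf⟩ := h.exists_hasLipschitzGradientOn
  exact (hf.smoothing h.convex hμ).mono (self_subset_thickening (sub_pos.2 hδ) _)

theorem Regular.le_smoothing (h : Q.Regular L σ μ) (hμ : 0 < μ) {b : ℝ} {x : Vec d} (hx : x ∈ Q.X)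
    (hb : ∀ w : Vec d, ‖w‖ ≤ 1 → b ≤ Q.obj (x + μ • w)) : b ≤ smoothing μ Q.obj x := by
  obtain ⟨δ, hδ, -, -, hf⟩ := h.exists_hasLipschitzGradientOn
  rw [smoothing_eq_integral]
  have := integral_mono_ae (integrable_const b) (hf.integrable_ballUniform hμ
    (self_subset_thickening (sub_pos.2 hδ) _ hx)) (ae_ballUniform.mono fun w hw => hb w hw)
  simpa using this

/-- The variance assumption is an integral in `ℝ≥0∞`, so its finiteness already contains square
integrability. -/
theorem Regular.memLp_uniGE_sub (h : Q.Regular L σ μ) {x : Vec d} (hx : x ∈ Q.X) :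
    MemLp (fun s : Ξ × USphere d => (Q.uniGE μ x s.1 s.2).val - ∇ (smoothing μ Q.obj) x) 2
      (Q.P.prod (sphereUniform d)) := by
  refine ⟨?_, ?_⟩
  · exact ((measurable_uniGE h.measurable measurable_const measurable_fst
      measurable_snd).sub_const _).aestronglyMeasurable
  · rw [eLpNorm_lt_top_iff_lintegral_rpow_enorm_lt_top two_ne_zero ENNReal.ofNat_ne_top]
    simpa using (h.variance x hx).trans_lt ENNReal.ofReal_lt_top

theorem Regular.integral_norm_uniGE_sub_sq_le (h : Q.Regular L σ μ) {x : Vec d} (hx : x ∈ Q.X) :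
    ∫ s : Ξ × USphere d, ‖(Q.uniGE μ x s.1 s.2).val - ∇ (smoothing μ Q.obj) x‖ ^ 2
      ∂(Q.P.prod (sphereUniform d)) ≤ σ ^ 2 := by
  rw [integral_eq_lintegral_of_nonneg_ae (.of_forall fun _ => by positivity)
    (h.memLp_uniGE_sub hx).integrable_norm_sq.aestronglyMeasurable]
  refine ENNReal.toReal_le_of_le_ofReal (sq_nonneg σ) ?_
  convert h.variance x hx using 3 with s
  rw [← ofReal_norm, ENNReal.ofReal_pow (norm_nonneg _)]

variable [NeZero d]

theorem Regular.norm_gradient_sub_le (h : Q.Regular L σ μ) (hL : 0 ≤ L) (hμ : 0 < μ) {x : Vec d}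
    (hx : x ∈ Q.X) : ‖∇ Q.obj x - ∇ (smoothing μ Q.obj) x‖ ≤ L * μ * (d / 2) := by
  obtain ⟨δ, hδ, -, -, hf⟩ := h.exists_hasLipschitzGradientOn
  exact hf.norm_gradient_sub_gradient_smoothing_le h.convex hL hμ hδ hx

theorem Regular.memLp_uniGE (h : Q.Regular L σ μ) {x : Vec d} (hx : x ∈ Q.X) :
    MemLp (fun s : Ξ × USphere d => (Q.uniGE μ x s.1 s.2).val) 2 (Q.P.prod (sphereUniform d)) := by
  have := h.isProbabilityMeasure
  convert (h.memLp_uniGE_sub hx).add (memLp_const (∇ (smoothing μ Q.obj) x)) using 1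
  ext1 s
  simp

/-- The estimator is unbiased for the gradient of the smoothing. -/
theorem Regular.integral_uniGE (h : Q.Regular L σ μ) (hL : 0 ≤ L) (hμ : 0 < μ) {x : Vec d}
    (hx : x ∈ Q.X) :
    ∫ s : Ξ × USphere d, (Q.uniGE μ x s.1 s.2).val ∂(Q.P.prod (sphereUniform d)) =
      ∇ (smoothing μ Q.obj) x := by
  have := h.isProbabilityMeasure
  obtain ⟨δ, hδ, hint, -, hf⟩ := h.exists_hasLipschitzGradientOn
  -- Integrating over `ξ` first turns the component function into the objective, to which the sphere
  -- formula applies.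
  rw [integral_prod_symm _ ((h.memLp_uniGE hx).integrable one_le_two),
    ← hf.integral_sphereUniform_smul h.convex hL hμ hδ hx]
  refine integral_congr_ae (.of_forall fun u => ?_)
  simp only [uniGE_val]
  rw [integral_smul_const, integral_div, integral_sub
    (hint _ (add_smul_mem_thickening_of_mem hμ.le hδ hx (by simp)))
    (hint _ (self_subset_thickening (hμ.trans hδ) _ hx))]
  rfl

/-- Here the sphere is averaged first: both estimators share the sample `ξ`, so the smoothness of a
single component gives the bound for every `ξ`. -/
theorem Regular.integral_norm_uniGE_sub_uniGE_sq_le (h : Q.Regular L σ μ) (hμ : 0 < μ)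
    {x y : Vec d} (hx : x ∈ Q.X) (hy : y ∈ Q.X) :
    ∫ s : Ξ × USphere d, ‖(Q.uniGE μ y s.1 s.2).val - (Q.uniGE μ x s.1 s.2).val‖ ^ 2
      ∂(Q.P.prod (sphereUniform d)) ≤
      3 * d * L ^ 2 * ‖y - x‖ ^ 2 + 3 / 2 * d ^ 2 * L ^ 2 * μ ^ 2 := by
  have := h.isProbabilityMeasure
  obtain ⟨δ, hδ, -, hF, -⟩ := h.exists_hasLipschitzGradientOn
  have hm := ((h.memLp_uniGE hy).sub (h.memLp_uniGE hx)).integrable_norm_sq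
  simp only [Pi.sub_apply] at hm
  rw [integral_prod _ hm]
  refine (integral_mono_of_nonneg (.of_forall fun ξ => integral_nonneg fun u => by positivity)
    (integrable_const _) (.of_forall fun ξ =>
      (hF ξ).integral_norm_estimator_sub_sq_le h.convex hμ hδ hx hy)).trans_eq ?_
  simp

theorem Regular.integral_norm_momentum_error_sq_le (h : Q.Regular L σ μ) (hL : 0 ≤ L) (hμ : 0 < μ)
    {x y : Vec d} (hx : x ∈ Q.X) (hy : y ∈ Q.X) (v : Vec d) (β : ℝ) :
    ∫ s : Ξ × USphere d, ‖(Q.uniGE μ y s.1 s.2).val + (1 - β) • (v - (Q.uniGE μ x s.1 s.2).val) -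
        ∇ (smoothing μ Q.obj) y‖ ^ 2 ∂(Q.P.prod (sphereUniform d)) ≤
      (1 - β) ^ 2 * ‖v - ∇ (smoothing μ Q.obj) x‖ ^ 2 +
        2 * (1 - β) ^ 2 * (3 * d * L ^ 2 * ‖y - x‖ ^ 2 + 3 / 2 * d ^ 2 * L ^ 2 * μ ^ 2) +
        2 * β ^ 2 * σ ^ 2 := by
  have := h.isProbabilityMeasure
  have key := AccZOM.integral_norm_momentum_error_sq_le (h.memLp_uniGE hy) (h.memLp_uniGE hx) v β
  rw [h.integral_uniGE hL hμ hx, h.integral_uniGE hL hμ hy] at key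
  refine key.trans ?_
  gcongr
  · exact h.integral_norm_uniGE_sub_uniGE_sq_le hμ hx hy
  · exact h.integral_norm_uniGE_sub_sq_le hy

end Problem

end AccZOM

/-! ### Euclidean projection and admissible step sizes. -/

namespace AccZOM

open Metric Set Filter Topology

section Projection

variable {d : ℕ} {X : Set (Vec d)}

theorem proj_spec (hX : IsClosed X) (hc : Convex ℝ X) (hne : X.Nonempty) (y : Vec d) :
    proj X y ∈ X ∧ ∀ w ∈ X, inner ℝ (y - proj X y) (w - proj X y) ≤ 0 := by
  have hex : ∃ z ∈ X, ∀ w ∈ X, ‖z - y‖ ≤ ‖w - y‖ := by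
    obtain ⟨z, hz, hzy⟩ := hX.exists_infDist_eq_dist hne y
    refine ⟨z, hz, fun w hw => ?_⟩
    rw [← dist_eq_norm, ← dist_eq_norm, dist_comm z, dist_comm w, ← hzy]
    exact infDist_le_dist_of_mem hw
  have hproj : proj X y = hex.choose := by rw [proj, dif_pos hex]
  obtain ⟨h1, h2⟩ := hex.choose_spec
  rw [← hproj] at h1 h2
  refine ⟨h1, (norm_eq_iInf_iff_real_inner_le_zero hc h1).1 ?_⟩
  have : Nonempty X := hne.to_subtype
  refine le_antisymm (le_ciInf fun w => ?_) (ciInf_le ⟨0, ?_⟩ (⟨_, h1⟩ : X))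
  · rw [norm_sub_rev, norm_sub_rev y]
    exact h2 w w.2
  · rintro _ ⟨w, rfl⟩
    exact norm_nonneg _

theorem proj_mem (hX : IsClosed X) (hc : Convex ℝ X) (hne : X.Nonempty) (y : Vec d) :
    proj X y ∈ X :=
  (proj_spec hX hc hne y).1

/-- Adding the two variational inequalities gives `‖a - b‖² ≤ ⟨y - z, a - b⟩`. The lemma serves the
measurability of `xTilde`. -/
theorem lipschitzWith_proj (hX : IsClosed X) (hc : Convex ℝ X) (hne : X.Nonempty) :
    LipschitzWith 1 (proj X) := by
  refine LipschitzWith.of_dist_le_mul fun y z => ?_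
  obtain ⟨hy, hy'⟩ := proj_spec hX hc hne y
  obtain ⟨hz, hz'⟩ := proj_spec hX hc hne z
  have h1 := hy' _ hz
  have h2 := hz' _ hy
  rw [NNReal.coe_one, one_mul, dist_eq_norm, dist_eq_norm]
  set a := proj X y
  set b := proj X z
  have h3 : ‖a - b‖ ^ 2 ≤ inner ℝ (y - z) (a - b) := by
    rw [← real_inner_self_eq_norm_sq]
    simp only [inner_sub_left, inner_sub_right] at h1 h2 ⊢
    linarith
  have h4 := real_inner_le_norm (y - z) (a - b)
  rcases (norm_nonneg (a - b)).eq_or_lt with h | h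
  · rw [← h]; positivity
  · exact le_of_mul_le_mul_right (by nlinarith) h

/-- A projected gradient step `x ↦ P_X(x - γ v)` satisfies `‖x̃ - x‖² ≤ -γ ⟨v, x̃ - x⟩`. -/
theorem norm_proj_sub_sq_le (hX : IsClosed X) (hc : Convex ℝ X) {x : Vec d} (hx : x ∈ X) (γ : ℝ)
    (v : Vec d) :
    ‖proj X (x - γ • v) - x‖ ^ 2 ≤ -(γ * inner ℝ v (proj X (x - γ • v) - x)) := by
  have h := (proj_spec hX hc ⟨x, hx⟩ (x - γ • v)).2 x hx
  rw [← real_inner_smul_left, ← real_inner_self_eq_norm_sq, ← inner_neg_left]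
  set a := proj X (x - γ • v)
  have h2 : inner ℝ (x - γ • v - a) (x - a) =
      inner ℝ (a - x) (a - x) - inner ℝ (-(γ • v)) (a - x) := by
    rw [← inner_sub_left, ← neg_sub a x, inner_neg_right, ← inner_neg_left]
    congr 1
    abel
  rw [h2] at h
  simpa using sub_nonpos.1 h

theorem norm_proj_sub_le (hX : IsClosed X) (hc : Convex ℝ X) {x : Vec d} (hx : x ∈ X) {γ : ℝ}
    (hγ : 0 ≤ γ) (v : Vec d) : ‖proj X (x - γ • v) - x‖ ≤ γ * ‖v‖ := by
  have h := norm_proj_sub_sq_le hX hc hx γ v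
  set a := proj X (x - γ • v) - x
  have h1 : -(γ * inner ℝ v a) ≤ γ * ‖v‖ * ‖a‖ := by
    have := neg_le_of_abs_le (abs_real_inner_le_norm v a)
    nlinarith
  rcases (norm_nonneg a).eq_or_lt with h0 | h0
  · rw [← h0]; positivity
  · exact le_of_mul_le_mul_right (by nlinarith) h0

end Projection

theorem le_add_natCast_rpow_of_pow_le {a m : ℝ} (ha : 0 ≤ a) (ham : a ^ 3 ≤ m) (n : ℕ) :
    a ≤ (m + n) ^ (1 / 3 : ℝ) := by
  have h1 : a = (a ^ 3) ^ (1 / 3 : ℝ) := by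
    rw [← Real.rpow_natCast, ← Real.rpow_mul ha]; norm_num
  rw [h1]
  refine Real.rpow_le_rpow (by positivity) ?_ (by norm_num)
  have : (0 : ℝ) ≤ n := n.cast_nonneg
  linarith

namespace Params.Valid

variable {p : Params} {d T : ℕ} {L : ℝ}

theorem m_ge_two (h : p.Valid d T L) : 2 ≤ p.m := (le_max_left _ _).trans h.m_ge

theorem c_pos (h : p.Valid d T L) : 0 < p.c := by
  have := h.c_ge
  have hk := h.k_pos
  have : 0 ≤ 2 / (3 * p.k ^ 3) := by positivity
  linarith

theorem m_add_pos (h : p.Valid d T L) (n : ℕ) : 0 < p.m + n := by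
  have := h.m_ge_two
  have : (0 : ℝ) ≤ n := n.cast_nonneg
  linarith

theorem eta_pos (h : p.Valid d T L) (n : ℕ) : 0 < p.eta n :=
  div_pos h.k_pos (Real.rpow_pos_of_pos (h.m_add_pos n) _)

theorem eta_le_one (h : p.Valid d T L) (n : ℕ) : p.eta n ≤ 1 := by
  rw [Params.eta, div_le_one (Real.rpow_pos_of_pos (h.m_add_pos n) _)]
  exact le_add_natCast_rpow_of_pow_le h.k_pos.le
    (((le_max_right _ _).trans (le_max_right _ _)).trans h.m_ge) n

theorem eta_le (h : p.Valid d T L) (n : ℕ) : p.eta n ≤ p.k / p.m ^ (1 / 3 : ℝ) := by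
  have := h.m_ge_two
  have hk := h.k_pos
  unfold Params.eta
  gcongr
  simp

theorem c_mul_eta_le_one (h : p.Valid d T L) (n : ℕ) : p.c * p.eta n ≤ 1 := by
  rw [Params.eta, ← mul_div_assoc, div_le_one (Real.rpow_pos_of_pos (h.m_add_pos n) _)]
  exact le_add_natCast_rpow_of_pow_le (mul_pos h.c_pos h.k_pos).le
    (((le_max_left _ _).trans (le_max_right _ _)).trans h.m_ge) n

theorem alpha_le_one (h : p.Valid d T L) (n : ℕ) : p.c * p.eta n ^ 2 ≤ 1 := by
  have h1 := h.c_mul_eta_le_one n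
  have h2 := h.eta_le_one n
  have h3 := h.eta_pos n
  nlinarith

theorem alpha_nonneg (h : p.Valid d T L) (n : ℕ) : 0 ≤ p.c * p.eta n ^ 2 := by
  have := h.c_pos
  positivity

theorem mul_eta_mul_le (h : p.Valid d T L) (hL : 0 < L) (n : ℕ) :
    2 * L * p.eta n * p.γ ≤ 1 := by
  have h1 := h.γ_le.trans (min_le_left _ _)
  have h2 := h.eta_le n
  have h3 := h.k_pos
  have h4 : 0 < p.m ^ (1 / 3 : ℝ) := Real.rpow_pos_of_pos (by linarith [h.m_ge_two]) _
  calc 2 * L * p.eta n * p.γ ≤ 2 * L * (p.k / p.m ^ (1 / 3 : ℝ)) *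
        (p.m ^ (1 / 3 : ℝ) / (2 * L * p.k)) := by
        have := h.γ_pos; have := (h.eta_pos n).le; gcongr
    _ = 1 := by field_simp

/-- This keeps the displacement term of the momentum recursion within half of the descent gain. -/
theorem mul_γ_sq_le (h : p.Valid d T L) (hL : 0 < L) (hd : 1 ≤ d) :
    24 * d * L ^ 2 * p.γ ^ 2 ≤ 1 := by
  have h1 := h.γ_le.trans (min_le_right _ _)
  have hd' : (0 : ℝ) < d := by exact_mod_cast hd
  have h2 : (2 * √(6 * d) * L) ^ 2 = 24 * d * L ^ 2 := by
    rw [mul_pow, mul_pow, Real.sq_sqrt (by positivity)]; ring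
  calc 24 * d * L ^ 2 * p.γ ^ 2 ≤ 24 * d * L ^ 2 * (1 / (2 * √(6 * d) * L)) ^ 2 := by
        have := h.γ_pos; gcongr
    _ = 1 := by rw [div_pow, h2]; field_simp

end Params.Valid

/-! ### One iteration: feasibility, descent, measurability. -/

namespace Problem

variable {d T : ℕ} {Ξ : Type*} [MeasurableSpace Ξ] {Q : Problem d Ξ} {L σ : ℝ} {p : Params}

theorem Regular.xTilde_mem (h : Q.Regular L σ p.μ) {s : State d} (hs : s.x ∈ Q.X) :
    Q.xTilde p s ∈ Q.X :=
  proj_mem h.isClosed h.convex ⟨_, hs⟩ _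

theorem Regular.step_x_mem (h : Q.Regular L σ p.μ) (hp : p.Valid d T L) (n : ℕ) {s : State d}
    (hs : s.x ∈ Q.X) : s.x + p.eta n • (Q.xTilde p s - s.x) ∈ Q.X :=
  h.convex.add_smul_sub_mem hs (h.xTilde_mem hs) ⟨(hp.eta_pos n).le, hp.eta_le_one n⟩

theorem Regular.run_x_mem (h : Q.Regular L σ p.μ) (hp : p.Valid d T L) {x₁ : Vec d}
    (hx₁ : x₁ ∈ Q.X) (ξ : ℕ → Ξ) (u : ℕ → USphere d) (n : ℕ) : (Q.run p x₁ ξ u n).x ∈ Q.X := by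
  induction n with
  | zero => exact hx₁
  | succ n ih => exact h.step_x_mem hp _ ih

theorem queries_run (x₁ : Vec d) (ξ : ℕ → Ξ) (u : ℕ → USphere d) (n : ℕ) :
    (Q.run p x₁ ξ u n).queries = 4 * n + 2 := by
  induction n with
  | zero => rfl
  | succ n ih =>
    have : (Q.run p x₁ ξ u (n + 1)).queries = (Q.run p x₁ ξ u n).queries + 2 + 2 := rfl
    rw [this, ih]
    ring

/-- Descent of the smoothed objective in one iteration. -/
theorem Regular.smoothing_step_le (h : Q.Regular L σ p.μ) (hp : p.Valid d T L) (hL : 0 < L) (n : ℕ)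
    {s : State d} (hs : s.x ∈ Q.X) :
    smoothing p.μ Q.obj (s.x + p.eta n • (Q.xTilde p s - s.x)) ≤
      smoothing p.μ Q.obj s.x + p.eta n * p.γ * ‖s.v - ∇ (smoothing p.μ Q.obj) s.x‖ ^ 2 -
        p.eta n / (2 * p.γ) * ‖Q.xTilde p s - s.x‖ ^ 2 := by
  have hη := hp.eta_pos n
  have hγ := hp.γ_pos
  have hq := (h.smoothing_hasLipschitzGradientOn hp.μ_pos).abs_sub_sub_inner_le h.convex hs
    (h.step_x_mem hp n hs)
  have hpr := norm_proj_sub_sq_le h.isClosed h.convex hs p.γ s.v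
  have hLγ := hp.mul_eta_mul_le hL n
  change ‖Q.xTilde p s - s.x‖ ^ 2 ≤ -(p.γ * inner ℝ s.v (Q.xTilde p s - s.x)) at hpr
  rw [add_sub_cancel_left, inner_smul_right, norm_smul, Real.norm_of_nonneg hη.le, mul_pow] at hq
  have hq := le_of_abs_le hq
  set D := Q.xTilde p s - s.x
  set g := ∇ (smoothing p.μ Q.obj) s.x
  set η := p.eta n
  have h1 : inner ℝ g D = inner ℝ s.v D - inner ℝ (s.v - g) D := by
    rw [inner_sub_left]; ring
  -- Young's inequality is weighted to spend a quarter of the gain `‖D‖²/γ` of the projection step.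
  -- Curvature, by `2Lηγ ≤ 1`, spends another quarter (`h6`), so half remains.
  have h2 : -inner ℝ (s.v - g) D ≤ p.γ * ‖s.v - g‖ ^ 2 + 1 / (4 * p.γ) * ‖D‖ ^ 2 := by
    have h3 := neg_le_of_abs_le (abs_real_inner_le_norm (s.v - g) D)
    have h4 : p.γ * ‖s.v - g‖ ^ 2 + 1 / (4 * p.γ) * ‖D‖ ^ 2 - ‖s.v - g‖ * ‖D‖ =
        p.γ * (‖s.v - g‖ - ‖D‖ / (2 * p.γ)) ^ 2 := by field_simp; ring
    have : 0 ≤ p.γ * (‖s.v - g‖ - ‖D‖ / (2 * p.γ)) ^ 2 := by positivity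
    linarith
  have h5 : inner ℝ s.v D ≤ -(1 / p.γ * ‖D‖ ^ 2) := by
    have : inner ℝ s.v D = -(1 / p.γ * -(p.γ * inner ℝ s.v D)) := by field_simp
    rw [this]
    gcongr
  have h6 : L / 2 * (η ^ 2 * ‖D‖ ^ 2) ≤ η * (1 / (4 * p.γ)) * ‖D‖ ^ 2 := by
    have : L * η ≤ 1 / (2 * p.γ) := by
      rw [le_div_iff₀ (by positivity)]; linarith
    calc L / 2 * (η ^ 2 * ‖D‖ ^ 2) = (L * η) * (η / 2 * ‖D‖ ^ 2) := by ring
      _ ≤ 1 / (2 * p.γ) * (η / 2 * ‖D‖ ^ 2) := by gcongr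
      _ = _ := by field_simp; ring
  have h7 : η * inner ℝ g D ≤ η * (-(1 / p.γ * ‖D‖ ^ 2) +
      (p.γ * ‖s.v - g‖ ^ 2 + 1 / (4 * p.γ) * ‖D‖ ^ 2)) := by
    gcongr
    linarith
  have h8 : η * (-(1 / p.γ * ‖D‖ ^ 2) + (p.γ * ‖s.v - g‖ ^ 2 + 1 / (4 * p.γ) * ‖D‖ ^ 2)) +
      η * (1 / (4 * p.γ)) * ‖D‖ ^ 2 = η * p.γ * ‖s.v - g‖ ^ 2 - η / (2 * p.γ) * ‖D‖ ^ 2 := by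
    field_simp
    ring
  linarith

theorem measurable_gradient (f : Vec d → ℝ) : Measurable (∇ f) :=
  (InnerProductSpace.toDual ℝ (Vec d)).symm.continuous.measurable.comp (measurable_fderiv ℝ f)

/-- The position and the gradient estimate of a state. -/
def _root_.AccZOM.State.pair (s : State d) : Vec d × Vec d := (s.x, s.v)

theorem Regular.measurable_xTilde (h : Q.Regular L σ p.μ) (hne : Q.X.Nonempty) {α : Type*}
    {mα : MeasurableSpace α} {s : α → State d} (hs : Measurable fun a => (s a).pair) :
    Measurable fun a => Q.xTilde p (s a) :=
  (lipschitzWith_proj h.isClosed h.convex hne).continuous.measurable.comp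
    (hs.fst.sub (hs.snd.const_smul p.γ))

theorem Regular.measurable_step (h : Q.Regular L σ p.μ) (hne : Q.X.Nonempty) (n : ℕ) {α : Type*}
    {mα : MeasurableSpace α} {s : α → State d} {z : α → Ξ × USphere d}
    (hs : Measurable fun a => (s a).pair) (hz : Measurable z) :
    Measurable fun a => (Q.step p n (s a) (z a).1 (z a).2).pair := by
  have hx : Measurable fun a => (s a).x := hs.fst
  have hv : Measurable fun a => (s a).v := hs.snd
  have hx' : Measurable fun a => (s a).x + p.eta n • (Q.xTilde p (s a) - (s a).x) :=
    hx.add (((h.measurable_xTilde hne hs).sub hx).const_smul (p.eta n))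
  exact hx'.prodMk ((measurable_uniGE h.measurable hx' hz.fst hz.snd).add
    ((hv.sub (measurable_uniGE h.measurable hx hz.fst hz.snd)).const_smul
      (1 - p.c * p.eta n ^ 2)))

/-- The σ-algebra is arbitrary and only the samples up to `n` enter. It is instantiated with the one
generated by those samples, for independence of the next sample, and with the space of sample
sequences, for independence of `ζ`. -/
theorem Regular.measurable_run (h : Q.Regular L σ p.μ) {x₁ : Vec d} (hx₁ : x₁ ∈ Q.X) {α : Type*}
    {mα : MeasurableSpace α} {z : ℕ → α → Ξ × USphere d} (n : ℕ)
    (hz : ∀ i ≤ n, Measurable (z i)) :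
    Measurable fun a => (Q.run p x₁ (fun t => (z t a).1) (fun t => (z t a).2) n).pair := by
  induction n with
  | zero =>
    have hz0 := hz 0 le_rfl
    exact measurable_const.prodMk
      (measurable_uniGE h.measurable measurable_const hz0.fst hz0.snd)
  | succ n ih =>
    exact h.measurable_step ⟨x₁, hx₁⟩ (n + 1) (ih fun i hi => hz i (by omega)) (hz _ le_rfl)

end Problem

end AccZOM

/-! ### Expectations along the random run. -/

namespace AccZOM

open Metric Set Filter Topology

/-- Integrability and an integral bound, obtained by conditioning on one of two independent
variables. -/
theorem integrable_and_integral_le_of_indepFun {Ω α β : Type*} [MeasurableSpace Ω]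
    [MeasurableSpace α] [MeasurableSpace β] {Pr : Measure Ω} [IsProbabilityMeasure Pr]
    {ν : Measure β} [SFinite ν] {S : Ω → α} {Z : Ω → β} (hS : Measurable S) (hZ : Measurable Z)
    (hind : IndepFun S Z Pr) (hlaw : Pr.map Z = ν) {h : α × β → ℝ} (hm : Measurable h)
    (h0 : ∀ q, 0 ≤ h q) {b : Ω → ℝ} (hb : Integrable b Pr)
    (hint : ∀ ω, Integrable (fun z => h (S ω, z)) ν) (hle : ∀ ω, ∫ z, h (S ω, z) ∂ν ≤ b ω) :
    Integrable (fun ω => h (S ω, Z ω)) Pr ∧ ∫ ω, h (S ω, Z ω) ∂Pr ≤ ∫ ω, b ω ∂Pr := by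
  have hb0 : ∀ ω, 0 ≤ b ω := fun ω => (integral_nonneg fun z => h0 _).trans (hle ω)
  -- Tonelli in `ℝ≥0∞` needs no prior integrability on the product, so this one estimate yields both
  -- conclusions.
  have hlint : ∫⁻ ω, ENNReal.ofReal (h (S ω, Z ω)) ∂Pr ≤ ENNReal.ofReal (∫ ω, b ω ∂Pr) := by
    have hprod := (indepFun_iff_map_prod_eq_prod_map_map hS.aemeasurable hZ.aemeasurable).1 hind
    rw [hlaw] at hprod
    calc ∫⁻ ω, ENNReal.ofReal (h (S ω, Z ω)) ∂Pr
        = ∫⁻ q, ENNReal.ofReal (h q) ∂(Pr.map fun ω => (S ω, Z ω)) :=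
          (lintegral_map hm.ennreal_ofReal (hS.prodMk hZ)).symm
      _ = ∫⁻ s, ∫⁻ z, ENNReal.ofReal (h (s, z)) ∂ν ∂(Pr.map S) := by
          rw [hprod, lintegral_prod _ hm.ennreal_ofReal.aemeasurable]
      _ = ∫⁻ ω, ∫⁻ z, ENNReal.ofReal (h (S ω, z)) ∂ν ∂Pr :=
          lintegral_map hm.ennreal_ofReal.lintegral_prod_right' hS
      _ ≤ ∫⁻ ω, ENNReal.ofReal (b ω) ∂Pr := by
          refine lintegral_mono fun ω => ?_
          rw [← ofReal_integral_eq_lintegral_ofReal (hint ω) (.of_forall fun z => h0 _)]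
          exact ENNReal.ofReal_le_ofReal (hle ω)
      _ = ENNReal.ofReal (∫ ω, b ω ∂Pr) :=
          (ofReal_integral_eq_lintegral_ofReal hb (.of_forall hb0)).symm
  have hmeas : Measurable fun ω => h (S ω, Z ω) := hm.comp (hS.prodMk hZ)
  refine ⟨⟨hmeas.aestronglyMeasurable, ?_⟩, ?_⟩
  · rw [hasFiniteIntegral_iff_ofReal (.of_forall fun ω => h0 _)]
    exact hlint.trans_lt ENNReal.ofReal_lt_top
  · rw [integral_eq_lintegral_of_nonneg_ae (.of_forall fun ω => h0 _) hmeas.aestronglyMeasurable]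
    exact ENNReal.toReal_le_of_le_ofReal (integral_nonneg hb0) hlint

namespace Problem

variable {d T : ℕ} {Ξ Ω : Type*} [MeasurableSpace Ξ] [MeasurableSpace Ω] {Q : Problem d Ξ}
  {L σ : ℝ} {p : Params} {x₁ : Vec d} {Pr : Measure Ω} {ξ : ℕ → Ω → Ξ} {u : ℕ → Ω → USphere d}
  {ζ : Ω → Fin T}

theorem _root_.AccZOM.IsSampling.measurable_sample (hS : IsSampling Q.P Pr ξ u ζ) (t : ℕ) :
    Measurable fun ω => (ξ t ω, u t ω) :=
  (hS.measurable_ξ t).prodMk (hS.measurable_u t)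

/-- The run of the algorithm on random samples. -/
noncomputable def randomRun (Q : Problem d Ξ) (p : Params) (x₁ : Vec d) (ξ : ℕ → Ω → Ξ)
    (u : ℕ → Ω → USphere d) (n : ℕ) (ω : Ω) : State d :=
  Q.run p x₁ (fun t => ξ t ω) (fun t => u t ω) n

theorem randomRun_succ {Ω : Type*} {ξ : ℕ → Ω → Ξ} {u : ℕ → Ω → USphere d} (n : ℕ) (ω : Ω) :
     Q.randomRun p x₁ ξ u (n + 1) ω =
    Q.step p (n + 1) (Q.randomRun p x₁ ξ u n ω) (ξ (n + 1) ω) (u (n + 1) ω) :=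
  rfl

theorem Regular.measurable_randomRun (h : Q.Regular L σ p.μ) (hx₁ : x₁ ∈ Q.X)
    (hS : IsSampling Q.P Pr ξ u ζ) (n : ℕ) :
    Measurable fun ω => (Q.randomRun p x₁ ξ u n ω).pair :=
  h.measurable_run hx₁ (z := fun t ω => (ξ t ω, u t ω)) n fun i _ => hS.measurable_sample i

/-- State `n` is measurable with respect to samples `0, …, n`, whose joint σ-algebra is independent
of sample `n + 1`. -/
theorem Regular.indepFun_randomRun (h : Q.Regular L σ p.μ) (hx₁ : x₁ ∈ Q.X)
    (hS : IsSampling Q.P Pr ξ u ζ) (n : ℕ) :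
    IndepFun (fun ω => (Q.randomRun p x₁ ξ u n ω).pair) (fun ω => (ξ (n + 1) ω, u (n + 1) ω)) Pr := by
  set m : ℕ → MeasurableSpace Ω := fun t =>
    MeasurableSpace.comap (fun ω => (ξ t ω, u t ω)) inferInstance with hm
  have hle : ∀ t, m t ≤ (inferInstance : MeasurableSpace Ω) :=
    fun t => (hS.measurable_sample t).comap_le
  have hdisj : Disjoint (Iic n) ({n + 1} : Set ℕ) := by simp
  have hind := indep_iSup_of_disjoint hle hS.indep.iIndep hdisj
  rw [IndepFun_iff_Indep]
  refine indep_of_indep_of_le_left (indep_of_indep_of_le_right hind ?_) ?_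
  · simp [hm]
  · rw [← measurable_iff_comap_le]
    refine h.measurable_run (mα := ⨆ i ∈ Iic n, m i) hx₁ (z := fun t ω => (ξ t ω, u t ω)) n
      fun i hi => ?_
    rw [measurable_iff_comap_le]
    exact le_iSup₂ (f := fun i (_ : i ∈ Iic n) => m i) i hi

/-- The error of the gradient estimate of a state. -/
noncomputable def err (Q : Problem d Ξ) (p : Params) (s : State d) : Vec d :=
  s.v - ∇ (smoothing p.μ Q.obj) s.x

/-- The displacement of the projected gradient step of a state. -/
noncomputable def displacement (Q : Problem d Ξ) (p : Params) (s : State d) : Vec d := Q.xTilde p s - s.x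

theorem Regular.measurable_err {α : Type*} [MeasurableSpace α] {s : α → State d}
    (hs : Measurable fun a => (s a).pair) : Measurable fun a => Q.err p (s a) :=
  hs.snd.sub ((measurable_gradient _).comp hs.fst)

theorem Regular.measurable_displacement (h : Q.Regular L σ p.μ) (hne : Q.X.Nonempty) {α : Type*}
    [MeasurableSpace α] {s : α → State d}
    (hs : Measurable fun a => (s a).pair) : Measurable fun a => Q.displacement p (s a) :=
  (h.measurable_xTilde hne hs).sub hs.fst

/-- `X` may be unbounded, so square integrability is propagated by induction. It holds here because
`‖x̃ - x‖ ≤ γ‖v‖`, where `v` is its error plus a gradient that grows at most linearly in `‖x - x₁‖`.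
-/
theorem Regular.memLp_displacement (h : Q.Regular L σ p.μ) (hp : p.Valid d T L)
    [IsFiniteMeasure Pr] {s : Ω → State d} (hx₁ : x₁ ∈ Q.X) (hsX : ∀ ω, (s ω).x ∈ Q.X)
    (hs : Measurable fun ω => (s ω).pair) (hx : MemLp (fun ω => (s ω).x - x₁) 2 Pr)
    (he : MemLp (fun ω => Q.err p (s ω)) 2 Pr) :
    MemLp (fun ω => Q.displacement p (s ω)) 2 Pr := by
  set g := ∇ (smoothing p.μ Q.obj)
  have hb : MemLp (fun ω => p.γ * (‖Q.err p (s ω)‖ + (‖g x₁‖ + L * ‖(s ω).x - x₁‖))) 2 Pr :=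
    (he.norm.add ((memLp_const ‖g x₁‖).add (hx.norm.const_mul L))).const_mul p.γ
  refine hb.of_le (h.measurable_displacement ⟨_, hx₁⟩ hs).aestronglyMeasurable
    (.of_forall fun ω => ?_)
  refine ((norm_proj_sub_le h.isClosed h.convex (hsX ω) hp.γ_pos.le _).trans ?_).trans
    (Real.le_norm_self _)
  have := hp.γ_pos
  have h1 := (h.smoothing_hasLipschitzGradientOn hp.μ_pos).norm_gradient_sub_le _ (hsX ω) _ hx₁
  have h2 : (s ω).v = Q.err p (s ω) + (g x₁ + (g (s ω).x - g x₁)) := by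
    simp [err, g]
  gcongr
  rw [h2]
  refine (norm_add_le _ _).trans ?_
  gcongr
  exact (norm_add_le _ _).trans (by gcongr)

theorem Regular.memLp_run_zero (h : Q.Regular L σ p.μ) (hx₁ : x₁ ∈ Q.X)
    (hS : IsSampling Q.P Pr ξ u ζ) :
    MemLp (fun ω => Q.err p (Q.randomRun p x₁ ξ u 0 ω)) 2 Pr ∧
    ∫ ω, ‖Q.err p (Q.randomRun p x₁ ξ u 0 ω)‖ ^ 2 ∂Pr ≤ σ ^ 2 := by
  have hz := hS.measurable_sample 0
  have hL := h.memLp_uniGE_sub hx₁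
  have hv := h.integral_norm_uniGE_sub_sq_le hx₁
  rw [← hS.law 0] at hL hv
  refine ⟨hL.comp_of_map hz.aemeasurable, ?_⟩
  rw [integral_map hz.aemeasurable hL.integrable_norm_sq.aestronglyMeasurable] at hv
  exact hv

variable [NeZero d]

/-- The mean square error of the gradient estimate after one iteration from a random state, with an
independent sample. -/
theorem Regular.memLp_err_step (h : Q.Regular L σ p.μ) (hp : p.Valid d T L) (hL : 0 ≤ L)
    [IsProbabilityMeasure Pr] (t : ℕ) {s : Ω → State d} {z : Ω → Ξ × USphere d}
    (hne : Q.X.Nonempty) (hsX : ∀ ω, (s ω).x ∈ Q.X) (hsm : Measurable fun ω => (s ω).pair)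
    (hz : Measurable z) (hlaw : Pr.map z = Q.P.prod (sphereUniform d))
    (hind : IndepFun (fun ω => (s ω).pair) z Pr)
    (he : MemLp (fun ω => Q.err p (s ω)) 2 Pr)
    (hD : MemLp (fun ω => Q.displacement p (s ω)) 2 Pr) :
    MemLp (fun ω => Q.err p (Q.step p t (s ω) (z ω).1 (z ω).2)) 2 Pr ∧
    ∫ ω, ‖Q.err p (Q.step p t (s ω) (z ω).1 (z ω).2)‖ ^ 2 ∂Pr ≤
      (1 - p.c * p.eta t ^ 2) ^ 2 * ∫ ω, ‖Q.err p (s ω)‖ ^ 2 ∂Pr +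
      2 * (1 - p.c * p.eta t ^ 2) ^ 2 * (3 * d * L ^ 2 * (p.eta t ^ 2 *
        ∫ ω, ‖Q.displacement p (s ω)‖ ^ 2 ∂Pr) +
        3 / 2 * d ^ 2 * L ^ 2 * p.μ ^ 2) + 2 * (p.c * p.eta t ^ 2) ^ 2 * σ ^ 2 := by
  have := h.isProbabilityMeasure
  set η := p.eta t with hη
  set β := p.c * η ^ 2 with hβ
  set D := fun ω => ‖Q.displacement p (s ω)‖ ^ 2 with hDdef
  set e := fun ω => ‖Q.err p (s ω)‖ ^ 2 with hedef
  -- Neither the new error nor the new position depends on the query counter, so the state is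
  -- rebuilt from its pair with counter `0`. This makes the squared error a function on a measurable
  -- space.
  set ofPair : Vec d × Vec d → State d := fun q => ⟨q.1, q.2, 0⟩ with hofPair
  set H : (Vec d × Vec d) × (Ξ × USphere d) → ℝ := fun q =>
    ‖Q.err p (Q.step p t (ofPair q.1) q.2.1 q.2.2)‖ ^ 2 with hH
  have hstep : Measurable fun q : (Vec d × Vec d) × (Ξ × USphere d) =>
      (Q.step p t (ofPair q.1) q.2.1 q.2.2).pair :=
    h.measurable_step hne t (s := fun q : (Vec d × Vec d) × (Ξ × USphere d) =>
      ofPair q.1) measurable_fst measurable_snd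
  have hHm : Measurable H := (Regular.measurable_err (Q := Q) (p := p) hstep).norm.pow_const 2
  have hHeq : ∀ ω y, H ((s ω).pair, y) = ‖(Q.uniGE p.μ ((s ω).x + η • Q.displacement p (s ω)) y.1
      y.2).val + (1 - β) • ((s ω).v - (Q.uniGE p.μ (s ω).x y.1 y.2).val) -
      ∇ (smoothing p.μ Q.obj) ((s ω).x + η • Q.displacement p (s ω))‖ ^ 2 := fun ω y => rfl
  have hx' : ∀ ω, (s ω).x + η • Q.displacement p (s ω) ∈ Q.X := fun ω =>
    h.step_x_mem hp t (hsX ω)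
  have hinner : ∀ ω, Integrable (fun y => H ((s ω).pair, y)) (Q.P.prod (sphereUniform d)) :=
    fun ω => by
      simp_rw [hHeq]
      exact (((h.memLp_uniGE (hx' ω)).add (((memLp_const (s ω).v).sub
        (h.memLp_uniGE (hsX ω))).const_smul (1 - β))).sub (memLp_const _)).integrable_norm_sq
  have hle : ∀ ω, ∫ y, H ((s ω).pair, y) ∂(Q.P.prod (sphereUniform d)) ≤ (1 - β) ^ 2 * e ω +
      2 * (1 - β) ^ 2 * (3 * d * L ^ 2 * (η ^ 2 * D ω) + 3 / 2 * d ^ 2 * L ^ 2 * p.μ ^ 2) +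
      2 * β ^ 2 * σ ^ 2 := fun ω => by
    simp_rw [hHeq]
    refine (h.integral_norm_momentum_error_sq_le hL hp.μ_pos (hsX ω) (hx' ω) (s ω).v β).trans_eq ?_
    rw [add_sub_cancel_left, norm_smul, mul_pow, Real.norm_eq_abs, sq_abs]
    rfl
  have i1 : Integrable (fun ω => (1 - β) ^ 2 * e ω) Pr := he.integrable_norm_sq.const_mul _
  have i2 : Integrable (fun ω => 3 * d * L ^ 2 * (η ^ 2 * D ω)) Pr :=
    (hD.integrable_norm_sq.const_mul _).const_mul _
  have i3 : Integrable (fun ω => 2 * (1 - β) ^ 2 * (3 * d * L ^ 2 * (η ^ 2 * D ω) +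
      3 / 2 * d ^ 2 * L ^ 2 * p.μ ^ 2)) Pr := (i2.add (integrable_const _)).const_mul _
  have i4 : Integrable (fun ω => (1 - β) ^ 2 * e ω + 2 * (1 - β) ^ 2 * (3 * d * L ^ 2 *
      (η ^ 2 * D ω) + 3 / 2 * d ^ 2 * L ^ 2 * p.μ ^ 2)) Pr := i1.add i3
  have i5 : Integrable (fun ω => (1 - β) ^ 2 * e ω + 2 * (1 - β) ^ 2 * (3 * d * L ^ 2 *
      (η ^ 2 * D ω) + 3 / 2 * d ^ 2 * L ^ 2 * p.μ ^ 2) + 2 * β ^ 2 * σ ^ 2) Pr :=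
    i4.add (integrable_const _)
  obtain ⟨h1, h2⟩ := integrable_and_integral_le_of_indepFun hsm hz hind hlaw hHm
    (fun _ => sq_nonneg _) i5 hinner hle
  have hHeq' : ∀ ω, H ((s ω).pair, z ω) = ‖Q.err p (Q.step p t (s ω) (z ω).1 (z ω).2)‖ ^ 2 :=
    fun ω => rfl
  simp_rw [hHeq'] at h1 h2
  refine ⟨(memLp_two_iff_integrable_sq_norm ?_).2 h1, h2.trans_eq ?_⟩
  · exact (Regular.measurable_err (h.measurable_step hne t hsm hz)).aestronglyMeasurable
  · rw [integral_add i4 (integrable_const _), integral_add i1 i3, integral_const_mul,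
      integral_const_mul, integral_add i2 (integrable_const _), integral_const_mul,
      integral_const_mul]
    simp

theorem Regular.memLp_run_succ (h : Q.Regular L σ p.μ) (hp : p.Valid d T L) (hL : 0 ≤ L)
    (hx₁ : x₁ ∈ Q.X) (hS : IsSampling Q.P Pr ξ u ζ) {n : ℕ}
    (hx : MemLp (fun ω => (Q.randomRun p x₁ ξ u n ω).x - x₁) 2 Pr)
    (he : MemLp (fun ω => Q.err p (Q.randomRun p x₁ ξ u n ω)) 2 Pr) :
    MemLp (fun ω => (Q.randomRun p x₁ ξ u (n + 1) ω).x - x₁) 2 Pr ∧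
    MemLp (fun ω => Q.err p (Q.randomRun p x₁ ξ u (n + 1) ω)) 2 Pr ∧
    ∫ ω, ‖Q.err p (Q.randomRun p x₁ ξ u (n + 1) ω)‖ ^ 2 ∂Pr ≤
      (1 - p.c * p.eta (n + 1) ^ 2) ^ 2 * ∫ ω, ‖Q.err p (Q.randomRun p x₁ ξ u n ω)‖ ^ 2 ∂Pr +
      2 * (1 - p.c * p.eta (n + 1) ^ 2) ^ 2 * (3 * d * L ^ 2 * (p.eta (n + 1) ^ 2 *
        ∫ ω, ‖Q.displacement p (Q.randomRun p x₁ ξ u n ω)‖ ^ 2 ∂Pr) +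
        3 / 2 * d ^ 2 * L ^ 2 * p.μ ^ 2) + 2 * (p.c * p.eta (n + 1) ^ 2) ^ 2 * σ ^ 2 := by
  have := hS.isProbabilityMeasure
  have hsX : ∀ ω, (Q.randomRun p x₁ ξ u n ω).x ∈ Q.X := fun ω => h.run_x_mem hp hx₁ _ _ n
  have hsm := h.measurable_randomRun hx₁ hS n
  have hD := h.memLp_displacement hp hx₁ hsX hsm hx he
  have key := h.memLp_err_step hp hL (n + 1) ⟨_, hx₁⟩ hsX hsm (hS.measurable_sample (n + 1))
    (hS.law (n + 1)) (h.indepFun_randomRun hx₁ hS n) he hD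
  simp_rw [randomRun_succ]
  refine ⟨?_, key⟩
  have hstep : ∀ ω, (Q.step p (n + 1) (Q.randomRun p x₁ ξ u n ω) (ξ (n + 1) ω)
      (u (n + 1) ω)).x - x₁ = ((Q.randomRun p x₁ ξ u n ω).x - x₁) +
      p.eta (n + 1) • Q.displacement p (Q.randomRun p x₁ ξ u n ω) := fun ω => by
    rw [sub_add_eq_add_sub]
    rfl
  simp_rw [hstep]
  exact hx.add (hD.const_smul (p.eta (n + 1)))

theorem Regular.memLp_run (h : Q.Regular L σ p.μ) (hp : p.Valid d T L) (hL : 0 ≤ L)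
    (hx₁ : x₁ ∈ Q.X) (hS : IsSampling Q.P Pr ξ u ζ) (n : ℕ) :
    MemLp (fun ω => (Q.randomRun p x₁ ξ u n ω).x - x₁) 2 Pr ∧
    MemLp (fun ω => Q.err p (Q.randomRun p x₁ ξ u n ω)) 2 Pr := by
  induction n with
  | zero =>
    have := hS.isProbabilityMeasure
    exact ⟨memLp_const (x₁ - x₁), (h.memLp_run_zero hx₁ hS).1⟩
  | succ n ih =>
    obtain ⟨h1, h2, -⟩ := h.memLp_run_succ hp hL hx₁ hS ih.1 ih.2
    exact ⟨h1, h2⟩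

theorem Regular.memLp_displacement_run (h : Q.Regular L σ p.μ) (hp : p.Valid d T L) (hL : 0 ≤ L)
    (hx₁ : x₁ ∈ Q.X) (hS : IsSampling Q.P Pr ξ u ζ) (n : ℕ) :
    MemLp (fun ω => Q.displacement p (Q.randomRun p x₁ ξ u n ω)) 2 Pr := by
  have := hS.isProbabilityMeasure
  obtain ⟨h1, h2⟩ := h.memLp_run hp hL hx₁ hS n
  exact h.memLp_displacement hp hx₁ (fun ω => h.run_x_mem hp hx₁ _ _ n)
    (h.measurable_randomRun hx₁ hS n) h1 h2

theorem Regular.integrable_smoothing_run (h : Q.Regular L σ p.μ) (hp : p.Valid d T L) (hL : 0 ≤ L)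
    (hx₁ : x₁ ∈ Q.X) (hS : IsSampling Q.P Pr ξ u ζ) (n : ℕ) :
    Integrable (fun ω => smoothing p.μ Q.obj (Q.randomRun p x₁ ξ u n ω).x) Pr := by
  have := hS.isProbabilityMeasure
  obtain ⟨hx, -⟩ := h.memLp_run hp hL hx₁ hS n
  have hsX : ∀ ω, (Q.randomRun p x₁ ξ u n ω).x ∈ Q.X := fun ω => h.run_x_mem hp hx₁ _ _ n
  have hsm : Measurable fun ω => (Q.randomRun p x₁ ξ u n ω).x :=
    (h.measurable_randomRun hx₁ hS n).fst
  have hf := h.smoothing_hasLipschitzGradientOn hp.μ_pos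
  set f := smoothing p.μ Q.obj
  have hb : Integrable (fun ω => |f x₁| + ‖∇ f x₁‖ * ‖(Q.randomRun p x₁ ξ u n ω).x - x₁‖ +
      L / 2 * ‖(Q.randomRun p x₁ ξ u n ω).x - x₁‖ ^ 2) Pr :=
    ((integrable_const _).add ((hx.integrable one_le_two).norm.const_mul _)).add
      (hx.integrable_norm_sq.const_mul _)
  refine hb.mono' ?_ (.of_forall fun ω => ?_)
  -- The smoothing is known to be continuous only on `X`, so measurability goes through the subtype.
  · exact ((continuousOn_iff_continuous_domRestrict.1 hf.continuousOn).measurable.comp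
      (hsm.subtype_mk (h := hsX))).aestronglyMeasurable
  · have h1 := abs_le.1 (hf.abs_sub_sub_inner_le h.convex hx₁ (hsX ω))
    have h2 := abs_le.1 (abs_real_inner_le_norm (∇ f x₁) ((Q.randomRun p x₁ ξ u n ω).x - x₁))
    rw [Real.norm_eq_abs, abs_le]
    have h3 := abs_le.1 (le_refl |f x₁|)
    constructor <;> linarith [h1.1, h1.2, h2.1, h2.2, h3.1, h3.2]

theorem Regular.integral_smoothing_run_succ_le (h : Q.Regular L σ p.μ) (hp : p.Valid d T L)
    (hL : 0 < L) (hx₁ : x₁ ∈ Q.X) (hS : IsSampling Q.P Pr ξ u ζ) (n : ℕ) :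
    ∫ ω, smoothing p.μ Q.obj (Q.randomRun p x₁ ξ u (n + 1) ω).x ∂Pr ≤
      ∫ ω, smoothing p.μ Q.obj (Q.randomRun p x₁ ξ u n ω).x ∂Pr +
        p.eta (n + 1) * p.γ * ∫ ω, ‖Q.err p (Q.randomRun p x₁ ξ u n ω)‖ ^ 2 ∂Pr -
        p.eta (n + 1) / (2 * p.γ) *
          ∫ ω, ‖Q.displacement p (Q.randomRun p x₁ ξ u n ω)‖ ^ 2 ∂Pr := by
  have hi := h.integrable_smoothing_run hp hL.le hx₁ hS
  have he := ((h.memLp_run hp hL.le hx₁ hS n).2.integrable_norm_sq).const_mul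
    (p.eta (n + 1) * p.γ)
  have hie : Integrable (fun ω => smoothing p.μ Q.obj (Q.randomRun p x₁ ξ u n ω).x +
      p.eta (n + 1) * p.γ * ‖Q.err p (Q.randomRun p x₁ ξ u n ω)‖ ^ 2) Pr := (hi n).add he
  have hD := (h.memLp_displacement_run hp hL.le hx₁ hS n).integrable_norm_sq.const_mul
    (p.eta (n + 1) / (2 * p.γ))
  rw [← integral_const_mul, ← integral_const_mul, ← integral_add (hi n) he,
    ← integral_sub hie hD]
  exact integral_mono (hi (n + 1)) (hie.sub hD) fun ω =>
    h.smoothing_step_le hp hL (n + 1) (h.run_x_mem hp hx₁ _ _ n)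

end Problem

end AccZOM

/-! ### Step-size sums and the potential recursion. -/

namespace AccZOM

namespace Params

variable {p : Params} {d T : ℕ} {L : ℝ}

/-- The reciprocal step size, up to the factor `k`. -/
noncomputable def root (p : Params) (n : ℕ) : ℝ := (p.m + n) ^ (1 / 3 : ℝ)

theorem eta_eq_div_root (n : ℕ) : p.eta n = p.k / p.root n := rfl

namespace Valid

theorem root_pos (h : p.Valid d T L) (n : ℕ) : 0 < p.root n :=
  Real.rpow_pos_of_pos (h.m_add_pos n) _

theorem root_pow_three (h : p.Valid d T L) (n : ℕ) : p.root n ^ 3 = p.m + n := by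
  rw [root, ← Real.rpow_natCast, ← Real.rpow_mul (h.m_add_pos n).le]; norm_num

theorem rpow_two_thirds (h : p.Valid d T L) (n : ℕ) :
    (p.m + n) ^ (2 / 3 : ℝ) = p.root n ^ 2 := by
  rw [root, ← Real.rpow_natCast, ← Real.rpow_mul (h.m_add_pos n).le]; norm_num

theorem root_succ_pow_three (h : p.Valid d T L) (n : ℕ) :
    p.root (n + 1) ^ 3 = p.root n ^ 3 + 1 := by
  rw [h.root_pow_three, h.root_pow_three]; push_cast; ring

theorem root_mono (h : p.Valid d T L) {i j : ℕ} (hij : i ≤ j) : p.root i ≤ p.root j := by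
  have := h.m_add_pos i
  have hij' : (i : ℝ) ≤ j := by exact_mod_cast hij
  exact Real.rpow_le_rpow this.le (by linarith) (by norm_num)

theorem k_le_root (h : p.Valid d T L) (n : ℕ) : p.k ≤ p.root n :=
  le_add_natCast_rpow_of_pow_le h.k_pos.le
    (((le_max_right _ _).trans (le_max_right _ _)).trans h.m_ge) n

/-- The contraction of the momentum outweighs the growth of the reciprocal step size. -/
theorem one_sub_div_eta_le (h : p.Valid d T L) (n : ℕ) :
    (1 - p.c * p.eta (n + 1) ^ 2) / p.eta (n + 1) ≤ p.root n / p.k - 5 / 4 * p.eta (n + 1) := by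
  have hk := h.k_pos
  have hq := h.root_pos n
  have hρ := h.root_pos (n + 1)
  have hqρ := h.root_mono (Nat.le_succ n)
  have h3 := h.root_succ_pow_three n
  have hq3 : 2 ≤ p.root n ^ 3 := by
    rw [h.root_pow_three]
    have := h.m_ge_two
    have : (0 : ℝ) ≤ n := n.cast_nonneg
    linarith
  have hkρ := h.k_le_root (n + 1)
  have hc := h.c_ge
  rw [eta_eq_div_root]
  set q := p.root n
  set ρ := p.root (n + 1)
  set k := p.k
  have hρ2q : ρ ≤ 2 * q := by
    refine le_of_pow_le_pow_left₀ three_ne_zero (by positivity) ?_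
    nlinarith
  -- Since `ρ³ - q³ = 1`, the increment is `1 / (ρ² + ρq + q²)`, and `ρ ≤ 2q` makes the denominator
  -- at least `(3/2)ρ²`. This is the source of the `2/(3k³)` required of `c`; trading one `ρ` for `k
  -- ≤ ρ` gives `h2`.
  have h1 : (ρ - q) * ρ ^ 2 ≤ 2 / 3 := by
    have e1 : (ρ - q) * (ρ ^ 2 + ρ * q + q ^ 2) = 1 := by linear_combination h3
    have e2 : ρ ^ 2 ≤ 2 / 3 * (ρ ^ 2 + ρ * q + q ^ 2) := by nlinarith
    calc (ρ - q) * ρ ^ 2 ≤ (ρ - q) * (2 / 3 * (ρ ^ 2 + ρ * q + q ^ 2)) :=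
          mul_le_mul_of_nonneg_left e2 (sub_nonneg.2 hqρ)
      _ = 2 / 3 := by linear_combination 2 / 3 * e1
  have h2 : (ρ - q) * ρ * k ≤ 2 / 3 := by
    refine le_trans ?_ h1
    have : 0 ≤ (ρ - q) * ρ := mul_nonneg (sub_nonneg.2 hqρ) hρ.le
    nlinarith
  have h4 : (ρ - q) / k ≤ 2 / (3 * k ^ 3) * (k / ρ) := by
    have : 2 / (3 * k ^ 3) * (k / ρ) = (2 / 3 / (ρ * k)) / k := by field_simp
    rw [this]
    gcongr
    rw [le_div_iff₀ (by positivity)]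
    linarith
  have h5 : 2 / (3 * k ^ 3) * (k / ρ) ≤ (p.c - 5 / 4) * (k / ρ) := by
    gcongr
    linarith
  have h6 : (1 - p.c * (k / ρ) ^ 2) / (k / ρ) = ρ / k - p.c * (k / ρ) := by field_simp
  have h7 : (ρ - q) / k = ρ / k - q / k := sub_div _ _ _
  rw [h6]
  linarith

/-- The discrete form of `∫ x^{1/3} = (3/4) x^{4/3}`: with `ρ³ = q³ + 1`, the increment `ρ⁴ - q⁴ =
ρ³(ρ - q) + q` is at least `(4/3) q`. -/
theorem sum_root_le (h : p.Valid d T L) (n : ℕ) :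
    ∑ i ∈ Finset.range n, p.root i ≤ 3 / 4 * p.root n ^ 4 := by
  induction n with
  | zero => have := h.root_pos 0; simp; positivity
  | succ n ih =>
    rw [Finset.sum_range_succ]
    have hq := h.root_pos n
    have hρ := h.root_pos (n + 1)
    have hqρ := h.root_mono (Nat.le_succ n)
    have h3 := h.root_succ_pow_three n
    set q := p.root n
    set ρ := p.root (n + 1)
    have e1 : (ρ - q) * (ρ ^ 2 + ρ * q + q ^ 2) = 1 := by linear_combination h3
    have e2 : q * (ρ ^ 2 + ρ * q + q ^ 2) ≤ 3 * ρ ^ 3 := by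
      have hq2 : q ^ 2 ≤ ρ ^ 2 := by gcongr
      have hqρ2 : ρ * q ≤ ρ ^ 2 := by nlinarith
      have : q * (ρ ^ 2 + ρ * q + q ^ 2) ≤ ρ * (ρ ^ 2 + ρ ^ 2 + ρ ^ 2) := by gcongr
      linarith
    have e3 : q ≤ 3 * ρ ^ 3 * (ρ - q) := by
      calc q = (ρ - q) * (q * (ρ ^ 2 + ρ * q + q ^ 2)) := by linear_combination -q * e1
        _ ≤ (ρ - q) * (3 * ρ ^ 3) := mul_le_mul_of_nonneg_left e2 (sub_nonneg.2 hqρ)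
        _ = _ := by ring
    have e4 : ρ ^ 4 - q ^ 4 = ρ ^ 3 * (ρ - q) + q := by linear_combination q * h3
    linarith

/-- Each term is at most `log(m+n+1) - log(m+n)`, and the sum telescopes; `log m ≥ 0` is dropped. -/
theorem sum_inv_le_log (h : p.Valid d T L) (n : ℕ) :
    ∑ i ∈ Finset.range n, 1 / (p.m + i + 1) ≤ Real.log (p.m + n) := by
  have hm := h.m_ge_two
  suffices ∑ i ∈ Finset.range n, 1 / (p.m + i + 1) ≤ Real.log (p.m + n) - Real.log p.m by
    have := Real.log_nonneg (show 1 ≤ p.m by linarith)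
    linarith
  induction n with
  | zero => simp
  | succ n ih =>
    rw [Finset.sum_range_succ]
    have h0 := h.m_add_pos n
    have h1 := Real.one_sub_inv_le_log_of_pos (x := (p.m + n + 1) / (p.m + n)) (by positivity)
    rw [Real.log_div (by positivity) h0.ne', inv_div] at h1
    have h2 : 1 / (p.m + n + 1) = 1 - (p.m + n) / (p.m + n + 1) := by field_simp; ring
    push_cast
    rw [← add_assoc]
    linarith

theorem sq_mul_root_le (h : p.Valid d T L) (hd : 1 ≤ d) :
    (d : ℝ) ^ 2 * p.μ ^ 2 * p.root T ^ 4 ≤ 1 := by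
  have hd' : (0 : ℝ) < d := by exact_mod_cast hd
  have h1 := h.μ_le
  have h2 := h.μ_pos
  have h3 := h.root_pos T
  rw [h.rpow_two_thirds, le_div_iff₀ (by positivity)] at h1
  calc (d : ℝ) ^ 2 * p.μ ^ 2 * p.root T ^ 4 = (p.μ * (d * p.root T ^ 2)) ^ 2 := by ring
    _ ≤ 1 := pow_le_one₀ (by positivity) h1

end Valid

end Params

/-- The decrease of the potential `φ + γ a / η` in one iteration, and its consequence for the sum of
the mean square errors. -/
theorem sum_le_of_recursion {p : Params} {d T : ℕ} {L σ : ℝ} (h : p.Valid d T L) (hd : 1 ≤ d)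
    (hL : 0 < L) {a D φ : ℕ → ℝ} {b : ℝ} (ha : ∀ n, 0 ≤ a n) (hD : ∀ n, 0 ≤ D n)
    (hφ : ∀ n, b ≤ φ n) (ha0 : a 0 ≤ σ ^ 2)
    (hstep : ∀ n, φ (n + 1) ≤ φ n + p.eta (n + 1) * p.γ * a n - p.eta (n + 1) / (2 * p.γ) * D n)
    (herr : ∀ n, a (n + 1) ≤ (1 - p.c * p.eta (n + 1) ^ 2) ^ 2 * a n +
      2 * (1 - p.c * p.eta (n + 1) ^ 2) ^ 2 * (3 * d * L ^ 2 * (p.eta (n + 1) ^ 2 * D n) +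
        3 / 2 * d ^ 2 * L ^ 2 * p.μ ^ 2) + 2 * (p.c * p.eta (n + 1) ^ 2) ^ 2 * σ ^ 2) :
    ∑ n ∈ Finset.range T, (a n + D n / p.γ ^ 2) ≤
      4 * boundM p L σ (φ 0 - b) T * p.root T := by
  have hk := h.k_pos
  have hγ := h.γ_pos
  -- The weight `root n / k` is `1/η_n`, and `R n` collects the smoothing error and the sampling
  -- noise of one step.
  set Ψ : ℕ → ℝ := fun n => φ n + p.γ * (p.root n / p.k) * a n with hΨ
  set R : ℕ → ℝ := fun n => 3 * d ^ 2 * L ^ 2 * p.μ ^ 2 / p.k * p.root n +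
    2 * p.c ^ 2 * p.k ^ 3 * σ ^ 2 * (1 / (p.m + n + 1)) with hR
  have hdec : ∀ n, p.γ * p.eta (n + 1) / 4 * (a n + D n / p.γ ^ 2) ≤
      Ψ n - Ψ (n + 1) + p.γ * R n := fun n => by
    have hη := h.eta_pos (n + 1)
    have hρ := h.root_pos (n + 1)
    have hβ1 := h.alpha_le_one (n + 1)
    have hβ0 := h.alpha_nonneg (n + 1)
    have hkey := h.one_sub_div_eta_le n
    have hγd := h.mul_γ_sq_le hL hd
    have hηρ : p.root (n + 1) / p.k = 1 / p.eta (n + 1) := by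
      rw [Params.eta_eq_div_root, one_div_div]
    have h1 := mul_le_mul_of_nonneg_left (herr n) (show 0 ≤ p.γ * (1 / p.eta (n + 1)) by positivity)
    have hs := hstep n
    have hη3 : 2 * p.c ^ 2 * p.k ^ 3 * σ ^ 2 * (1 / (p.m + n + 1)) =
        2 * p.c ^ 2 * p.eta (n + 1) ^ 3 * σ ^ 2 := by
      have h3 := h.root_pow_three (n + 1)
      push_cast at h3
      rw [add_assoc, ← h3, Params.eta_eq_div_root]
      field_simp
    simp only [hΨ, hR, hηρ, hη3]
    set η := p.eta (n + 1)
    set β := p.c * η ^ 2 with hβ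
    have hsq : (1 - β) ^ 2 ≤ 1 - β := by nlinarith
    have hsq1 : (1 - β) ^ 2 ≤ 1 := by nlinarith
    have hsqη : (1 - β) ^ 2 / η ≤ p.root n / p.k - 5 / 4 * η :=
      (div_le_div_of_nonneg_right hsq hη.le).trans hkey
    -- Of the surplus `5/4 * η`, one `η` cancels the error term of the descent and `η/4` is kept.
    have t1 : p.γ * ((1 - β) ^ 2 / η) * a n ≤ p.γ * (p.root n / p.k - 5 / 4 * η) * a n := by
      have := ha n
      gcongr
    have t2 : 6 * d * L ^ 2 * p.γ * η * ((1 - β) ^ 2 * D n) ≤ η / (4 * p.γ) * D n := by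
      have hDn := hD n
      have e1 : 6 * d * L ^ 2 * p.γ ≤ 1 / (4 * p.γ) := by
        rw [le_div_iff₀ (by positivity)]; linarith
      calc 6 * d * L ^ 2 * p.γ * η * ((1 - β) ^ 2 * D n) ≤ 1 / (4 * p.γ) * η * (1 * D n) := by
            gcongr
        _ = _ := by ring
    have t3 : 3 * d ^ 2 * L ^ 2 * p.μ ^ 2 * p.γ * ((1 - β) ^ 2 / η) ≤
        3 * d ^ 2 * L ^ 2 * p.μ ^ 2 * p.γ * (p.root n / p.k) :=
      mul_le_mul_of_nonneg_left (by linarith) (by positivity)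
    have e1 : p.γ * (1 / η) * ((1 - β) ^ 2 * a n + 2 * (1 - β) ^ 2 *
        (3 * d * L ^ 2 * (η ^ 2 * D n) + 3 / 2 * d ^ 2 * L ^ 2 * p.μ ^ 2) + 2 * β ^ 2 * σ ^ 2) =
        p.γ * ((1 - β) ^ 2 / η) * a n + 6 * d * L ^ 2 * p.γ * η * ((1 - β) ^ 2 * D n) +
        3 * d ^ 2 * L ^ 2 * p.μ ^ 2 * p.γ * ((1 - β) ^ 2 / η) +
        p.γ * (2 * p.c ^ 2 * η ^ 3 * σ ^ 2) := by
      rw [hβ]; field_simp; ring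
    have e2 : p.γ * η / 4 * (a n + D n / p.γ ^ 2) = p.γ * η / 4 * a n + η / (4 * p.γ) * D n := by
      field_simp
    have e3 : η / (2 * p.γ) * D n = 2 * (η / (4 * p.γ) * D n) := by field_simp; ring
    have e4 : p.γ * (3 * d ^ 2 * L ^ 2 * p.μ ^ 2 / p.k * p.root n + 2 * p.c ^ 2 * η ^ 3 * σ ^ 2) =
        3 * d ^ 2 * L ^ 2 * p.μ ^ 2 * p.γ * (p.root n / p.k) +
        p.γ * (2 * p.c ^ 2 * η ^ 3 * σ ^ 2) := by ring
    rw [e1] at h1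
    rw [e2, e4]
    linarith
  -- Step sizes decrease, so each is replaced by the smallest, `η_T`, and the potential telescopes.
  have hsum : p.γ * p.eta T / 4 * ∑ n ∈ Finset.range T, (a n + D n / p.γ ^ 2) ≤
      Ψ 0 - Ψ T + p.γ * ∑ n ∈ Finset.range T, R n := by
    rw [Finset.mul_sum, Finset.mul_sum, ← Finset.sum_range_sub', ← Finset.sum_add_distrib]
    refine Finset.sum_le_sum fun n hn => (le_trans ?_ (hdec n))
    have hle : p.eta T ≤ p.eta (n + 1) := by
      rw [Params.eta_eq_div_root, Params.eta_eq_div_root]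
      have := h.root_pos (n + 1)
      have := h.root_mono (Nat.succ_le_of_lt (Finset.mem_range.1 hn))
      gcongr
    have := ha n
    have := hD n
    gcongr
  have hΨ0 : Ψ 0 ≤ φ 0 + p.γ * (p.m ^ (1 / 3 : ℝ) / p.k) * σ ^ 2 := by
    have hr : p.root 0 = p.m ^ (1 / 3 : ℝ) := by simp [Params.root]
    have := h.root_pos 0
    simp only [hΨ, ← hr]
    gcongr
  have hΨT : b ≤ Ψ T := by
    have h1 := hφ T
    have h2 : 0 ≤ p.γ * (p.root T / p.k) * a T := by
      have := ha T; have := h.root_pos T; positivity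
    simp only [hΨ]
    linarith
  have hRsum : ∑ n ∈ Finset.range T, R n ≤ 9 * L ^ 2 / (4 * p.k) +
      2 * p.c ^ 2 * p.k ^ 3 * σ ^ 2 * Real.log (p.m + T) := by
    simp only [hR]
    rw [Finset.sum_add_distrib, ← Finset.mul_sum, ← Finset.mul_sum]
    refine add_le_add ?_ ?_
    · calc 3 * d ^ 2 * L ^ 2 * p.μ ^ 2 / p.k * ∑ n ∈ Finset.range T, p.root n
          ≤ 3 * d ^ 2 * L ^ 2 * p.μ ^ 2 / p.k * (3 / 4 * p.root T ^ 4) := by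
            gcongr; exact h.sum_root_le T
        _ = 9 * L ^ 2 / (4 * p.k) * (d ^ 2 * p.μ ^ 2 * p.root T ^ 4) := by ring
        _ ≤ 9 * L ^ 2 / (4 * p.k) * 1 := by gcongr; exact h.sq_mul_root_le hd
        _ = _ := mul_one _
    · gcongr
      exact h.sum_inv_le_log T
  have hrT := h.root_pos T
  have hfin : p.γ * p.eta T / 4 * ∑ n ∈ Finset.range T, (a n + D n / p.γ ^ 2) ≤
      p.γ * p.k * boundM p L σ (φ 0 - b) T := by
    have hRs := mul_le_mul_of_nonneg_left hRsum hγ.le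
    have e : p.γ * p.k * boundM p L σ (φ 0 - b) T = (φ 0 - b) +
        p.γ * (p.m ^ (1 / 3 : ℝ) / p.k) * σ ^ 2 + p.γ * (9 * L ^ 2 / (4 * p.k) +
      2 * p.c ^ 2 * p.k ^ 3 * σ ^ 2 * Real.log (p.m + T)) := by
      unfold boundM
      field_simp
      ring
    rw [e]
    linarith
  have e : ∑ n ∈ Finset.range T, (a n + D n / p.γ ^ 2) = 4 * p.root T / (p.γ * p.k) *
      (p.γ * p.eta T / 4 * ∑ n ∈ Finset.range T, (a n + D n / p.γ ^ 2)) := by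
    rw [Params.eta_eq_div_root]
    generalize ∑ n ∈ Finset.range T, (a n + D n / p.γ ^ 2) = S
    field_simp
  rw [e]
  calc _ ≤ 4 * p.root T / (p.γ * p.k) * (p.γ * p.k * boundM p L σ (φ 0 - b) T) := by gcongr
    _ = _ := by field_simp

end AccZOM

/-! ### From mean squares to the expected gap. -/

namespace AccZOM

open Metric Set Filter Topology

/-- The expectation of a sequence evaluated at an independent uniform index. -/
theorem integral_uniform_index {Ω : Type*} [MeasurableSpace Ω] {Pr : Measure Ω}
    [IsProbabilityMeasure Pr] {T : ℕ} {ζ : Ω → Fin T} (hζ : Measurable ζ)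
    (hlaw : ∀ i, Pr (ζ ⁻¹' {i}) = (T : ℝ≥0∞)⁻¹) {G : ℕ → Ω → ℝ}
    (hG : ∀ n < T, Integrable (G n) Pr) (hind : ∀ n, IndepFun ζ (G n) Pr) :
    Integrable (fun ω => G (ζ ω) ω) Pr ∧
      ∫ ω, G (ζ ω) ω ∂Pr = 1 / T * ∑ n ∈ Finset.range T, ∫ ω, G n ω ∂Pr := by
  have hset : ∀ i, MeasurableSet (ζ ⁻¹' {i}) := fun i => hζ (measurableSet_singleton i)
  have hsum : (fun ω => G (ζ ω) ω) = fun ω => ∑ i : Fin T, (ζ ⁻¹' {i}).indicator (G i) ω := by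
    ext1 ω
    rw [Finset.sum_eq_single (ζ ω)]
    · simp
    · intro i _ hi
      exact indicator_of_notMem (by simpa using hi.symm) _
    · simp
  have hi : ∀ i : Fin T, Integrable ((ζ ⁻¹' {i}).indicator (G i)) Pr :=
    fun i => (hG i i.2).indicator (hset i)
  rw [hsum]
  refine ⟨integrable_finsetSum _ fun i _ => hi i, ?_⟩
  rw [integral_finsetSum _ fun i _ => hi i, Finset.sum_range, Finset.mul_sum]
  refine Finset.sum_congr rfl fun i _ => ?_
  have h1 : (ζ ⁻¹' {i}).indicator (G i) =
      fun ω => (({i} : Set (Fin T)).indicator (fun _ => (1 : ℝ)) (ζ ω)) * G i ω := by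
    ext1 ω
    by_cases h : ζ ω = i <;> simp [h]
  have hm : Measurable (({i} : Set (Fin T)).indicator (fun _ => (1 : ℝ))) :=
    measurable_const.indicator (measurableSet_singleton i)
  have hi' : IndepFun (fun ω => ({i} : Set (Fin T)).indicator (fun _ => (1 : ℝ)) (ζ ω)) (G i) Pr :=
    (hind i).comp hm measurable_id
  simp only [h1]
  rw [hi'.integral_fun_mul_eq_mul_integral (hm.comp hζ).aestronglyMeasurable
    (hG i i.2).aestronglyMeasurable]
  congr 1
  have h2 : (fun ω => ({i} : Set (Fin T)).indicator (fun _ => (1 : ℝ)) (ζ ω)) =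
      (ζ ⁻¹' {i}).indicator fun _ => (1 : ℝ) := by
    ext1 ω
    by_cases h : ζ ω = i <;> simp [h]
  rw [h2, integral_indicator_const _ (hset i), measureReal_def, hlaw]
  simp

/-- Cauchy–Schwarz over the `T` indices, then `(√A + √B)² ≤ 2(A + B)`. -/
theorem sum_le_sqrt_of_sq_le {T : ℕ} {g A B : ℕ → ℝ} {r : ℝ}
    (hg : ∀ n, g n ≤ √(A n) + √(B n) + r) (hA : ∀ n, 0 ≤ A n) (hB : ∀ n, 0 ≤ B n) :
    ∑ n ∈ Finset.range T, g n ≤ √(2 * T * ∑ n ∈ Finset.range T, (A n + B n)) + T * r := by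
  calc ∑ n ∈ Finset.range T, g n ≤ ∑ n ∈ Finset.range T, (√(A n) + √(B n) + r) :=
        Finset.sum_le_sum fun n _ => hg n
    _ = ∑ n ∈ Finset.range T, (√(A n) + √(B n)) + T * r := by
        rw [Finset.sum_add_distrib]; simp
    _ ≤ _ := by
        gcongr
        refine Real.le_sqrt_of_sq_le ((sq_sum_le_card_mul_sum_sq).trans ?_)
        have h3 : ∑ n ∈ Finset.range T, (√(A n) + √(B n)) ^ 2 ≤
            2 * ∑ n ∈ Finset.range T, (A n + B n) := by
          rw [Finset.mul_sum]
          refine Finset.sum_le_sum fun n _ => ?_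
          have h1 := Real.sq_sqrt (hA n)
          have h2 := Real.sq_sqrt (hB n)
          nlinarith [sq_nonneg (√(A n) - √(B n))]
        rw [Finset.card_range, mul_comm 2, mul_assoc]
        gcongr

theorem integral_norm_le_sqrt {Ω E : Type*} [MeasurableSpace Ω] {Pr : Measure Ω}
    [IsProbabilityMeasure Pr] [NormedAddCommGroup E] {f : Ω → E} (hf : MemLp f 2 Pr) :
    ∫ ω, ‖f ω‖ ∂Pr ≤ √(∫ ω, ‖f ω‖ ^ 2 ∂Pr) := by
  refine Real.le_sqrt_of_sq_le ?_
  have h := integral_norm_sub_integral_sq_le hf.norm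
  have h1 : Integrable (fun ω => ‖f ω‖) Pr := (hf.integrable one_le_two).norm
  have h2 : Integrable (fun ω => ‖f ω‖ ^ 2) Pr := hf.integrable_norm_sq
  set c := ∫ ω, ‖f ω‖ ∂Pr with hc
  have h3 : ∫ ω, (‖f ω‖ - c) ^ 2 ∂Pr = ∫ ω, ‖f ω‖ ^ 2 ∂Pr - c ^ 2 := by
    have h4 : ∀ ω, (‖f ω‖ - c) ^ 2 = ‖f ω‖ ^ 2 - 2 * c * ‖f ω‖ + c ^ 2 := fun ω => by ring
    simp_rw [h4]
    have h5 : Integrable (fun ω => 2 * c * ‖f ω‖) Pr := h1.const_mul _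
    have h6 : Integrable (fun ω => ‖f ω‖ ^ 2 - 2 * c * ‖f ω‖) Pr := h2.sub h5
    rw [integral_add h6 (integrable_const _), integral_sub h2 h5, integral_const_mul, ← hc]
    simp
    ring
  have h7 : 0 ≤ ∫ ω, (‖f ω‖ - c) ^ 2 ∂Pr := integral_nonneg fun ω => sq_nonneg _
  linarith

theorem boundM_nonneg {p : Params} {d T : ℕ} {L σ Δ : ℝ} (h : p.Valid d T L) (hΔ : 0 ≤ Δ) :
    0 ≤ boundM p L σ Δ T := by
  have := h.k_pos
  have := h.γ_pos
  have hm := h.m_ge_two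
  have hlog : 0 ≤ Real.log (p.m + T) := Real.log_nonneg (by
    have : (0 : ℝ) ≤ T := T.cast_nonneg
    linarith)
  unfold boundM
  positivity

/-- Subadditivity of `x ↦ x^{1/6}` splits `(m + T)^{1/6}`, which produces the two rates. -/
theorem sqrt_mul_root_div_le {p : Params} {d T : ℕ} {L M : ℝ} (h : p.Valid d T L) (hT : 1 ≤ T)
    (hM : 0 ≤ M) :
    √(2 * T * (4 * M * p.root T)) / T ≤ 2 * √(2 * M) * p.m ^ (1 / 6 : ℝ) / (T : ℝ) ^ (1 / 2 : ℝ)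
      + 2 * √(2 * M) / (T : ℝ) ^ (1 / 3 : ℝ) := by
  have hT' : (0 : ℝ) < T := by exact_mod_cast hT
  have hm := h.m_ge_two
  have hs : √(p.root T) ≤ p.m ^ (1 / 6 : ℝ) + (T : ℝ) ^ (1 / 6 : ℝ) := by
    rw [Real.sqrt_eq_rpow, Params.root, ← Real.rpow_mul (h.m_add_pos T).le]
    norm_num
    exact Real.rpow_add_le_add_rpow (by linarith) hT'.le (by norm_num) (by norm_num)
  have h1 : √(2 * T * (4 * M * p.root T)) = 2 * √(2 * M) * (√T * √(p.root T)) := by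
    have : 2 * T * (4 * M * p.root T) = 2 ^ 2 * ((2 * M) * (T * p.root T)) := by ring
    rw [this, Real.sqrt_mul (by norm_num), Real.sqrt_sq (by norm_num), Real.sqrt_mul (by positivity),
      Real.sqrt_mul hT'.le, mul_assoc]
  have h2 : (T : ℝ) = (T : ℝ) ^ (1 / 2 : ℝ) * (T : ℝ) ^ (1 / 2 : ℝ) := by
    rw [← Real.rpow_add hT']; norm_num
  have h3 : (T : ℝ) ^ (1 / 2 : ℝ) = (T : ℝ) ^ (1 / 6 : ℝ) * (T : ℝ) ^ (1 / 3 : ℝ) := by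
    rw [← Real.rpow_add hT']; norm_num
  have h4 : 0 < (T : ℝ) ^ (1 / 2 : ℝ) := Real.rpow_pos_of_pos hT' _
  have h5 : 0 < (T : ℝ) ^ (1 / 6 : ℝ) := Real.rpow_pos_of_pos hT' _
  have h6 : 0 < (T : ℝ) ^ (1 / 3 : ℝ) := Real.rpow_pos_of_pos hT' _
  rw [h1, Real.sqrt_eq_rpow T]
  calc 2 * √(2 * M) * ((T : ℝ) ^ (1 / 2 : ℝ) * √(p.root T)) / T
      = 2 * √(2 * M) * √(p.root T) / (T : ℝ) ^ (1 / 2 : ℝ) := by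
        nth_rewrite 2 [h2]
        field_simp
    _ ≤ 2 * √(2 * M) * (p.m ^ (1 / 6 : ℝ) + (T : ℝ) ^ (1 / 6 : ℝ)) / (T : ℝ) ^ (1 / 2 : ℝ) := by
        gcongr
    _ = 2 * √(2 * M) * p.m ^ (1 / 6 : ℝ) / (T : ℝ) ^ (1 / 2 : ℝ) +
        2 * √(2 * M) * ((T : ℝ) ^ (1 / 6 : ℝ) / (T : ℝ) ^ (1 / 2 : ℝ)) := by ring
    _ = _ := by
        rw [h3]
        field_simp

namespace Problem

variable {d T : ℕ} {Ξ Ω : Type*} [MeasurableSpace Ξ] [MeasurableSpace Ω] {Q : Problem d Ξ}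
  {L σ : ℝ} {p : Params} {x₁ : Vec d} {Pr : Measure Ω} {ξ : ℕ → Ω → Ξ} {u : ℕ → Ω → USphere d}
  {ζ : Ω → Fin T}

theorem Regular.measurable_gap (h : Q.Regular L σ p.μ) (hne : Q.X.Nonempty) {α : Type*}
    [MeasurableSpace α] {s : α → State d} (hs : Measurable fun a => (s a).pair) :
    Measurable fun a => Q.gap p (s a) :=
  ((((measurable_gradient Q.obj).comp hs.fst).sub hs.snd).norm).add
    ((h.measurable_displacement hne hs).norm.const_mul (1 / p.γ))

/-- The gap is a measurable function of the whole sample sequence, read off through the coordinate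
maps. -/
theorem Regular.indepFun_gap (h : Q.Regular L σ p.μ) (hx₁ : x₁ ∈ Q.X)
    (hS : IsSampling Q.P Pr ξ u ζ) (n : ℕ) :
    IndepFun ζ (fun ω => Q.gap p (Q.randomRun p x₁ ξ u n ω)) Pr :=
  hS.indep_ζ.comp measurable_id (h.measurable_gap ⟨_, hx₁⟩
    (h.measurable_run hx₁ (α := ℕ → Ξ × USphere d) (z := fun t a => a t) n
      fun i _ => measurable_pi_apply i))

variable [NeZero d]

theorem Regular.gap_le (h : Q.Regular L σ p.μ) (hL : 0 ≤ L) (hμ : 0 < p.μ) {s : State d}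
    (hs : s.x ∈ Q.X) :
    Q.gap p s ≤ ‖Q.err p s‖ + 1 / p.γ * ‖Q.displacement p s‖ + L * p.μ * (d / 2) := by
  have h1 := h.norm_gradient_sub_le hL hμ hs
  have h2 := norm_sub_le_norm_sub_add_norm_sub (∇ Q.obj s.x) (∇ (smoothing p.μ Q.obj) s.x) s.v
  rw [norm_sub_rev (∇ (smoothing p.μ Q.obj) s.x) s.v] at h2
  unfold gap err displacement
  linarith

theorem Regular.integrable_gap (h : Q.Regular L σ p.μ) (hp : p.Valid d T L) (hL : 0 ≤ L)
    (hx₁ : x₁ ∈ Q.X) (hS : IsSampling Q.P Pr ξ u ζ) (n : ℕ) :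
    Integrable (fun ω => Q.gap p (Q.randomRun p x₁ ξ u n ω)) Pr ∧
    ∫ ω, Q.gap p (Q.randomRun p x₁ ξ u n ω) ∂Pr ≤
      √(∫ ω, ‖Q.err p (Q.randomRun p x₁ ξ u n ω)‖ ^ 2 ∂Pr) +
      √((∫ ω, ‖Q.displacement p (Q.randomRun p x₁ ξ u n ω)‖ ^ 2 ∂Pr) / p.γ ^ 2) +
      L * p.μ * (d / 2) := by
  have := hS.isProbabilityMeasure
  have hγ := hp.γ_pos
  have he := (h.memLp_run hp hL hx₁ hS n).2
  have hD := h.memLp_displacement_run hp hL hx₁ hS n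
  have hsX : ∀ ω, (Q.randomRun p x₁ ξ u n ω).x ∈ Q.X := fun ω => h.run_x_mem hp hx₁ _ _ n
  have hle := fun ω => h.gap_le (p := p) hL hp.μ_pos (hsX ω)
  have i1 : Integrable (fun ω => ‖Q.err p (Q.randomRun p x₁ ξ u n ω)‖) Pr :=
    (he.integrable one_le_two).norm
  have i2 : Integrable (fun ω => 1 / p.γ * ‖Q.displacement p (Q.randomRun p x₁ ξ u n ω)‖) Pr :=
    (hD.integrable one_le_two).norm.const_mul _
  have i3 : Integrable (fun ω => ‖Q.err p (Q.randomRun p x₁ ξ u n ω)‖ +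
      1 / p.γ * ‖Q.displacement p (Q.randomRun p x₁ ξ u n ω)‖) Pr := i1.add i2
  have i4 : Integrable (fun ω => ‖Q.err p (Q.randomRun p x₁ ξ u n ω)‖ +
      1 / p.γ * ‖Q.displacement p (Q.randomRun p x₁ ξ u n ω)‖ + L * p.μ * (d / 2)) Pr :=
    i3.add (integrable_const _)
  have hgap0 : ∀ s : State d, 0 ≤ Q.gap p s := fun s => by unfold gap; positivity
  have hint : Integrable (fun ω => Q.gap p (Q.randomRun p x₁ ξ u n ω)) Pr := by
    refine i4.mono' (h.measurable_gap ⟨_, hx₁⟩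
      (h.measurable_randomRun hx₁ hS n)).aestronglyMeasurable (.of_forall fun ω => ?_)
    rw [Real.norm_of_nonneg (hgap0 _)]
    exact hle ω
  refine ⟨hint, (integral_mono hint i4 hle).trans ?_⟩
  rw [integral_add i3 (integrable_const _), integral_add i1 i2, integral_const_mul]
  have h1 := integral_norm_le_sqrt he
  have h2 := integral_norm_le_sqrt hD
  rw [Real.sqrt_div (integral_nonneg fun ω => sq_nonneg _), Real.sqrt_sq hγ.le]
  simp only [integral_const, probReal_univ, one_smul]
  rw [div_eq_inv_mul (√_), ← one_div]
  gcongr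

/-- The convergence bound. -/
theorem Regular.convergence (h : Q.Regular L σ p.μ) (hp : p.Valid d T L) (hL : 0 < L)
    (hT : 1 ≤ T) (hx₁ : x₁ ∈ Q.X) {b : ℝ}
    (hb : ∀ x ∈ Q.X, ∀ w : Vec d, ‖w‖ ≤ 1 → b ≤ Q.obj (x + p.μ • w))
    (hS : IsSampling Q.P Pr ξ u ζ) :
    let s := Q.randomRun p x₁ ξ u
    let M : ℝ := boundM p L σ (smoothing p.μ Q.obj x₁ - b) T
    (∀ n, Integrable (fun ω => Q.gap p (s n ω)) Pr) ∧
    Integrable (fun ω => Q.gap p (s (ζ ω) ω)) Pr ∧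
    ∫ ω, Q.gap p (s (ζ ω) ω) ∂Pr = 1 / T * ∑ n ∈ Finset.range T, ∫ ω, Q.gap p (s n ω) ∂Pr ∧
    ∫ ω, Q.gap p (s (ζ ω) ω) ∂Pr ≤
      2 * √(2 * M) * p.m ^ (1 / 6 : ℝ) / (T : ℝ) ^ (1 / 2 : ℝ)
        + 2 * √(2 * M) / (T : ℝ) ^ (1 / 3 : ℝ) + L / (2 * (p.m + T) ^ (2 / 3 : ℝ)) := by
  intro s M
  have := hS.isProbabilityMeasure
  have hT' : (0 : ℝ) < T := by exact_mod_cast hT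
  have hd : 1 ≤ d := NeZero.pos d
  have hd' := cast_pos_of_neZero (d := d)
  have hgap := h.integrable_gap hp hL.le hx₁ hS
  have hζ := integral_uniform_index hS.measurable_ζ hS.law_ζ (fun n _ => (hgap n).1)
    (h.indepFun_gap hx₁ hS)
  refine ⟨fun n => (hgap n).1, hζ.1, hζ.2, ?_⟩
  set a : ℕ → ℝ := fun n => ∫ ω, ‖Q.err p (Q.randomRun p x₁ ξ u n ω)‖ ^ 2 ∂Pr with ha
  set D : ℕ → ℝ := fun n => ∫ ω, ‖Q.displacement p (Q.randomRun p x₁ ξ u n ω)‖ ^ 2 ∂Pr with hD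
  set φ : ℕ → ℝ := fun n => ∫ ω, smoothing p.μ Q.obj (Q.randomRun p x₁ ξ u n ω).x ∂Pr with hφ
  have ha0 : ∀ n, 0 ≤ a n := fun n => integral_nonneg fun ω => sq_nonneg _
  have hD0 : ∀ n, 0 ≤ D n := fun n => integral_nonneg fun ω => sq_nonneg _
  have hφ0 : φ 0 = smoothing p.μ Q.obj x₁ := by
    have : φ 0 = ∫ _ : Ω, smoothing p.μ Q.obj x₁ ∂Pr := rfl
    simpa using this
  have hφb : ∀ n, b ≤ φ n := fun n => by
    have := integral_mono (integrable_const b) (h.integrable_smoothing_run hp hL.le hx₁ hS n)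
      fun ω => h.le_smoothing hp.μ_pos (h.run_x_mem hp hx₁ _ _ n)
        (hb _ (h.run_x_mem hp hx₁ _ _ n))
    simpa using this
  have hsum := sum_le_of_recursion hp hd hL ha0 hD0 hφb (h.memLp_run_zero hx₁ hS).2
    (h.integral_smoothing_run_succ_le hp hL hx₁ hS) (fun n => (h.memLp_run_succ hp hL.le hx₁ hS
      (h.memLp_run hp hL.le hx₁ hS n).1 (h.memLp_run hp hL.le hx₁ hS n).2).2.2)
  rw [hφ0] at hsum
  have hM : 0 ≤ M := boundM_nonneg hp (by have := hφb 0; rw [hφ0] at this; linarith)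
  have hg := sum_le_sqrt_of_sq_le (T := T) (fun n => (hgap n).2) ha0
    fun n => div_nonneg (hD0 n) (sq_nonneg p.γ)
  have hbias : L * p.μ * (d / 2) ≤ L / (2 * (p.m + T) ^ (2 / 3 : ℝ)) := by
    have hμ := hp.μ_le
    have hpos : 0 < (p.m + T) ^ (2 / 3 : ℝ) := Real.rpow_pos_of_pos (hp.m_add_pos T) _
    calc L * p.μ * (d / 2) ≤ L * (1 / (d * (p.m + T) ^ (2 / 3 : ℝ))) * (d / 2) := by gcongr
      _ = _ := by field_simp
  calc ∫ ω, Q.gap p (s (ζ ω) ω) ∂Pr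
      = 1 / T * ∑ n ∈ Finset.range T, ∫ ω, Q.gap p (s n ω) ∂Pr := hζ.2
    _ ≤ 1 / T * (√(2 * T * ∑ n ∈ Finset.range T, (a n + D n / p.γ ^ 2)) +
        T * (L * p.μ * (d / 2))) := by gcongr
    _ ≤ 1 / T * (√(2 * T * (4 * M * p.root T)) + T * (L * p.μ * (d / 2))) := by gcongr
    _ = √(2 * T * (4 * M * p.root T)) / T + L * p.μ * (d / 2) := by field_simp
    _ ≤ _ := add_le_add (sqrt_mul_root_div_le hp hT hM) hbias

end Problem

end AccZOM

/-! ### Query complexity. -/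

namespace AccZOM

open Metric Set Filter Topology

/-- A dimension-free constant that dominates `M / (√d · log (m + T))`. -/
noncomputable def constM (L σ k c m Δ γ₀ : ℝ) : ℝ :=
  |Δ| / (k * γ₀) + m ^ (1 / 3 : ℝ) * σ ^ 2 / k ^ 2 + 9 * L ^ 2 / (4 * k ^ 2)
    + 2 * k ^ 2 * c ^ 2 * σ ^ 2

/-- The dimension enters only through `1/γ ≤ √d/γ₀` and `T` only through the logarithm; multiplying
every term by `√d * lam ≥ 1` makes the bound uniform. -/
theorem boundM_le {p : Params} {d T : ℕ} {L σ Δ' Δ γ₀ lam : ℝ} (h : p.Valid d T L) (hd : 1 ≤ d)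
    (hγ₀ : 0 < γ₀) (hγ : γ₀ / √d ≤ p.γ) (hΔ : Δ' ≤ Δ) (hlam1 : 1 ≤ lam)
    (hlam : Real.log (p.m + T) ≤ lam) :
    boundM p L σ Δ' T ≤ √d * lam * constM L σ p.k p.c p.m Δ γ₀ := by
  have hk := h.k_pos
  have hm := h.m_ge_two
  have hs : 1 ≤ √(d : ℝ) := Real.one_le_sqrt.2 (by exact_mod_cast hd)
  have hsl : 1 ≤ √(d : ℝ) * lam := one_le_mul_of_one_le_of_one_le hs hlam1
  have hγp := h.γ_pos
  have t1 : Δ' / (p.k * p.γ) ≤ √d * lam * (|Δ| / (p.k * γ₀)) := by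
    calc Δ' / (p.k * p.γ) ≤ |Δ| / (p.k * p.γ) := by
          gcongr; exact hΔ.trans (le_abs_self _)
      _ ≤ |Δ| / (p.k * (γ₀ / √d)) := by gcongr
      _ = √d * 1 * (|Δ| / (p.k * γ₀)) := by field_simp
      _ ≤ _ := by gcongr
  have t2 : ∀ x : ℝ, 0 ≤ x → x ≤ √d * lam * x := fun x hx => le_mul_of_one_le_left hx hsl
  have t3 : 2 * p.k ^ 2 * p.c ^ 2 * σ ^ 2 * Real.log (p.m + T) ≤
      √d * lam * (2 * p.k ^ 2 * p.c ^ 2 * σ ^ 2) := by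
    calc 2 * p.k ^ 2 * p.c ^ 2 * σ ^ 2 * Real.log (p.m + T)
        ≤ 2 * p.k ^ 2 * p.c ^ 2 * σ ^ 2 * lam := by gcongr
      _ = 1 * lam * (2 * p.k ^ 2 * p.c ^ 2 * σ ^ 2) := by ring
      _ ≤ _ := by gcongr
  unfold boundM constM
  rw [mul_add, mul_add, mul_add]
  exact add_le_add (add_le_add (add_le_add t1 (t2 _ (by positivity))) (t2 _ (by positivity))) t3

/-- A dimension-free constant for the gap bound. -/
noncomputable def constK (L σ k c m Δ γ₀ : ℝ) : ℝ :=
  2 * √(2 * constM L σ k c m Δ γ₀) * (m ^ (1 / 6 : ℝ) + 1) + L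

/-- All three terms decay at least like `T^{-1/3}`, and `√(√d)` is `d^{1/4}`. -/
theorem gap_bound_le {p : Params} {d T : ℕ} {L σ Δ' Δ γ₀ lam : ℝ} (h : p.Valid d T L) (hL : 0 < L)
    (hd : 1 ≤ d) (hT : 1 ≤ T) (hγ₀ : 0 < γ₀) (hγ : γ₀ / √d ≤ p.γ) (hΔ : Δ' ≤ Δ) (hlam1 : 1 ≤ lam)
    (hlam : Real.log (p.m + T) ≤ lam) :
    2 * √(2 * boundM p L σ Δ' T) * p.m ^ (1 / 6 : ℝ) / (T : ℝ) ^ (1 / 2 : ℝ)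
      + 2 * √(2 * boundM p L σ Δ' T) / (T : ℝ) ^ (1 / 3 : ℝ)
      + L / (2 * (p.m + T) ^ (2 / 3 : ℝ)) ≤
    √(√d) * √lam * constK L σ p.k p.c p.m Δ γ₀ / (T : ℝ) ^ (1 / 3 : ℝ) := by
  have hm := h.m_ge_two
  have hT' : (1 : ℝ) ≤ T := by exact_mod_cast hT
  have hs : 1 ≤ √(√(d : ℝ)) :=
    Real.one_le_sqrt.2 (Real.one_le_sqrt.2 (by exact_mod_cast hd))
  have hl : 1 ≤ √lam := Real.one_le_sqrt.2 hlam1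
  have hsl : 1 ≤ √(√(d : ℝ)) * √lam := one_le_mul_of_one_le_of_one_le hs hl
  have hR : 0 < (T : ℝ) ^ (1 / 3 : ℝ) := Real.rpow_pos_of_pos (by linarith) _
  have hM : √(2 * boundM p L σ Δ' T) ≤
      √(√d) * √lam * √(2 * constM L σ p.k p.c p.m Δ γ₀) := by
    rw [← Real.sqrt_mul (by positivity), ← Real.sqrt_mul (by positivity)]
    refine Real.sqrt_le_sqrt ?_
    have := boundM_le (L := L) (σ := σ) h hd hγ₀ hγ hΔ hlam1 hlam
    linarith
  have h1 : (T : ℝ) ^ (1 / 3 : ℝ) ≤ (T : ℝ) ^ (1 / 2 : ℝ) :=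
    Real.rpow_le_rpow_of_exponent_le hT' (by norm_num)
  have h2 : (T : ℝ) ^ (1 / 3 : ℝ) ≤ 2 * (p.m + T) ^ (2 / 3 : ℝ) := by
    calc (T : ℝ) ^ (1 / 3 : ℝ) ≤ (T : ℝ) ^ (2 / 3 : ℝ) :=
          Real.rpow_le_rpow_of_exponent_le hT' (by norm_num)
      _ ≤ (p.m + T) ^ (2 / 3 : ℝ) := Real.rpow_le_rpow (by linarith) (by linarith) (by norm_num)
      _ ≤ _ := by
        have : 0 ≤ (p.m + T) ^ (2 / 3 : ℝ) := Real.rpow_nonneg (by linarith) _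
        linarith
  set S := √(2 * boundM p L σ Δ' T)
  set R := (T : ℝ) ^ (1 / 3 : ℝ)
  set N := √(2 * constM L σ p.k p.c p.m Δ γ₀) with hN
  calc _ ≤ 2 * S * p.m ^ (1 / 6 : ℝ) / R + 2 * S / R + L / R := by gcongr
    _ = (2 * S * (p.m ^ (1 / 6 : ℝ) + 1) + L * 1) / R := by ring
    _ ≤ (2 * (√(√d) * √lam * N) * (p.m ^ (1 / 6 : ℝ) + 1) + L * (√(√(d : ℝ)) * √lam)) / R := by
        gcongr
    _ = _ := by unfold constK; rw [← hN]; ring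

/-- The iteration count for accuracy `ε` in dimension `d`, for a constant `b`. -/
noncomputable def iterations (b : ℝ) (d : ℕ) (ε : ℝ) : ℕ :=
  ⌈b ^ 3 * (√(√d) * ε⁻¹ * √(Real.log (2 + d / ε))) ^ 3⌉₊

section Rate

variable {d : ℕ} {ε : ℝ}

theorem one_le_log_two_add (hd : 1 ≤ d) (hε : 0 < ε) (hε1 : ε ≤ 1) :
    1 ≤ Real.log (2 + d / ε) := by
  have hd' : (1 : ℝ) ≤ d := by exact_mod_cast hd
  have h1 : 1 ≤ d / ε := by rw [le_div_iff₀ hε]; linarith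
  rw [Real.le_log_iff_exp_le (by linarith)]
  linarith [Real.exp_one_lt_three]

theorem rate_pow_three (hε : 0 < ε) (hl : 0 ≤ Real.log (2 + d / ε)) :
    (√(√d) * ε⁻¹ * √(Real.log (2 + d / ε))) ^ 3 =
      (d : ℝ) ^ (3 / 4 : ℝ) * ε ^ (-3 : ℝ) * Real.log (2 + d / ε) ^ (3 / 2 : ℝ) := by
  rw [mul_pow, mul_pow]
  congr 1
  · congr 1
    · rw [Real.sqrt_eq_rpow, Real.sqrt_eq_rpow, ← Real.rpow_mul (by positivity),
        ← Real.rpow_natCast, ← Real.rpow_mul (by positivity)]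
      norm_num
    · rw [Real.rpow_neg hε.le, inv_pow]
      norm_cast
  · rw [Real.sqrt_eq_rpow, ← Real.rpow_natCast, ← Real.rpow_mul hl]
    norm_num

theorem one_le_rate (hd : 1 ≤ d) (hε : 0 < ε) (hε1 : ε ≤ 1) :
    1 ≤ √(√d) * ε⁻¹ * √(Real.log (2 + d / ε)) := by
  have hs : 1 ≤ √(√(d : ℝ)) :=
    Real.one_le_sqrt.2 (Real.one_le_sqrt.2 (by exact_mod_cast hd))
  have hl := Real.one_le_sqrt.2 (one_le_log_two_add hd hε hε1)
  exact one_le_mul_of_one_le_of_one_le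
    (one_le_mul_of_one_le_of_one_le hs ((one_le_inv₀ hε).2 hε1)) hl

/-- A crude polynomial bound is enough, since it is used only inside a logarithm. -/
theorem rate_pow_three_le (hd : 1 ≤ d) (hε : 0 < ε) (hε1 : ε ≤ 1) :
    (√(√d) * ε⁻¹ * √(Real.log (2 + d / ε))) ^ 3 ≤ (2 + d / ε) ^ 6 := by
  have hd' : (1 : ℝ) ≤ d := by exact_mod_cast hd
  have hl := one_le_log_two_add hd hε hε1
  have h0 : 0 ≤ d / ε := by positivity
  have h1 : √(√(d : ℝ)) ≤ d := by
    have h2 : √(d : ℝ) ≤ d := Real.sqrt_le_iff.2 ⟨by linarith, by nlinarith⟩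
    exact (Real.sqrt_le_sqrt h2).trans h2
  have h3 : √(Real.log (2 + d / ε)) ≤ 2 + d / ε := by
    have h2 : √(Real.log (2 + d / ε)) ≤ Real.log (2 + d / ε) :=
      Real.sqrt_le_iff.2 ⟨by linarith, by nlinarith⟩
    exact h2.trans (Real.log_le_self (by positivity))
  calc (√(√d) * ε⁻¹ * √(Real.log (2 + d / ε))) ^ 3 ≤ (d * ε⁻¹ * (2 + d / ε)) ^ 3 := by gcongr
    _ = (d / ε * (2 + d / ε)) ^ 3 := by rw [div_eq_mul_inv]
    _ ≤ ((2 + d / ε) * (2 + d / ε)) ^ 3 := by gcongr; linarith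
    _ = _ := by ring

theorem iterations_le {b : ℝ} (hb : 1 ≤ b) (hd : 1 ≤ d) (hε : 0 < ε) (hε1 : ε ≤ 1) :
    (iterations b d ε : ℝ) ≤ 2 * b ^ 3 * (√(√d) * ε⁻¹ * √(Real.log (2 + d / ε))) ^ 3 := by
  have h1 := one_le_rate hd hε hε1
  set Z := √(√(d : ℝ)) * ε⁻¹ * √(Real.log (2 + d / ε))
  have h2 : 1 ≤ b ^ 3 * Z ^ 3 :=
    one_le_mul_of_one_le_of_one_le (one_le_pow₀ hb) (one_le_pow₀ h1)
  have h3 := (Nat.ceil_lt_add_one (show 0 ≤ b ^ 3 * Z ^ 3 by linarith)).le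
  change ((⌈b ^ 3 * Z ^ 3⌉₊ : ℕ) : ℝ) ≤ _
  linarith

theorem one_le_iterations {b : ℝ} (hb : 1 ≤ b) (hd : 1 ≤ d) (hε : 0 < ε) (hε1 : ε ≤ 1) :
    1 ≤ iterations b d ε := by
  have h1 := one_le_rate hd hε hε1
  refine Nat.one_le_ceil_iff.2 ?_
  positivity

theorem le_iterations_rpow {b : ℝ} (hb : 1 ≤ b) (hd : 1 ≤ d) (hε : 0 < ε) (hε1 : ε ≤ 1) :
    b * (√(√d) * ε⁻¹ * √(Real.log (2 + d / ε))) ≤ (iterations b d ε : ℝ) ^ (1 / 3 : ℝ) := by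
  have h1 := one_le_rate hd hε hε1
  set Z := √(√(d : ℝ)) * ε⁻¹ * √(Real.log (2 + d / ε))
  have h2 : (b * Z) ^ 3 ≤ (iterations b d ε : ℝ) := by
    rw [mul_pow]
    exact Nat.le_ceil _
  simpa using le_add_natCast_rpow_of_pow_le (by positivity) h2 0

/-- `T` is polynomial in `2 + d/ε`, so its logarithm is of the order used to define `T`. The
dependence on `b` is kept linear, and `m + 11 = (m + 2) + 3 + 6` adds up the three logarithms. -/
theorem log_iterations_le {b m : ℝ} (hb : 1 ≤ b) (hm : 0 ≤ m) (hd : 1 ≤ d) (hε : 0 < ε)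
    (hε1 : ε ≤ 1) :
    Real.log (m + iterations b d ε) ≤ (m + 11) * b * Real.log (2 + d / ε) := by
  have h1 := iterations_le hb hd hε hε1
  have h2 := rate_pow_three_le hd hε hε1
  have hl := one_le_log_two_add hd hε hε1
  have h0 : 0 ≤ d / ε := by positivity
  set y := 2 + d / ε with hy
  have hb3 : 1 ≤ b ^ 3 := one_le_pow₀ hb
  have hy6 : 1 ≤ y ^ 6 := one_le_pow₀ (by linarith)
  have h3 : m + iterations b d ε ≤ (m + 2) * b ^ 3 * y ^ 6 := by
    have h4 : (1 : ℝ) ≤ b ^ 3 * y ^ 6 := one_le_mul_of_one_le_of_one_le hb3 hy6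
    have h5 : m ≤ m * (b ^ 3 * y ^ 6) := le_mul_of_one_le_right hm h4
    have h6 : 2 * b ^ 3 * (√(√d) * ε⁻¹ * √(Real.log y)) ^ 3 ≤ 2 * b ^ 3 * y ^ 6 := by gcongr
    linarith
  have hpos : 0 < m + iterations b d ε := by
    have : (1 : ℝ) ≤ iterations b d ε := by exact_mod_cast one_le_iterations hb hd hε hε1
    linarith
  have hy0 : 0 < y := by linarith
  have hm2 : Real.log (m + 2) ≤ m + 2 := Real.log_le_self (by linarith)
  have hb2 : Real.log b ≤ b := Real.log_le_self (by linarith)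
  calc Real.log (m + iterations b d ε) ≤ Real.log ((m + 2) * b ^ 3 * y ^ 6) :=
        Real.log_le_log hpos h3
    _ = Real.log (m + 2) + 3 * Real.log b + 6 * Real.log y := by
        rw [Real.log_mul (by positivity) (by positivity), Real.log_mul (by positivity)
          (by positivity), Real.log_pow, Real.log_pow]
        norm_num
    _ ≤ (m + 2) * (b * Real.log y) + 3 * (b * Real.log y) + 6 * (b * Real.log y) := by
        have e1 : 1 ≤ b * Real.log y := one_le_mul_of_one_le_of_one_le hb hl
        have e2 : b ≤ b * Real.log y := le_mul_of_one_le_right (by linarith) hl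
        have e3 : Real.log y ≤ b * Real.log y := le_mul_of_one_le_left (by linarith) hb
        have e4 : m + 2 ≤ (m + 2) * (b * Real.log y) := le_mul_of_one_le_right (by linarith) e1
        linarith
    _ = _ := by ring

end Rate

namespace Problem

variable {d : ℕ} {Ξ Ω : Type*} [MeasurableSpace Ξ] [MeasurableSpace Ω] {Q : Problem d Ξ}
  {L σ : ℝ} {p : Params} {x₁ : Vec d} {Pr : Measure Ω} {ξ : ℕ → Ω → Ξ} {u : ℕ → Ω → USphere d}

theorem Regular.integral_gap_le_of_iterations [NeZero d] {Δ γ₀ ε b fstar : ℝ} (hb1 : 1 ≤ b)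
    (hb : constK L σ p.k p.c p.m Δ γ₀ ^ 2 * (p.m + 11) ≤ b) (hε : 0 < ε) (hε1 : ε ≤ 1)
    {ζ : Ω → Fin (iterations b d ε)} (h : Q.Regular L σ p.μ)
    (hp : p.Valid d (iterations b d ε) L) (hL : 0 < L) (hγ₀ : 0 < γ₀) (hγ : γ₀ / √d ≤ p.γ)
    (hx₁ : x₁ ∈ Q.X) (hf : ∀ x ∈ Q.X, ∀ w : Vec d, ‖w‖ ≤ 1 → fstar ≤ Q.obj (x + p.μ • w))
    (hΔ : smoothing p.μ Q.obj x₁ - fstar ≤ Δ) (hS : IsSampling Q.P Pr ξ u ζ) :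
    ∫ ω, Q.gap p (Q.randomRun p x₁ ξ u (ζ ω) ω) ∂Pr ≤ ε := by
  have hd : 1 ≤ d := NeZero.pos d
  have hd' := cast_pos_of_neZero (d := d)
  have hT := one_le_iterations hb1 hd hε hε1
  have hm := hp.m_ge_two
  have hl := one_le_log_two_add hd hε hε1
  have hlog := log_iterations_le hb1 (m := p.m) (by linarith) hd hε hε1
  have hroot := le_iterations_rpow hb1 hd hε hε1
  set T := iterations b d ε
  set l := Real.log (2 + d / ε)
  set K := constK L σ p.k p.c p.m Δ γ₀
  have hlam1 : 1 ≤ (p.m + 11) * b * l := one_le_mul_of_one_le_of_one_le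
    (one_le_mul_of_one_le_of_one_le (by linarith) hb1) hl
  refine (h.convergence hp hL hT hx₁ hf hS).2.2.2.trans
    ((gap_bound_le hp hL hd hT hγ₀ hγ hΔ hlam1 hlog).trans ?_)
  -- After squaring, the left side is linear in `b` and the right side quadratic, so `K² (m + 11) ≤
  -- b` suffices. This resolves the circularity of `T` depending on `log T`.
  have hK : √((p.m + 11) * b * l) * K ≤ b * √l := by
    refine abs_le_of_sq_le_sq' ?_ (by positivity) |>.2
    rw [mul_pow, mul_pow, Real.sq_sqrt (by positivity), Real.sq_sqrt (by linarith)]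
    calc (p.m + 11) * b * l * K ^ 2 = K ^ 2 * (p.m + 11) * (b * l) := by ring
      _ ≤ b * (b * l) := by gcongr
      _ = _ := by ring
  have hs : 0 < √(√(d : ℝ)) := Real.sqrt_pos.2 (Real.sqrt_pos.2 hd')
  have hsl : 0 < √l := Real.sqrt_pos.2 (by linarith)
  rw [div_le_iff₀ (Real.rpow_pos_of_pos (by exact_mod_cast hT) _)]
  calc √(√d) * √((p.m + 11) * b * l) * K = √(√d) * (√((p.m + 11) * b * l) * K) := by ring
    _ ≤ √(√d) * (b * √l) := by gcongr
    _ = ε * (b * (√(√d) * ε⁻¹ * √l)) := by field_simp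
    _ ≤ _ := by gcongr

end Problem

end AccZOM

theorem theorem1 (L σ : ℝ) (hL : 0 < L) (hσ : 0 < σ) :
    -- the convergence bound
    (∀ (d T : ℕ) (_ : 1 ≤ d) (_ : 1 ≤ T)
      (Ξ : Type uX) [MeasurableSpace Ξ] (Q : AccZOM.Problem d Ξ)
      (p : AccZOM.Params) (_ : p.Valid d T L) (_ : Q.Regular L σ p.μ)
      (x₁ : AccZOM.Vec d) (_ : x₁ ∈ Q.X)
      (fstar : ℝ) (_ : ∀ x ∈ Q.X, ∀ w : AccZOM.Vec d, ‖w‖ ≤ 1 → fstar ≤ Q.obj (x + p.μ • w))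
      (Ω : Type uO) [MeasurableSpace Ω] (Pr : MeasureTheory.Measure Ω)
      (ξ : ℕ → Ω → Ξ) (u : ℕ → Ω → AccZOM.USphere d) (ζ : Ω → Fin T)
      (_ : AccZOM.IsSampling Q.P Pr ξ u ζ),
      let s : ℕ → Ω → AccZOM.State d := fun n ω => Q.run p x₁ (fun t => ξ t ω) (fun t => u t ω) n
      let M : ℝ := AccZOM.boundM p L σ (AccZOM.smoothing p.μ Q.obj x₁ - fstar) T
      (∀ n < T, MeasureTheory.Integrable (fun ω => Q.gap p (s n ω)) Pr) ∧
      MeasureTheory.Integrable (fun ω => Q.gap p (s (ζ ω) ω)) Pr ∧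
      ∫ ω, Q.gap p (s (ζ ω) ω) ∂Pr = 1 / T * ∑ n ∈ Finset.range T, ∫ ω, Q.gap p (s n ω) ∂Pr ∧
      ∫ ω, Q.gap p (s (ζ ω) ω) ∂Pr ≤
        2 * √(2 * M) * p.m ^ (1 / 6 : ℝ) / (T : ℝ) ^ (1 / 2 : ℝ)
          + 2 * √(2 * M) / (T : ℝ) ^ (1 / 3 : ℝ) + L / (2 * (p.m + T) ^ (2 / 3 : ℝ))) ∧
    -- the query complexity
    (∀ (k c m Δ γ₀ : ℝ) (_ : 0 < γ₀), ∃ C : ℝ,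
      ∀ (d : ℕ) (_ : 1 ≤ d) (ε : ℝ) (_ : 0 < ε) (_ : ε ≤ 1), ∃ T : ℕ, 1 ≤ T ∧
        ∀ (Ξ : Type uX) [MeasurableSpace Ξ] (Q : AccZOM.Problem d Ξ)
          (p : AccZOM.Params) (_ : p.k = k) (_ : p.c = c) (_ : p.m = m)
          (_ : p.Valid d T L) (_ : γ₀ / √d ≤ p.γ) (_ : Q.Regular L σ p.μ)
          (x₁ : AccZOM.Vec d) (_ : x₁ ∈ Q.X)
          (fstar : ℝ) (_ : ∀ x ∈ Q.X, ∀ w : AccZOM.Vec d, ‖w‖ ≤ 1 → fstar ≤ Q.obj (x + p.μ • w))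
          (_ : AccZOM.smoothing p.μ Q.obj x₁ - fstar ≤ Δ)
          (Ω : Type uO) [MeasurableSpace Ω] (Pr : MeasureTheory.Measure Ω)
          (ξ : ℕ → Ω → Ξ) (u : ℕ → Ω → AccZOM.USphere d) (ζ : Ω → Fin T)
          (_ : AccZOM.IsSampling Q.P Pr ξ u ζ),
          let s : ℕ → Ω → AccZOM.State d :=
            fun n ω => Q.run p x₁ (fun t => ξ t ω) (fun t => u t ω) n
          (∀ ω, ((s T ω).queries : ℝ) ≤
            C * (d : ℝ) ^ (3 / 4 : ℝ) * ε ^ (-3 : ℝ) * Real.log (2 + d / ε) ^ (3 / 2 : ℝ)) ∧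
          MeasureTheory.Integrable (fun ω => Q.gap p (s (ζ ω) ω)) Pr ∧
          ∫ ω, Q.gap p (s (ζ ω) ω) ∂Pr ≤ ε) := by
  refine ⟨?_, ?_⟩
  · intro d T hd hT Ξ _ Q p hp hQ x₁ hx₁ fstar hf Ω _ Pr ξ u ζ hS
    have : NeZero d := ⟨by omega⟩
    obtain ⟨h1, h2, h3, h4⟩ := hQ.convergence hp hL hT hx₁ hf hS
    exact ⟨fun n _ => h1 n, h2, h3, h4⟩
  · intro k c m Δ γ₀ hγ₀
    -- `b` involves only the fixed constants, neither `d` nor `ε`. The maximum with `1` is what the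
    -- estimates of the iteration count require.
    set b := max 1 (AccZOM.constK L σ k c m Δ γ₀ ^ 2 * (m + 11)) with hb
    have hb1 : 1 ≤ b := le_max_left _ _
    -- With `Z³` the rate, `4T + 2 ≤ 8b³Z³ + 2 ≤ 10b³Z³`, so `14` leaves room.
    refine ⟨14 * b ^ 3, fun d hd ε hε hε1 => ⟨AccZOM.iterations b d ε,
      AccZOM.one_le_iterations hb1 hd hε hε1, ?_⟩⟩
    intro Ξ _ Q p hk hc hm hp hγ hQ x₁ hx₁ fstar hf hΔ Ω _ Pr ξ u ζ hS
    have : NeZero d := ⟨by omega⟩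
    have hT := AccZOM.one_le_iterations hb1 hd hε hε1
    refine ⟨fun ω => ?_, (hQ.convergence hp hL hT hx₁ hf hS).2.1, ?_⟩
    · have hl := AccZOM.one_le_log_two_add hd hε hε1
      have hle := AccZOM.iterations_le hb1 hd hε hε1
      have hZ := one_le_pow₀ (n := 3) (AccZOM.one_le_rate hd hε hε1)
      rw [AccZOM.Problem.queries_run, mul_assoc (14 * b ^ 3), mul_assoc (14 * b ^ 3),
        ← AccZOM.rate_pow_three hε (by linarith)]
      push_cast
      have hb3 : 1 ≤ b ^ 3 := one_le_pow₀ hb1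
      have hbZ := one_le_mul_of_one_le_of_one_le hb3 hZ
      linarith
    · subst hk hc hm
      exact hQ.integral_gap_le_of_iterations hb1 (le_max_right _ _) hε hε1 hp hL hγ₀ hγ hx₁ hf hΔ hS
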